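/- Let $n\ge 2$ and let $\Gamma$ be the star graph consisting of $n$ half-lines $e_j=[0,\infty)$, $1\le j\le n$, joined at their origins. Let $V$ be a real-valued measurable potential on $\Gamma$ with $V_j=V|_{e_j}$ and $$\int_0^\infty (1+x)\,|V_j(x)|\,dx<\infty\qquad (1\le j\le n).$$ Let $H_0$ be the self-adjoint operator in $L_2(\Gamma)=\bigoplus_j L_2(e_j)$ associated with the quadratic form $\phi\mapsto\int_\Gamma|\phi'|^2\,dx$ with form domain $H^1(\Gamma)$ (functions that are $H^1$ on each edge and continuous at the vertex), i.e. $-d^2/dx^2$ with continuity and Kirchhoff conditions. For $z\in\mathbb C\setminus[0,\infty)$ put $R_0(z)=(H_0-z)^{-1}$ and let $$D(z)=\det\bigl(1+\sqrt V\,R_0(z)\sqrt{|V|}\bigr),\qquad \sqrt V=(\operatorname{sgn}V)\sqrt{|V|},$$ be the (modified) perturbation determinant, the Fredholm determinant of a trace class perturbation of the identity. Let $m$ be the dimension of the complex vector space of bounded solutions $u$ on $\Gamma$ of $-u''+Vu=0$ ($u_j\in C^1$, $u_j'$ locally absolutely continuous) satisfying $u_1(0)=\dots=u_n(0)$ and $\sum_{j=1}^n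 u_j'(0)=0$; that is, $m$ is the multiplicity of the resonance at zero energy, and $m=0$ if there is none. If $m=1$, assume in addition that $\int_0^\infty(1+x^2)\,|V_j(x)|\,dx<\infty$ for all $1\le j\le n$. Then $m$ is finite, $D(z)$ is well defined (the operator $\sqrt V R_0(z)\sqrt{|V|}$, defined on the dense set of $f$ with $\sqrt{|V|}f\in L_2(\Gamma)$, extends uniquely to a trace class operator) for every $z=\zeta^2$ with $\operatorname{Im}\zeta>0$, and there is a constant $c\ne 0$ such that, as $\zeta\to 0$ with $\operatorname{Im}\zeta>0$, $$D(\zeta^2)=c\,\zeta^{m-1}\,(1+o(1)).$$ -/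

import Mathlib

open MeasureTheory Filter Topology Set Asymptotics
open scoped InnerProductSpace ComplexConjugate

noncomputable section

namespace StarGraph

section Fredholm

variable {E : Type*} [NormedAddCommGroup E] [InnerProductSpace ℂ E] [CompleteSpace E]

/-- `A` is trace class (nuclear): `A f = ∑ i, ⟪u i, f⟫ v i` with `∑ i, ‖u i‖ ‖v i‖ < ∞`. -/
def IsTraceClass (A : E →L[ℂ] E) : Prop :=
  ∃ u v : ℕ → E, (Summable fun i => ‖u i‖ * ‖v i‖) ∧
    ∀ f : E, HasSum (fun i => ⟪u i, f⟫_ℂ • v i) (A f)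

/-- The determinant of `1 + P A` on the finite-dimensional space `W = span S`, where `P` is the
orthogonal projection onto `W`. -/
def compressedDet (A : E →L[ℂ] E) (S : Finset E) : ℂ :=
  LinearMap.det
    (((1 : Submodule.span ℂ (S : Set E) →L[ℂ] Submodule.span ℂ (S : Set E)) +
      (Submodule.span ℂ (S : Set E)).orthogonalProjectionOnto ∘L A ∘L
        (Submodule.span ℂ (S : Set E)).subtypeL) :
      Submodule.span ℂ (S : Set E) →ₗ[ℂ] Submodule.span ℂ (S : Set E))

/-- `A` is trace class and `d = det (1 + A)` is its Fredholm determinant, i.e. the limit of the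
determinants of `1 + P A P` along the orthogonal projections `P` onto the finite-dimensional
subspaces (directed by inclusion); the limit exists for every trace class operator. -/
def HasFredholmDet (A : E →L[ℂ] E) (d : ℂ) : Prop :=
  IsTraceClass A ∧ Tendsto (compressedDet A) atTop (𝓝 d)

end Fredholm

variable {n : ℕ}

/-- Lebesgue measure on the star graph: `n` half-lines `e_j = [0, ∞)`, whose points are the pairs
`(j, x)` with `x ≥ 0`. -/
def starMeasure (n : ℕ) : Measure (Fin n × ℝ) :=
  Measure.count.prod (volume.restrict (Ioi (0 : ℝ)))

/-- The Hilbert space `L₂(Γ) = ⊕ L₂(e_j)`. -/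
abbrev StarL2 (n : ℕ) : Type := Lp ℂ 2 (starMeasure n)

/-- `V` is measurable and `∫_{e_j} (1 + x) |V_j(x)| dx < ∞` for all `j`. -/
def FirstMoment (V : Fin n → ℝ → ℝ) : Prop :=
  ∀ j, IntegrableOn (fun x => (1 + x) * V j x) (Ioi 0) volume

/-- `V` is measurable and `∫_{e_j} (1 + x²) |V_j(x)| dx < ∞` for all `j`. -/
def SecondMoment (V : Fin n → ℝ → ℝ) : Prop :=
  ∀ j, IntegrableOn (fun x => (1 + x ^ 2) * V j x) (Ioi 0) volume

/-- `u ∈ H¹(Γ)` with derivative `du`: on every edge `u` and `du` are square integrable and `u` is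
the absolutely continuous primitive of `du`, and `u` is continuous at the vertex.  Only the values
at `x ≥ 0` matter. -/
structure MemH1 (u du : Fin n → ℝ → ℂ) : Prop where
  memLp : ∀ j, MemLp (u j) 2 (volume.restrict (Ioi 0))
  memLp_deriv : ∀ j, MemLp (du j) 2 (volume.restrict (Ioi 0))
  eq_integral : ∀ j x, 0 ≤ x → u j x = u j 0 + ∫ t in (0 : ℝ)..x, du j t
  vertex : ∀ i j, u i 0 = u j 0

/-- `ψ` lies in the domain of the Schrödinger operator `H` on `L₂(Γ)` and `H ψ = f`, where `H` is
the operator of the quadratic form `∫_Γ |φ'|² + ∫_Γ V |φ|²` with form domain `H¹(Γ)`: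
`ψ ∈ H¹(Γ)`, and the sesquilinear form satisfies `h(ψ, φ) = (f, φ)` for all `φ ∈ H¹(Γ)`. -/
def OperatorEq (V : Fin n → ℝ → ℝ) (ψ f : StarL2 n) : Prop :=
  ∃ u du : Fin n → ℝ → ℂ, MemH1 u du ∧ (ψ =ᵐ[starMeasure n] fun p => u p.1 p.2) ∧
    ∀ φ dφ : Fin n → ℝ → ℂ, MemH1 φ dφ →
      (∑ j, ∫ x in Ioi (0 : ℝ), du j x * conj (dφ j x)) +
          ∑ j, ∫ x in Ioi (0 : ℝ), (V j x : ℂ) * u j x * conj (φ j x) =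
        ∑ j, ∫ x in Ioi (0 : ℝ), f (j, x) * conj (φ j x)

/-- `R = (H - z)⁻¹`: the bounded operator `R` maps into the domain of `H` and is a two-sided
inverse of `H - z`. -/
def IsResolvent (V : Fin n → ℝ → ℝ) (z : ℂ) (R : StarL2 n →L[ℂ] StarL2 n) : Prop :=
  (∀ f, OperatorEq V (R f) (f + z • R f)) ∧
    ∀ ψ f, OperatorEq V ψ f → R (f - z • ψ) = ψ

/-- `A` is the bounded operator `√V R √|V|`, with `√V = (sgn V) √|V|`: whenever `g = √|V| f` lies
in `L₂(Γ)`, which holds for a dense set of `f`, one has `A f = √V R g`. -/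
def IsSandwich (V : Fin n → ℝ → ℝ) (R A : StarL2 n →L[ℂ] StarL2 n) : Prop :=
  ∀ f g : StarL2 n,
    (g =ᵐ[starMeasure n] fun p => (Real.sqrt |V p.1 p.2| : ℂ) * f p) →
      A f =ᵐ[starMeasure n]
        fun p => ((Real.sign (V p.1 p.2) * Real.sqrt |V p.1 p.2| : ℝ) : ℂ) * R g p

/-- `d = det (1 + √V R₀(z) √|V|)`, where `R₀(z)` is the resolvent at `z` of the operator `H₀` with
zero potential. -/
def IsPerturbationDet (V : Fin n → ℝ → ℝ) (z d : ℂ) : Prop :=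
  ∃ R A : StarL2 n →L[ℂ] StarL2 n,
    IsResolvent (0 : Fin n → ℝ → ℝ) z R ∧ IsSandwich V R A ∧ HasFredholmDet A d

open Classical in
/-- The perturbation determinant `D(z) = det (1 + √V R₀(z) √|V|)`. -/
def perturbationDet (V : Fin n → ℝ → ℝ) (z : ℂ) : ℂ :=
  if h : ∃ d, IsPerturbationDet V z d then h.choose else 0

/-- `u` is a bounded solution of `-u'' + V u = 0` on the star graph with derivative `du`, subject
to the continuity and Kirchhoff conditions at the vertex.  As usual, `u` is continuously
differentiable and `u'` is absolutely continuous with `u'' = V u` almost everywhere. -/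
structure IsZeroEnergySolution (V : Fin n → ℝ → ℝ) (u du : Fin n → ℝ → ℂ) : Prop where
  hasDeriv : ∀ j x, 0 ≤ x → HasDerivWithinAt (u j) (du j x) (Ici 0) x
  integrable : ∀ j x, 0 ≤ x → IntervalIntegrable (fun t => (V j t : ℂ) * u j t) volume 0 x
  deriv_eq : ∀ j x, 0 ≤ x → du j x = du j 0 + ∫ t in (0 : ℝ)..x, (V j t : ℂ) * u j t
  bounded : ∃ C : ℝ, ∀ j x, 0 ≤ x → ‖u j x‖ ≤ C
  vertex : ∀ i j, u i 0 = u j 0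
  kirchhoff : ∑ j, du j 0 = 0

/-- The complex vector space of bounded zero-energy solutions.  A function on an edge `[0, ∞)` is
represented by its extension by zero to the negative half-line. -/
def zeroEnergySpace (V : Fin n → ℝ → ℝ) : Submodule ℂ (Fin n → ℝ → ℂ) where
  carrier := {u | (∀ j x, x < 0 → u j x = 0) ∧ ∃ du, IsZeroEnergySolution V u du}
  zero_mem' := by
    refine ⟨fun _ _ _ => rfl, 0, ?_⟩
    constructor
    · intro j x _
      exact hasDerivWithinAt_const x (Ici 0) (0 : ℂ)
    · intro j x _
      simp
    · intro j x _
      simp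
    · exact ⟨0, fun j x _ => by simp⟩
    · intro i j
      rfl
    · simp
  add_mem' := by
    rintro u v ⟨hu0, du, hu⟩ ⟨hv0, dv, hv⟩
    refine ⟨fun j x hx => by simp [hu0 j x hx, hv0 j x hx], du + dv, ?_⟩
    have e : ∀ j, (fun t => (V j t : ℂ) * (u + v) j t) =
        fun t => (V j t : ℂ) * u j t + (V j t : ℂ) * v j t := by
      intro j
      funext t
      simp [mul_add]
    constructor
    · intro j x hx
      exact (hu.hasDeriv j x hx).add (hv.hasDeriv j x hx)
    · intro j x hx
      rw [e j]
      exact (hu.integrable j x hx).add (hv.integrable j x hx)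
    · intro j x hx
      rw [e j, intervalIntegral.integral_add (hu.integrable j x hx) (hv.integrable j x hx)]
      simp only [Pi.add_apply]
      rw [hu.deriv_eq j x hx, hv.deriv_eq j x hx]
      ring
    · obtain ⟨C, hC⟩ := hu.bounded
      obtain ⟨C', hC'⟩ := hv.bounded
      exact ⟨C + C', fun j x hx =>
        (norm_add_le (u j x) (v j x)).trans (add_le_add (hC j x hx) (hC' j x hx))⟩
    · intro i j
      simp only [Pi.add_apply]
      rw [hu.vertex i j, hv.vertex i j]
    · simp only [Pi.add_apply, Finset.sum_add_distrib]
      rw [hu.kirchhoff, hv.kirchhoff, add_zero]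
  smul_mem' := by
    rintro a u ⟨hu0, du, hu⟩
    refine ⟨fun j x hx => by simp [hu0 j x hx], a • du, ?_⟩
    have e : ∀ j, (fun t => (V j t : ℂ) * (a • u) j t) =
        fun t => a * ((V j t : ℂ) * u j t) := by
      intro j
      funext t
      simp only [Pi.smul_apply, smul_eq_mul]
      ring
    constructor
    · intro j x hx
      exact (hu.hasDeriv j x hx).const_smul a
    · intro j x hx
      rw [e j]
      exact (hu.integrable j x hx).const_mul a
    · intro j x hx
      rw [e j, intervalIntegral.integral_const_mul]
      simp only [Pi.smul_apply, smul_eq_mul]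
      rw [hu.deriv_eq j x hx]
      ring
    · obtain ⟨C, hC⟩ := hu.bounded
      refine ⟨‖a‖ * C, fun j x hx => ?_⟩
      simp only [Pi.smul_apply, norm_smul]
      exact mul_le_mul_of_nonneg_left (hC j x hx) (norm_nonneg a)
    · intro i j
      simp only [Pi.smul_apply]
      rw [hu.vertex i j]
    · simp only [Pi.smul_apply]
      rw [← Finset.smul_sum, hu.kirchhoff, smul_zero]

/-- The multiplicity `m` of the resonance at zero energy; `m = 0` if there is no resonance. -/
def resonanceMultiplicity (V : Fin n → ℝ → ℝ) : ℕ :=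
  Module.finrank ℂ (zeroEnergySpace V)

end StarGraph

end

/-!
The perturbation determinant is computed in terms of Jost functions, and the Jost functions are
expanded at zero energy.

**The determinant.** On each edge let `θ_j(x) = e^{iζx} g_j(x)` be the Jost solution of
`-θ'' + V_j θ = ζ² θ`.  Then `D(ζ²) = (i / nζ) ∑_j L_j ∏_{k ≠ j} G_k` with `G_j = θ_j(0)` and
`L_j = -θ_j'(0)` (`isPerturbationDet_vertexSum`).  The free resolvent (`resolventFun`) is explicit.
If `V` has bounded support, then variation of constants from infinity writes the sandwiched
resolvent as `-K` plus an operator of rank `n`, where `K` is a Volterra operator.  Conjugation by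
exponential weights makes the trace norm of `K` arbitrarily small, so that `det (1 - K) = 1`
(`exists_volterra`); and `(1 - K)⁻¹` maps `a e^{iζx}` to `a θ_j`, so that a determinant of size `n`
remains (`tendsto_compressedDet_of_truncated`).  Truncation of `V` gives the general case, the
Fredholm determinant being continuous in the trace norm (`tendsto_fredholmDet`).

**The Fredholm determinant.** All that is needed of it follows from the bound
`|det (1 + T)| ≤ exp (τ + τ² / 2)` in terms of the trace norm `τ`, which does not depend on the
dimension, and the Schwarz lemma (`NuclearLE.norm_det_sub_le`): the existence of the limit that
defines it, its continuity, and its invariance under similarity.  The sandwiched resolvent is trace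
class because its main part factors through the kernel `1_{t < x} e^{iζ(x - t)}` into two
Hilbert–Schmidt operators.

**Zero energy.** Let `a_j = θ_j(0)` and `β_j = -θ_j'(0)` at `ζ = 0`, which are real numbers.  The
bounded solutions on an edge are the multiples of `θ_j`, so that `m` is the dimension of the space
of `c` with `c_i a_i = c_j a_j` and `∑ c_j β_j = 0` (`zeroEnergySpace_eq_map`).  Integrating the
Wronskian of the Jost solutions at energies `0` and `ζ²` gives
`β_j G_j - a_j L_j = iζ (1 + o(1))` (`tendsto_jost_wronskian`), a first order expansion that
requires only the first moment of `V`.  It determines the order of vanishing of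
`∑_j L_j ∏_{k ≠ j} G_k` (`exists_tendsto_vertexSum`).  If some `a_j` vanish, the corresponding
`G_j` are `∼ iζ / β_j`, the order is one less than their number, and so is `m`.  If none vanishes,
the sum tends to `∏ a_j · ∑ β_j / a_j`; when this is zero, which is the case `m = 1`, the expansion
yields the nonzero coefficient `-i ∏ a_j · ∑ a_j⁻²` of `ζ`.
-/

noncomputable section

namespace StarGraph

/-! ### Nuclear operators -/

section Nuclear

variable {E : Type*} [NormedAddCommGroup E] [InnerProductSpace ℂ E]

/-- `A` has a nuclear representation `A f = ∑ i, ⟪u i, f⟫ v i` with `∑ i, ‖u i‖ ‖v i‖ ≤ τ`; in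
other words, `τ` dominates the trace norm of `A`. -/
def NuclearLE (A : E →L[ℂ] E) (τ : ℝ) : Prop :=
  ∃ u v : ℕ → E, (Summable fun i => ‖u i‖ * ‖v i‖) ∧ ∑' i, ‖u i‖ * ‖v i‖ ≤ τ ∧
    ∀ f : E, HasSum (fun i => ⟪u i, f⟫_ℂ • v i) (A f)

theorem NuclearLE.isTraceClass [CompleteSpace E] {A : E →L[ℂ] E} {τ : ℝ} (h : NuclearLE A τ) :
    IsTraceClass A := by
  obtain ⟨u, v, hs, -, h⟩ := h
  exact ⟨u, v, hs, h⟩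

theorem NuclearLE.nonneg {A : E →L[ℂ] E} {τ : ℝ} (h : NuclearLE A τ) : 0 ≤ τ := by
  obtain ⟨u, v, -, hτ, -⟩ := h
  exact (tsum_nonneg fun i => by positivity).trans hτ

theorem NuclearLE.mono {A : E →L[ℂ] E} {τ σ : ℝ} (h : NuclearLE A τ) (hτ : τ ≤ σ) :
    NuclearLE A σ := by
  obtain ⟨u, v, hs, h1, h2⟩ := h
  exact ⟨u, v, hs, h1.trans hτ, h2⟩

theorem nuclearLE_zero : NuclearLE (0 : E →L[ℂ] E) 0 :=
  ⟨0, 0, by simp, by simp, fun f => by simp⟩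

theorem nuclearLE_rankOne (u v : E) (A : E →L[ℂ] E) (hA : ∀ f, A f = ⟪u, f⟫_ℂ • v) :
    NuclearLE A (‖u‖ * ‖v‖) := by
  have key : HasSum (fun i : ℕ => ‖(Pi.single 0 u : ℕ → E) i‖ * ‖(Pi.single 0 v : ℕ → E) i‖)
      (‖u‖ * ‖v‖) := by
    convert! hasSum_single (0 : ℕ) ?_
    intro i hi
    simp [hi]
  refine ⟨Pi.single 0 u, Pi.single 0 v, key.summable, key.tsum_eq.le, fun f => ?_⟩
  rw [hA]
  convert! hasSum_single (0 : ℕ) ?_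
  intro i hi
  simp [hi]

theorem NuclearLE.neg {A : E →L[ℂ] E} {τ : ℝ} (h : NuclearLE A τ) : NuclearLE (-A) τ := by
  obtain ⟨u, v, hs, h1, h2⟩ := h
  exact ⟨u, fun i => -v i, by simpa using hs, by simpa using h1,
    fun f => by simpa using (h2 f).neg⟩

theorem NuclearLE.smul {A : E →L[ℂ] E} {τ : ℝ} (h : NuclearLE A τ) (c : ℂ) :
    NuclearLE (c • A) (‖c‖ * τ) := by
  obtain ⟨u, v, hs, h1, h2⟩ := h
  have e : (fun i => ‖u i‖ * ‖c • v i‖) = fun i => ‖c‖ * (‖u i‖ * ‖v i‖) := by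
    funext i
    rw [norm_smul]
    ring
  refine ⟨u, fun i => c • v i, ?_, ?_, fun f => ?_⟩
  · rw [e]
    exact hs.mul_left _
  · rw [e, tsum_mul_left]
    gcongr
  · simpa [smul_comm _ c] using (h2 f).const_smul c

/-- Two sequences are merged into one, as needed for the sum of two nuclear representations. -/
theorem hasSum_interleave {M : Type*} [AddCommMonoid M] [TopologicalSpace M] [ContinuousAdd M]
    {a b : ℕ → M} {x y : M} (ha : HasSum a x) (hb : HasSum b y) :
    HasSum (fun k => Sum.elim a b (Equiv.natSumNatEquivNat.symm k)) (x + y) := by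
  refine (Equiv.hasSum_iff Equiv.natSumNatEquivNat.symm (f := Sum.elim a b)).2 ?_
  exact HasSum.sum (f := Sum.elim a b) ha hb

theorem NuclearLE.add {A B : E →L[ℂ] E} {τ σ : ℝ} (hA : NuclearLE A τ) (hB : NuclearLE B σ) :
    NuclearLE (A + B) (τ + σ) := by
  obtain ⟨u, v, hs, h1, h2⟩ := hA
  obtain ⟨u', v', hs', h1', h2'⟩ := hB
  have key := hasSum_interleave hs.hasSum hs'.hasSum
  have e : (fun k => Sum.elim (fun i => ‖u i‖ * ‖v i‖) (fun i => ‖u' i‖ * ‖v' i‖)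
      (Equiv.natSumNatEquivNat.symm k)) =
      fun k => ‖Sum.elim u u' (Equiv.natSumNatEquivNat.symm k)‖ *
        ‖Sum.elim v v' (Equiv.natSumNatEquivNat.symm k)‖ := by
    funext k
    cases Equiv.natSumNatEquivNat.symm k <;> rfl
  rw [e] at key
  refine ⟨fun k => Sum.elim u u' (Equiv.natSumNatEquivNat.symm k),
    fun k => Sum.elim v v' (Equiv.natSumNatEquivNat.symm k), key.summable, ?_, fun f => ?_⟩
  · rw [key.tsum_eq]
    exact add_le_add h1 h1'
  · have := hasSum_interleave (h2 f) (h2' f)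
    convert! this using 1
    funext k
    dsimp only
    cases Equiv.natSumNatEquivNat.symm k <;> rfl

theorem NuclearLE.norm_le {A : E →L[ℂ] E} {τ : ℝ} (h : NuclearLE A τ) : ‖A‖ ≤ τ := by
  have h0 := h.nonneg
  obtain ⟨u, v, hs, h1, h2⟩ := h
  refine A.opNorm_le_bound h0 fun f => ?_
  have hs' : HasSum (fun i => ‖u i‖ * ‖v i‖ * ‖f‖) ((∑' i, ‖u i‖ * ‖v i‖) * ‖f‖) :=
    hs.hasSum.mul_right _
  refine ((h2 f).norm_le_of_bounded hs' fun i => ?_).trans ?_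
  · rw [norm_smul]
    calc ‖⟪u i, f⟫_ℂ‖ * ‖v i‖ ≤ ‖u i‖ * ‖f‖ * ‖v i‖ := by
          gcongr
          exact norm_inner_le_norm _ _
      _ = _ := by ring
  · gcongr

/-- Compression to a subspace does not increase the trace norm. -/
theorem NuclearLE.compress {A : E →L[ℂ] E} {τ : ℝ} (h : NuclearLE A τ) (W : Submodule ℂ E)
    [W.HasOrthogonalProjection] :
    NuclearLE (W.orthogonalProjectionOnto ∘L A ∘L W.subtypeL) τ := by
  obtain ⟨u, v, hs, h1, h2⟩ := h
  have hle : ∀ i, ‖W.orthogonalProjectionOnto (u i)‖ * ‖W.orthogonalProjectionOnto (v i)‖ ≤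
      ‖u i‖ * ‖v i‖ := fun i => by
    gcongr
    · exact W.norm_orthogonalProjectionOnto_apply_le _
    · exact W.norm_orthogonalProjectionOnto_apply_le _
  have hs' := Summable.of_nonneg_of_le (fun i => by positivity) hle hs
  refine ⟨fun i => W.orthogonalProjectionOnto (u i), fun i => W.orthogonalProjectionOnto (v i),
    hs', (hs'.tsum_le_tsum hle hs).trans h1, fun f => ?_⟩
  have := (h2 f).mapL W.orthogonalProjectionOnto
  convert! this using 1
  funext i
  rw [map_smul, Submodule.inner_orthogonalProjectionOnto_eq_of_mem_right]

end Nuclear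

/-! ### Determinants and trace norms in finite dimension -/

section FiniteDimensional

variable {W : Type*} [NormedAddCommGroup W] [InnerProductSpace ℂ W] [FiniteDimensional ℂ W]

/-- `|tr (T B)| ≤ ‖T‖₁ ‖B‖`. -/
theorem NuclearLE.norm_trace_le {T : W →L[ℂ] W} {τ : ℝ} (h : NuclearLE T τ) (B : W →L[ℂ] W) :
    ‖LinearMap.trace ℂ W ((T : W →ₗ[ℂ] W) ∘ₗ (B : W →ₗ[ℂ] W))‖ ≤ τ * ‖B‖ := by
  obtain ⟨u, v, hs, h1, h2⟩ := h
  have b := stdOrthonormalBasis ℂ W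
  have key : HasSum (fun i => ⟪u i, B (v i)⟫_ℂ)
      (LinearMap.trace ℂ W ((T : W →ₗ[ℂ] W) ∘ₗ (B : W →ₗ[ℂ] W))) := by
    rw [LinearMap.trace_eq_sum_inner _ b]
    have := hasSum_sum (s := Finset.univ) fun k _ =>
      (h2 (B (b k))).mapL (innerSL ℂ (b k))
    convert! this using 1
    funext i
    conv_lhs => rw [← b.sum_repr' (v i)]
    simp only [map_sum, map_smul, inner_sum, inner_smul_right, innerSL_apply_apply]
    exact Finset.sum_congr rfl fun k _ => mul_comm _ _
  refine (key.norm_le_of_bounded (hs.hasSum.mul_right ‖B‖) fun i => ?_).trans ?_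
  · calc _ ≤ ‖u i‖ * ‖B (v i)‖ := norm_inner_le_norm _ _
      _ ≤ ‖u i‖ * (‖B‖ * ‖v i‖) := by
          gcongr
          exact B.le_opNorm _
      _ = _ := by ring
  · gcongr

theorem det_adjoint_eq_conj (S : W →ₗ[ℂ] W) :
    LinearMap.det (LinearMap.adjoint S) = conj (LinearMap.det S) := by
  have b := stdOrthonormalBasis ℂ W
  rw [← LinearMap.det_toMatrix b.toBasis, LinearMap.toMatrix_adjoint, Matrix.det_conjTranspose,
    LinearMap.det_toMatrix]
  rfl

theorem trace_adjoint_eq_conj (S : W →ₗ[ℂ] W) :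
    LinearMap.trace ℂ W (LinearMap.adjoint S) = conj (LinearMap.trace ℂ W S) := by
  have b := stdOrthonormalBasis ℂ W
  simp [LinearMap.trace_eq_sum_inner _ b, LinearMap.adjoint_inner_right]

/-- `|det S|² = ∏ λ ≤ exp (∑ (λ - 1))`, the `λ` being the eigenvalues of `S* S`. -/
theorem norm_det_sq_le (S : W →ₗ[ℂ] W) :
    ‖LinearMap.det S‖ ^ 2 ≤
      Real.exp ((LinearMap.trace ℂ W (LinearMap.adjoint S ∘ₗ S)).re - Module.finrank ℂ W) := by
  have hpos := LinearMap.isPositive_adjoint_comp_self S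
  have hsym := hpos.isSymmetric
  have hdet := hsym.det_eq_prod_eigenvalues rfl
  have htr := hsym.trace_eq_sum_eigenvalues rfl
  rw [htr, LinearMap.det_comp, det_adjoint_eq_conj, ← Complex.normSq_eq_conj_mul_self,
    Complex.normSq_eq_norm_sq] at *
  have h2 : ‖LinearMap.det S‖ ^ 2 = ∏ i, hsym.eigenvalues rfl i := by
    apply Complex.ofReal_injective
    rw [hdet]
    simp
  rw [h2]
  have h3 : ∑ i, hsym.eigenvalues rfl i - Module.finrank ℂ W =
      ∑ i, (hsym.eigenvalues rfl i - 1) := by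
    simp
  simp only [RCLike.ofReal_eq_complex_ofReal, Complex.ofReal_re] at *
  rw [h3, Real.exp_sum]
  refine Finset.prod_le_prod (fun i _ => hpos.nonneg_eigenvalues rfl i) fun i _ => ?_
  have := Real.add_one_le_exp (hsym.eigenvalues rfl i - 1)
  linarith

/-- A bound for the determinant that does not depend on the dimension: apply `norm_det_sq_le` to
`1 + T`, whose square is `1 + T + T* + T* T`. -/
theorem NuclearLE.norm_det_le {T : W →L[ℂ] W} {τ : ℝ} (h : NuclearLE T τ) :
    ‖LinearMap.det ((1 + T : W →L[ℂ] W) : W →ₗ[ℂ] W)‖ ≤ Real.exp (τ + τ ^ 2 / 2) := by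
  have h0 := h.nonneg
  set T' : W →ₗ[ℂ] W := (T : W →ₗ[ℂ] W)
  have e1 : ((1 + T : W →L[ℂ] W) : W →ₗ[ℂ] W) = 1 + T' := rfl
  have e2 : LinearMap.adjoint (1 + T') ∘ₗ (1 + T') =
      1 + T' + LinearMap.adjoint T' + LinearMap.adjoint T' ∘ₗ T' := by
    ext w
    have : LinearMap.adjoint (1 : W →ₗ[ℂ] W) = 1 := LinearMap.adjoint_id
    simp [map_add, this]
    abel
  have t1 : ‖LinearMap.trace ℂ W T'‖ ≤ τ := by
    have := h.norm_trace_le 1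
    refine this.trans ?_
    have : ‖(1 : W →L[ℂ] W)‖ ≤ 1 := ContinuousLinearMap.norm_id_le
    nlinarith
  have t2 : ‖LinearMap.trace ℂ W (LinearMap.adjoint T' ∘ₗ T')‖ ≤ τ ^ 2 := by
    have := h.norm_trace_le (LinearMap.toContinuousLinearMap (LinearMap.adjoint T'))
    have hn : ‖LinearMap.toContinuousLinearMap (LinearMap.adjoint T')‖ ≤ τ := by
      have e : LinearMap.toContinuousLinearMap (LinearMap.adjoint T') =
          ContinuousLinearMap.adjoint (E := W) (F := W) T := by
        ext w
        refine ext_inner_left ℂ fun z => ?_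
        simp [LinearMap.adjoint_inner_right, ContinuousLinearMap.adjoint_inner_right, T']
      rw [e]
      simpa using h.norm_le
    rw [LinearMap.trace_comp_comm']
    refine this.trans ?_
    nlinarith
  have key := norm_det_sq_le (1 + T')
  rw [e2, map_add (LinearMap.trace ℂ W), map_add (LinearMap.trace ℂ W),
    map_add (LinearMap.trace ℂ W), trace_adjoint_eq_conj, LinearMap.trace_one] at key
  have key2 : ‖LinearMap.det (1 + T')‖ ^ 2 ≤ Real.exp (τ + τ ^ 2 / 2) ^ 2 := by
    refine key.trans ?_
    rw [← Real.exp_nat_mul]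
    refine Real.exp_le_exp.2 ?_
    have a1 := (Complex.re_le_norm _).trans t1
    have a2 := (Complex.re_le_norm _).trans t2
    simp only [Complex.add_re, Complex.natCast_re, Complex.conj_re]
    push_cast
    linarith
  rw [e1]
  exact le_of_sq_le_sq key2 (Real.exp_pos _).le

theorem differentiable_det_pencil (S T : W →ₗ[ℂ] W) :
    Differentiable ℂ fun z : ℂ => LinearMap.det (S + z • T) := by
  have b := Module.finBasis ℂ W
  have e : (fun z : ℂ => LinearMap.det (S + z • T)) = fun z =>
      (LinearMap.toMatrix b b S + z • LinearMap.toMatrix b b T).det := by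
    funext z
    rw [← LinearMap.det_toMatrix b, map_add, map_smul]
  rw [e]
  simp only [Matrix.det_apply, Matrix.add_apply, Matrix.smul_apply]
  fun_prop

/-- Lipschitz continuity of the determinant in the trace norm, with a constant that does not
depend on the dimension: the pencil `z ↦ det (1 + T' + z (T - T'))` is bounded on the disc of
radius `1 / δ`, and the Schwarz lemma applies. -/
theorem NuclearLE.norm_det_sub_le {T T' : W →L[ℂ] W} {τ δ : ℝ} (h' : NuclearLE T' τ)
    (h : NuclearLE (T - T') δ) (h0 : 0 < δ) (h1 : δ < 1) :
    ‖LinearMap.det ((1 + T : W →L[ℂ] W) : W →ₗ[ℂ] W) -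
      LinearMap.det ((1 + T' : W →L[ℂ] W) : W →ₗ[ℂ] W)‖ ≤
      2 * Real.exp ((τ + 1) + (τ + 1) ^ 2 / 2) * δ := by
  set C := Real.exp ((τ + 1) + (τ + 1) ^ 2 / 2)
  set f : ℂ → ℂ := fun z => LinearMap.det
    (((1 + T' : W →L[ℂ] W) : W →ₗ[ℂ] W) + z • ((T - T' : W →L[ℂ] W) : W →ₗ[ℂ] W)) with hf
  have fd : Differentiable ℂ f := differentiable_det_pencil _ _
  have bd : ∀ z ∈ Metric.ball (0 : ℂ) (1 / δ), ‖f z‖ ≤ C := by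
    intro z hz
    have hz' : ‖z‖ * δ ≤ 1 := by
      have : ‖z‖ < 1 / δ := by simpa using hz
      rw [lt_div_iff₀ h0] at this
      exact this.le
    have hn := (h'.add (h.smul z)).mono (σ := τ + 1) (by linarith)
    have := hn.norm_det_le
    have e : f z = LinearMap.det ((1 + (T' + z • (T - T')) : W →L[ℂ] W) : W →ₗ[ℂ] W) := by
      simp only [hf]
      congr 1
      ext w
      simp [add_assoc]
    rw [e]
    exact this
  have m0 : (0 : ℂ) ∈ Metric.ball (0 : ℂ) (1 / δ) := by simpa using h0
  have m1 : (1 : ℂ) ∈ Metric.ball (0 : ℂ) (1 / δ) := by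
    simpa using (one_lt_inv₀ h0).2 h1
  have := Complex.dist_le_div_mul_dist_of_mapsTo_ball (R₁ := 1 / δ) (R₂ := 2 * C) (f := f)
    fd.differentiableOn (fun z hz => by
      rw [Metric.mem_closedBall, dist_eq_norm]
      refine (norm_sub_le _ _).trans ?_
      linarith [bd z hz, bd 0 m0]) m1
  rw [dist_eq_norm] at this
  have e0 : f 0 = LinearMap.det ((1 + T' : W →L[ℂ] W) : W →ₗ[ℂ] W) := by simp [hf]
  have e1 : f 1 = LinearMap.det ((1 + T : W →L[ℂ] W) : W →ₗ[ℂ] W) := by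
    simp only [hf]
    congr 1
    ext w
    simp
  rw [e0, e1] at this
  simpa using this

/-- The determinant of a finite-rank perturbation of the identity (Weinstein–Aronszajn). -/
theorem det_one_add_sum_rankOne {ι : Type*} [Fintype ι] [DecidableEq ι] (ℓ : ι → W →ₗ[ℂ] ℂ)
    (f : ι → W) :
    LinearMap.det (1 + ∑ i, (ℓ i).smulRight (f i) : W →ₗ[ℂ] W) =
      (1 + Matrix.of fun i j => ℓ i (f j)).det := by
  have b := Module.finBasis ℂ W
  set P : Matrix (Fin (Module.finrank ℂ W)) ι ℂ := Matrix.of fun k j => b.repr (f j) k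
  set Q : Matrix ι (Fin (Module.finrank ℂ W)) ℂ := Matrix.of fun i k => ℓ i (b k)
  have e1 : LinearMap.toMatrix b b (1 + ∑ i, (ℓ i).smulRight (f i)) = 1 + P * Q := by
    rw [map_add, LinearMap.toMatrix_one]
    congr 1
    ext k l
    simp [LinearMap.toMatrix_apply, Matrix.mul_apply, P, Q, mul_comm]
  have e2 : (Matrix.of fun i j => ℓ i (f j)) = Q * P := by
    ext i j
    conv_lhs => rw [Matrix.of_apply, ← b.sum_repr (f j)]
    rw [map_sum]
    simp [Matrix.mul_apply, P, Q, mul_comm]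
  rw [← LinearMap.det_toMatrix b, e1, e2, Matrix.det_one_add_mul_comm]

end FiniteDimensional

/-! ### The Fredholm determinant -/

section FredholmDeterminant

variable {E : Type*} [NormedAddCommGroup E] [InnerProductSpace ℂ E]

/-- The compressed determinants are Lipschitz continuous in the trace norm, uniformly in the
subspace. -/
theorem norm_compressedDet_sub_le {A A' : E →L[ℂ] E} {τ δ : ℝ} (h' : NuclearLE A' τ)
    (h : NuclearLE (A - A') δ) (h0 : 0 < δ) (h1 : δ < 1) (S : Finset E) :
    ‖compressedDet A S - compressedDet A' S‖ ≤ 2 * Real.exp ((τ + 1) + (τ + 1) ^ 2 / 2) * δ := by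
  refine NuclearLE.norm_det_sub_le (h'.compress _) ?_ h0 h1
  have := h.compress (Submodule.span ℂ (S : Set E))
  convert this using 1
  ext x
  simp

@[simp]
theorem compressedDet_zero (S : Finset E) : compressedDet (0 : E →L[ℂ] E) S = 1 := by
  simp [compressedDet]

/-- If `A = K + ∑ ℓᵢ(·) (1 + K) fᵢ`, then `1 + A = (1 + K)(1 + ∑ ℓᵢ(·) fᵢ)`; this factorization
survives the compression to every subspace that contains the `fᵢ`. -/
theorem compressedDet_finiteRank_update {ι : Type*} [Fintype ι] [DecidableEq ι]
    {A K : E →L[ℂ] E} (ℓ : ι → E →ₗ[ℂ] ℂ) (f : ι → E)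
    (hA : ∀ x, A x = K x + ∑ i, ℓ i x • (f i + K (f i))) (S : Finset E) (hS : ∀ i, f i ∈ S) :
    compressedDet A S = compressedDet K S * (1 + Matrix.of fun i j => ℓ i (f j)).det := by
  have hf : ∀ i, f i ∈ Submodule.span ℂ (S : Set E) := fun i => Submodule.subset_span (hS i)
  have hdet := det_one_add_sum_rankOne (W := Submodule.span ℂ (S : Set E))
    (fun i => (ℓ i) ∘ₗ (Submodule.span ℂ (S : Set E)).subtype)
    (fun i => (⟨f i, hf i⟩ : Submodule.span ℂ (S : Set E)))
  have e : (Matrix.of fun i j => ((ℓ i) ∘ₗ (Submodule.span ℂ (S : Set E)).subtype)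
      (⟨f j, hf j⟩ : Submodule.span ℂ (S : Set E))) = Matrix.of fun i j => ℓ i (f j) := rfl
  rw [e] at hdet
  rw [← hdet, compressedDet, compressedDet, ← LinearMap.det_comp]
  congr 1
  refine LinearMap.ext fun w => ?_
  have hp : ∀ i, (Submodule.span ℂ (S : Set E)).orthogonalProjectionOnto (f i) = ⟨f i, hf i⟩ :=
    fun i => (Submodule.span ℂ (S : Set E)).orthogonalProjectionOnto_mem_subspace_eq_self
      ⟨f i, hf i⟩
  simp only [ContinuousLinearMap.coe_coe, one_apply_eq_self, ContinuousLinearMap.comp_apply,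
    Submodule.subtypeL_apply, LinearMap.comp_apply, LinearMap.add_apply, Module.End.one_apply,
    LinearMap.sum_apply, LinearMap.smulRight_apply, Submodule.subtype_apply, hA, map_add, map_sum,
    map_smul, hp, smul_add, Finset.sum_add_distrib]
  abel

theorem tendsto_compressedDet_finiteRank_update {ι : Type*} [Fintype ι] [DecidableEq ι]
    {A K : E →L[ℂ] E} (ℓ : ι → E →ₗ[ℂ] ℂ) (f : ι → E)
    (hA : ∀ x, A x = K x + ∑ i, ℓ i x • (f i + K (f i))) {d : ℂ}
    (hd : Tendsto (compressedDet K) atTop (𝓝 d)) :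
    Tendsto (compressedDet A) atTop (𝓝 (d * (1 + Matrix.of fun i j => ℓ i (f j)).det)) := by
  classical
  refine (hd.mul_const _).congr' ?_
  filter_upwards [eventually_ge_atTop (Finset.univ.image f)] with S hS
  exact (compressedDet_finiteRank_update ℓ f hA S fun i =>
    hS (Finset.mem_image_of_mem f (Finset.mem_univ i))).symm

/-- The compressed determinants of a nuclear operator converge, and their limit is the limit of
the determinants of the truncated representation, which only involve the pairings `⟪u i, v j⟫`. -/
theorem exists_tendsto_compressedDet {A : E →L[ℂ] E} {u v : ℕ → E}
    (hs : Summable fun i => ‖u i‖ * ‖v i‖)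
    (hA : ∀ f : E, HasSum (fun i => ⟪u i, f⟫_ℂ • v i) (A f)) :
    ∃ d, Tendsto (compressedDet A) atTop (𝓝 d) ∧
      Tendsto (fun N : ℕ => (1 + Matrix.of fun i j : Fin N => ⟪u i, v j⟫_ℂ).det) atTop (𝓝 d) := by
  classical
  set τ := ∑' i, ‖u i‖ * ‖v i‖
  have hτ : NuclearLE A τ := ⟨u, v, hs, le_rfl, hA⟩
  set C := 2 * Real.exp ((τ + 1) + (τ + 1) ^ 2 / 2) with hC
  have hC0 : 0 < C := by positivity
  set δ : ℕ → ℝ := fun N => (∑' i, ‖u (i + N)‖ * ‖v (i + N)‖) + 1 / ((N : ℝ) + 1)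
  have hδ0 : ∀ N, 0 < δ N := fun N =>
    add_pos_of_nonneg_of_pos (tsum_nonneg fun i => by positivity) (by positivity)
  have hδ : Tendsto δ atTop (𝓝 0) := by
    simpa [δ] using (tendsto_sum_nat_add fun i => ‖u i‖ * ‖v i‖).add
      tendsto_one_div_add_atTop_nhds_zero_nat
  set c : ℕ → ℂ := fun N => (1 + Matrix.of fun i j : Fin N => ⟪u i, v j⟫_ℂ).det
  set B : ℕ → E →L[ℂ] E := fun N => ∑ i : Fin N, (innerSL ℂ (u i)).smulRight (v i)
  have hB : ∀ N, NuclearLE (B N - A) (δ N) := by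
    intro N
    have : NuclearLE (A - B N) (∑' i, ‖u (i + N)‖ * ‖v (i + N)‖) := by
      refine ⟨fun i => u (i + N), fun i => v (i + N),
        (summable_nat_add_iff N).2 hs, le_rfl, fun f => ?_⟩
      have := (hasSum_nat_add_iff' N).2 (hA f)
      simpa [B, Finset.sum_range] using this
    rw [← neg_sub]
    exact this.neg.mono (le_add_of_nonneg_right (by positivity))
  have hcB : ∀ N S, (Finset.univ.image fun i : Fin N => v i) ≤ S →
      compressedDet (B N) S = c N := by
    intro N S hS
    have := compressedDet_finiteRank_update (A := B N) (K := 0)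
      (fun i : Fin N => (innerSL ℂ (u i) : E →ₗ[ℂ] ℂ)) (fun i : Fin N => v i)
      (fun x => by simp [B]) S
      fun i => hS (Finset.mem_image_of_mem _ (Finset.mem_univ i))
    simpa using this
  have key : ∀ N, δ N < 1 → ∀ S, (Finset.univ.image fun i : Fin N => v i) ≤ S →
      ‖c N - compressedDet A S‖ ≤ C * δ N := by
    intro N hN S hS
    rw [← hcB N S hS]
    exact norm_compressedDet_sub_le hτ (hB N) (hδ0 N) hN S
  have small : ∀ ε > 0, ∀ᶠ N in atTop, δ N < 1 ∧ C * δ N < ε := by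
    intro ε hε
    have h1 : ∀ᶠ N in atTop, δ N < 1 := hδ.eventually_lt_const one_pos
    have h2 : ∀ᶠ N in atTop, C * δ N < ε :=
      (hδ.const_mul C).eventually_lt_const (by simpa using hε)
    exact h1.and h2
  have cau : CauchySeq (compressedDet A) := by
    rw [Metric.cauchySeq_iff']
    intro ε hε
    obtain ⟨N, h1, h2⟩ := (small (ε / 2) (by positivity)).exists
    refine ⟨Finset.univ.image fun i : Fin N => v i, fun S hS => ?_⟩
    have a1 := key N h1 S hS
    have a2 := key N h1 _ le_rfl
    rw [← dist_eq_norm] at a1 a2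
    rw [dist_comm] at a1
    exact (dist_triangle _ (c N) _).trans_lt (by linarith)
  obtain ⟨d, hd⟩ := cauchySeq_tendsto_of_complete cau
  refine ⟨d, hd, ?_⟩
  rw [Metric.tendsto_nhds]
  intro ε hε
  filter_upwards [small ε hε] with N hN
  refine lt_of_le_of_lt ?_ hN.2
  rw [dist_eq_norm]
  refine le_of_tendsto (tendsto_const_nhds.sub hd).norm ?_
  filter_upwards [eventually_ge_atTop (Finset.univ.image fun i : Fin N => v i)] with S hS
  exact key N hN.1 S hS

theorem NuclearLE.exists_tendsto {A : E →L[ℂ] E} {τ : ℝ} (h : NuclearLE A τ) :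
    ∃ d, Tendsto (compressedDet A) atTop (𝓝 d) := by
  obtain ⟨u, v, hs, -, hA⟩ := h
  obtain ⟨d, hd, -⟩ := exists_tendsto_compressedDet hs hA
  exact ⟨d, hd⟩

/-- The Fredholm determinant is invariant under similarities: a similarity preserves the pairings
`⟪u i, v j⟫` of a nuclear representation. -/
theorem NuclearLE.tendsto_compressedDet_conj [CompleteSpace E] {A : E →L[ℂ] E} {τ : ℝ} (h : NuclearLE A τ)
    {M N : E →L[ℂ] E} (hNM : ∀ x, N (M x) = x) {d : ℂ}
    (hd : Tendsto (compressedDet A) atTop (𝓝 d)) :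
    Tendsto (compressedDet (M ∘L A ∘L N)) atTop (𝓝 d) := by
  obtain ⟨u, v, hs, -, hA⟩ := h
  obtain ⟨d₁, h1, h1'⟩ := exists_tendsto_compressedDet hs hA
  have hle : ∀ i, ‖ContinuousLinearMap.adjoint N (u i)‖ * ‖M (v i)‖ ≤
      ‖N‖ * ‖M‖ * (‖u i‖ * ‖v i‖) := fun i => by
    calc _ ≤ (‖N‖ * ‖u i‖) * (‖M‖ * ‖v i‖) := by
          gcongr
          · simpa using (ContinuousLinearMap.adjoint N).le_opNorm (u i)
          · exact M.le_opNorm _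
      _ = _ := by ring
  have hs' := Summable.of_nonneg_of_le (fun i => by positivity) hle (hs.mul_left _)
  obtain ⟨d₂, h2, h2'⟩ := exists_tendsto_compressedDet (A := M ∘L A ∘L N)
    (u := fun i => ContinuousLinearMap.adjoint N (u i)) (v := fun i => M (v i)) hs'
    (fun f => by
      simpa [ContinuousLinearMap.adjoint_inner_left] using (hA (N f)).mapL M)
  simp only [ContinuousLinearMap.adjoint_inner_left, hNM] at h2'
  rwa [tendsto_nhds_unique hd h1, tendsto_nhds_unique h1' h2']

/-- The Fredholm determinant is continuous in the trace norm. -/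
theorem tendsto_fredholmDet {α : Type*} {l : Filter α} {A : α → E →L[ℂ] E} {B : E →L[ℂ] E} {τ : ℝ}
    (hB : NuclearLE B τ) {δ : α → ℝ} (hAB : ∀ a, NuclearLE (A a - B) (δ a))
    (hδ : Tendsto δ l (𝓝 0)) {d : α → ℂ} {d₀ : ℂ}
    (hd : ∀ a, Tendsto (compressedDet (A a)) atTop (𝓝 (d a)))
    (hd₀ : Tendsto (compressedDet B) atTop (𝓝 d₀)) : Tendsto d l (𝓝 d₀) := by
  set C := 2 * Real.exp ((τ + 1) + (τ + 1) ^ 2 / 2) with hC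
  have hC0 : 0 < C := by positivity
  rw [Metric.tendsto_nhds]
  intro ε hε
  set η := min (1 / 2) (ε / (2 * C))
  have hη : 0 < η := by positivity
  filter_upwards [hδ.eventually_lt_const hη] with a ha
  have := norm_compressedDet_sub_le hB ((hAB a).mono ha.le) hη
    ((min_le_left _ _).trans_lt (by norm_num))
  have h2 : ‖d a - d₀‖ ≤ C * η :=
    le_of_tendsto ((hd a).sub hd₀).norm (Eventually.of_forall this)
  rw [dist_eq_norm]
  refine h2.trans_lt ?_
  calc C * η ≤ C * (ε / (2 * C)) := by
        gcongr
        exact min_le_right _ _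
    _ = ε / 2 := by field_simp
    _ < ε := by linarith

end FredholmDeterminant

/-! ### Hilbert–Schmidt operators -/

section HilbertSchmidt

variable {E : Type*} [NormedAddCommGroup E] [InnerProductSpace ℂ E]

/-- The Hilbert–Schmidt norm of `T` is at most `H`: `∑ i, ‖T eᵢ‖² ≤ H²` for every finite part of
every orthonormal set. -/
def HilbertSchmidtLE (T : E →L[ℂ] E) (H : ℝ) : Prop :=
  ∀ w : Set E, Orthonormal ℂ ((↑) : w → E) → ∀ s : Finset w, ∑ i ∈ s, ‖T i‖ ^ 2 ≤ H ^ 2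

theorem Orthonormal.countable_of_separable [TopologicalSpace.SeparableSpace E] {w : Set E}
    (hw : Orthonormal ℂ ((↑) : w → E)) : Countable w := by
  refine Pairwise.countable_of_isOpen_disjoint (s := fun i : w => Metric.ball (i : E) (1 / 2)) ?_
    (fun i => Metric.isOpen_ball) fun i => ⟨i, by simp⟩
  intro i j hij
  refine Metric.ball_disjoint_ball ?_
  have h := norm_sub_sq (𝕜 := ℂ) (i : E) (j : E)
  rw [hw.1 i, hw.1 j, hw.2 hij] at h
  norm_num at h
  rw [dist_eq_norm]
  nlinarith [norm_nonneg ((i : E) - j)]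

/-- Nuclear representations may be indexed by any countable type. -/
theorem nuclearLE_of_countable {ι : Type*} [Countable ι] {A : E →L[ℂ] E} {u v : ι → E} {τ : ℝ}
    (hs : ∀ s : Finset ι, ∑ i ∈ s, ‖u i‖ * ‖v i‖ ≤ τ)
    (hA : ∀ f : E, HasSum (fun i => ⟪u i, f⟫_ℂ • v i) (A f)) : NuclearLE A τ := by
  obtain ⟨g, hg⟩ := exists_injective_nat ι
  have hz : ∀ x ∉ Set.range g, Function.extend g v 0 x = 0 := fun x hx =>
    Function.extend_apply' _ _ _ fun ⟨a, ha⟩ => hx ⟨a, ha⟩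
  have hsum : Summable fun i => ‖u i‖ * ‖v i‖ :=
    summable_of_sum_le (fun i => by positivity) hs
  have h1 : HasSum (fun n => ‖Function.extend g u 0 n‖ * ‖Function.extend g v 0 n‖)
      (∑' i, ‖u i‖ * ‖v i‖) := by
    refine (hg.hasSum_iff fun x hx => by simp [hz x hx]).1 ?_
    convert! hsum.hasSum using 1
    funext i
    simp [hg.extend_apply]
  refine ⟨Function.extend g u 0, Function.extend g v 0, h1.summable, ?_, fun f => ?_⟩
  · rw [h1.tsum_eq]
    exact Real.tsum_le_of_sum_le (fun i => by positivity) hs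
  · refine (hg.hasSum_iff fun x hx => by simp [hz x hx]).1 ?_
    convert! hA f using 1
    funext i
    simp [hg.extend_apply]

theorem HilbertBasis.hasSum_norm_inner_sq {ι : Type*} (b : HilbertBasis ι ℂ E) (x : E) :
    HasSum (fun i => ‖⟪b i, x⟫_ℂ‖ ^ 2) (‖x‖ ^ 2) := by
  have h := (Complex.hasSum_re (b.hasSum_inner_mul_inner x x))
  convert! h using 1
  · funext i
    rw [← inner_conj_symm x (b i), Complex.conj_mul', ← Complex.ofReal_pow, Complex.ofReal_re]
  · rw [inner_self_eq_norm_sq_to_K]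
    simp [← Complex.ofReal_pow]

/-- The product of two Hilbert–Schmidt operators is trace class. -/
theorem HilbertSchmidtLE.comp [CompleteSpace E] [TopologicalSpace.SeparableSpace E]
    {S T : E →L[ℂ] E} {a b : ℝ} (hS : HilbertSchmidtLE S a) (hT : HilbertSchmidtLE T b)
    (ha : 0 ≤ a) (hb : 0 ≤ b) : NuclearLE (S ∘L T) (a * b) := by
  obtain ⟨w, e, he⟩ := exists_hilbertBasis ℂ E
  have hw : Orthonormal ℂ ((↑) : w → E) := he ▸ e.orthonormal
  have : Countable w := Orthonormal.countable_of_separable hw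
  have hadj : ∀ s : Finset w, ∑ i ∈ s, ‖ContinuousLinearMap.adjoint T (e i)‖ ^ 2 ≤ b ^ 2 := by
    intro s
    have h1 := hasSum_sum (s := s) fun i _ =>
      HilbertBasis.hasSum_norm_inner_sq e (ContinuousLinearMap.adjoint T (e i))
    refine le_of_tendsto h1 (Eventually.of_forall fun t => ?_)
    refine le_trans ?_ (hT w hw t)
    refine Finset.sum_le_sum fun k _ => ?_
    have h2 := e.orthonormal.sum_inner_products_le (T (e k)) (s := s)
    rw [he] at h2
    refine le_trans (le_of_eq ?_) h2
    refine Finset.sum_congr rfl fun i _ => ?_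
    rw [ContinuousLinearMap.adjoint_inner_right, norm_inner_symm, he]
  refine nuclearLE_of_countable (ι := w) (u := fun i => ContinuousLinearMap.adjoint T (e i))
    (v := fun i => S (e i)) (fun s => ?_) fun f => ?_
  · refine le_of_sq_le_sq ?_ (by positivity)
    refine (Finset.sum_mul_sq_le_sq_mul_sq s _ _).trans ?_
    rw [mul_pow, mul_comm]
    refine mul_le_mul ?_ (hadj s) (Finset.sum_nonneg fun i _ => by positivity) (by positivity)
    simpa [he] using hS w hw s
  · have h := (e.hasSum_repr (T f)).mapL S
    simpa [ContinuousLinearMap.adjoint_inner_left, e.repr_apply_apply] using h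

end HilbertSchmidt

/-! ### Integral operators -/

section KernelOperators

variable {X : Type*} [MeasurableSpace X] {μ : Measure X}

theorem lintegral_enorm_sq (f : X → ℂ) : ∫⁻ x, ‖f x‖ₑ ^ 2 ∂μ = eLpNorm f 2 μ ^ 2 := by
  have := eLpNorm_nnreal_pow_eq_lintegral (μ := μ) (f := f) (p := 2) (by norm_num)
  simp only [NNReal.coe_ofNat, ENNReal.rpow_ofNat, ENNReal.coe_ofNat] at this
  exact this.symm

/-- A map on `L₂` that is given by functions and is linear and bounded up to null sets. -/
theorem exists_clm_of_eLpNorm_le (Φ : Lp ℂ 2 μ → X → ℂ)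
    (hmeas : ∀ f, AEStronglyMeasurable (Φ f) μ)
    (hadd : ∀ f g, Φ (f + g) =ᵐ[μ] fun x => Φ f x + Φ g x)
    (hsmul : ∀ (c : ℂ) f, Φ (c • f) =ᵐ[μ] fun x => c * Φ f x) {C : ℝ} (hC : 0 ≤ C)
    (hb : ∀ f, eLpNorm (Φ f) 2 μ ≤ ENNReal.ofReal C * eLpNorm f 2 μ) :
    ∃ T : Lp ℂ 2 μ →L[ℂ] Lp ℂ 2 μ, ∀ f, T f =ᵐ[μ] Φ f := by
  have hm : ∀ f, MemLp (Φ f) 2 μ := fun f => ⟨hmeas f, (hb f).trans_lt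
    (ENNReal.mul_lt_top ENNReal.ofReal_lt_top (Lp.memLp f).2)⟩
  let L : Lp ℂ 2 μ →ₗ[ℂ] Lp ℂ 2 μ :=
    { toFun := fun f => (hm f).toLp
      map_add' := fun f g => by
        ext1
        filter_upwards [(hm (f + g)).coeFn_toLp, (hm f).coeFn_toLp, (hm g).coeFn_toLp, hadd f g,
          Lp.coeFn_add (hm f).toLp (hm g).toLp] with x h1 h2 h3 h4 h5
        rw [h1, h5, Pi.add_apply, h2, h3, h4]
      map_smul' := fun c f => by
        ext1
        filter_upwards [(hm (c • f)).coeFn_toLp, (hm f).coeFn_toLp, hsmul c f,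
          Lp.coeFn_smul c (hm f).toLp] with x h1 h2 h3 h4
        rw [h1, RingHom.id_apply, h4, Pi.smul_apply, h2, h3, smul_eq_mul] }
  refine ⟨L.mkContinuous C fun f => ?_, fun f => (hm f).coeFn_toLp⟩
  change ‖(hm f).toLp‖ ≤ C * ‖f‖
  rw [Lp.norm_toLp, Lp.norm_def]
  have := ENNReal.toReal_mono (ENNReal.mul_ne_top ENNReal.ofReal_ne_top (Lp.memLp f).2.ne) (hb f)
  rwa [ENNReal.toReal_mul, ENNReal.toReal_ofReal hC] at this

/-- Multiplication by a bounded function. -/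
theorem exists_mulOp {m : X → ℂ} (hm : AEStronglyMeasurable m μ) {C : ℝ} (hC : 0 ≤ C)
    (hb : ∀ x, ‖m x‖ ≤ C) :
    ∃ T : Lp ℂ 2 μ →L[ℂ] Lp ℂ 2 μ, ∀ f, T f =ᵐ[μ] fun x => m x * f x := by
  refine exists_clm_of_eLpNorm_le (fun f x => m x * f x)
    (fun f => hm.mul (Lp.aestronglyMeasurable f)) (fun f g => ?_) (fun c f => ?_) hC fun f => ?_
  · filter_upwards [Lp.coeFn_add f g] with x hx
    rw [hx, Pi.add_apply, mul_add]
  · filter_upwards [Lp.coeFn_smul c f] with x hx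
    rw [hx, Pi.smul_apply, smul_eq_mul]
    ring
  · refine eLpNorm_le_mul_eLpNorm_of_ae_le_mul (Eventually.of_forall fun x => ?_) 2
    rw [norm_mul]
    gcongr
    exact hb x

theorem integral_mul_eq_inner {k : X → ℂ} (hk : MemLp k 2 μ) (f : Lp ℂ 2 μ) :
    ∫ y, k y * f y ∂μ = ⟪hk.star.toLp, f⟫_ℂ := by
  rw [L2.inner_def]
  refine integral_congr_ae ?_
  filter_upwards [hk.star.coeFn_toLp] with x hx
  rw [hx]
  simp [mul_comm]

theorem norm_star_toLp {k : X → ℂ} (hk : MemLp k 2 μ) :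
    ‖hk.star.toLp‖ₑ ^ 2 = ∫⁻ y, ‖k y‖ₑ ^ 2 ∂μ := by
  rw [Lp.enorm_toLp, ← lintegral_enorm_sq]
  simp

theorem integrable_mul_lp {k : X → ℂ} (hk : MemLp k 2 μ) (f : Lp ℂ 2 μ) :
    Integrable (fun y => k y * f y) μ := hk.integrable_mul (Lp.memLp f)

variable [SFinite μ]

theorem aestronglyMeasurable_kernel {k : X → X → ℂ}
    (hk : AEStronglyMeasurable (Function.uncurry k) (μ.prod μ)) (f : Lp ℂ 2 μ) :
    AEStronglyMeasurable (fun x => ∫ y, k x y * f y ∂μ) μ :=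
  AEStronglyMeasurable.integral_prod_right'
    (f := fun p : X × X => k p.1 p.2 * f p.2)
    (hk.mul (Lp.aestronglyMeasurable f).comp_snd)

/-- The integral operator of the kernel `k`, provided that it satisfies an `L₂` bound. -/
theorem exists_kernelOp {k : X → X → ℂ}
    (hk : AEStronglyMeasurable (Function.uncurry k) (μ.prod μ)) (hx : ∀ x, MemLp (k x) 2 μ)
    {C : ℝ} (hC : 0 ≤ C)
    (hb : ∀ f : Lp ℂ 2 μ, ∫⁻ x, ‖∫ y, k x y * f y ∂μ‖ₑ ^ 2 ∂μ ≤
      ENNReal.ofReal C ^ 2 * ∫⁻ x, ‖f x‖ₑ ^ 2 ∂μ) :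
    ∃ T : Lp ℂ 2 μ →L[ℂ] Lp ℂ 2 μ, ∀ f, T f =ᵐ[μ] fun x => ∫ y, k x y * f y ∂μ := by
  refine exists_clm_of_eLpNorm_le (fun f x => ∫ y, k x y * f y ∂μ)
    (aestronglyMeasurable_kernel hk) (fun f g => ?_) (fun c f => ?_) hC fun f => ?_
  · refine Eventually.of_forall fun x => ?_
    dsimp only
    rw [integral_mul_eq_inner (hx x), integral_mul_eq_inner (hx x), integral_mul_eq_inner (hx x),
      inner_add_right]
  · refine Eventually.of_forall fun x => ?_
    dsimp only
    rw [integral_mul_eq_inner (hx x), integral_mul_eq_inner (hx x), inner_smul_right]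
  · have := hb f
    rw [lintegral_enorm_sq, lintegral_enorm_sq, ← mul_pow] at this
    exact (ENNReal.pow_le_pow_left_iff two_ne_zero).1 this

/-- Schur's test. -/
theorem exists_kernelOp_schur {k : X → X → ℂ}
    (hk : AEStronglyMeasurable (Function.uncurry k) (μ.prod μ)) (hx : ∀ x, MemLp (k x) 2 μ)
    {C : ℝ} (hC : 0 ≤ C) (h1 : ∀ x, ∫⁻ y, ‖k x y‖ₑ ∂μ ≤ ENNReal.ofReal C)
    (h2 : ∀ y, ∫⁻ x, ‖k x y‖ₑ ∂μ ≤ ENNReal.ofReal C) :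
    ∃ T : Lp ℂ 2 μ →L[ℂ] Lp ℂ 2 μ, ∀ f, T f =ᵐ[μ] fun x => ∫ y, k x y * f y ∂μ := by
  refine exists_kernelOp hk hx hC fun f => ?_
  have hf := (Lp.aestronglyMeasurable f)
  have step : ∀ x, ‖∫ y, k x y * f y ∂μ‖ₑ ^ 2 ≤
      ENNReal.ofReal C * ∫⁻ y, ‖k x y‖ₑ * ‖f y‖ₑ ^ 2 ∂μ := by
    intro x
    have hkx := (hx x).1.enorm
    have a1 : ‖∫ y, k x y * f y ∂μ‖ₑ ≤
        ∫⁻ y, ‖k x y‖ₑ ^ (1 / 2 : ℝ) * (‖k x y‖ₑ ^ (1 / 2 : ℝ) * ‖f y‖ₑ) ∂μ := by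
      refine (enorm_integral_le_lintegral_enorm _).trans (le_of_eq ?_)
      refine lintegral_congr fun y => ?_
      rw [← mul_assoc, ← ENNReal.rpow_add_of_nonneg _ _ (by norm_num) (by norm_num), enorm_mul]
      norm_num
    have a2 := ENNReal.lintegral_mul_le_Lp_mul_Lq μ (p := 2) (q := 2)
      (Real.HolderConjugate.two_two) (hkx.pow_const (1 / 2 : ℝ))
      ((hkx.pow_const (1 / 2 : ℝ)).mul hf.enorm)
    have a3 := a1.trans a2
    have a4 : ∀ t : ENNReal, (t ^ (1 / 2 : ℝ)) ^ (2 : ℕ) = t := fun t => by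
      rw [← ENNReal.rpow_natCast, ← ENNReal.rpow_mul]
      norm_num
    calc _ ≤ _ := pow_le_pow_left₀ zero_le a3 2
      _ ≤ _ := by
        simp only [Pi.mul_apply, ENNReal.rpow_two, mul_pow, a4]
        gcongr
        exact h1 x
  calc ∫⁻ x, ‖∫ y, k x y * f y ∂μ‖ₑ ^ 2 ∂μ
      ≤ ∫⁻ x, ENNReal.ofReal C * ∫⁻ y, ‖k x y‖ₑ * ‖f y‖ₑ ^ 2 ∂μ ∂μ := lintegral_mono step
    _ = ENNReal.ofReal C * ∫⁻ x, ∫⁻ y, ‖k x y‖ₑ * ‖f y‖ₑ ^ 2 ∂μ ∂μ :=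
        lintegral_const_mul' _ _ ENNReal.ofReal_ne_top
    _ = ENNReal.ofReal C * ∫⁻ y, ∫⁻ x, ‖k x y‖ₑ * ‖f y‖ₑ ^ 2 ∂μ ∂μ := by
        rw [lintegral_lintegral_swap]
        exact hk.enorm.mul (hf.comp_snd.enorm.pow_const 2)
    _ ≤ ENNReal.ofReal C * ∫⁻ y, ENNReal.ofReal C * ‖f y‖ₑ ^ 2 ∂μ := by
        gcongr with y
        rw [lintegral_mul_const' _ _ (by finiteness)]
        gcongr
        exact h2 y
    _ = _ := by
        rw [lintegral_const_mul' _ _ ENNReal.ofReal_ne_top, ← mul_assoc, sq]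

/-- A square integrable kernel defines a Hilbert–Schmidt operator, by Bessel's inequality for the
sections of the kernel. -/
theorem exists_kernelOp_hilbertSchmidt {k : X → X → ℂ}
    (hk : AEStronglyMeasurable (Function.uncurry k) (μ.prod μ)) (hx : ∀ x, MemLp (k x) 2 μ)
    {H : ℝ} (hH : 0 ≤ H) (h : ∫⁻ x, ∫⁻ y, ‖k x y‖ₑ ^ 2 ∂μ ∂μ ≤ ENNReal.ofReal H ^ 2) :
    ∃ T : Lp ℂ 2 μ →L[ℂ] Lp ℂ 2 μ, (∀ f, T f =ᵐ[μ] fun x => ∫ y, k x y * f y ∂μ) ∧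
      HilbertSchmidtLE T H := by
  obtain ⟨T, hT⟩ := exists_kernelOp hk hx hH fun f => by
    calc ∫⁻ x, ‖∫ y, k x y * f y ∂μ‖ₑ ^ 2 ∂μ
        ≤ ∫⁻ x, (∫⁻ y, ‖k x y‖ₑ ^ 2 ∂μ) * ‖f‖ₑ ^ 2 ∂μ := by
          refine lintegral_mono fun x => ?_
          dsimp only
          rw [integral_mul_eq_inner (hx x), ← norm_star_toLp (hx x), ← mul_pow]
          gcongr
          have := norm_inner_le_norm (𝕜 := ℂ) ((hx x).star.toLp) f
          simp only [← ofReal_norm]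
          rw [← ENNReal.ofReal_mul (norm_nonneg _)]
          exact ENNReal.ofReal_le_ofReal this
      _ = (∫⁻ x, ∫⁻ y, ‖k x y‖ₑ ^ 2 ∂μ ∂μ) * ‖f‖ₑ ^ 2 :=
          lintegral_mul_const' _ _ (by finiteness)
      _ ≤ _ := by
          rw [lintegral_enorm_sq, ← Lp.enorm_def]
          gcongr
  refine ⟨T, hT, fun w hw s => ?_⟩
  have e1 : ∀ g : Lp ℂ 2 μ, ENNReal.ofReal (‖g‖ ^ 2) = ∫⁻ x, ‖g x‖ₑ ^ 2 ∂μ := by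
    intro g
    rw [lintegral_enorm_sq, ← Lp.enorm_def, ENNReal.ofReal_pow (norm_nonneg _), ofReal_norm]
  have e2 : ENNReal.ofReal (∑ i ∈ s, ‖T i‖ ^ 2) ≤ ENNReal.ofReal (H ^ 2) := by
    rw [ENNReal.ofReal_sum_of_nonneg fun i _ => by positivity, ENNReal.ofReal_pow hH]
    refine le_trans ?_ h
    simp only [e1]
    rw [← lintegral_finsetSum' _ fun (i : w) _ =>
      (Lp.aestronglyMeasurable (T (i : Lp ℂ 2 μ))).enorm.pow_const 2]
    refine lintegral_mono_ae ?_
    have hall : ∀ᵐ x ∂μ, ∀ i ∈ s, T i x = ∫ y, k x y * (i : Lp ℂ 2 μ) y ∂μ :=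
      (ae_ball_iff s.countable_toSet).2 fun i _ => hT i
    filter_upwards [hall] with x hxx
    rw [← norm_star_toLp (hx x)]
    have b := hw.sum_inner_products_le ((hx x).star.toLp) (s := s)
    have b' := ENNReal.ofReal_le_ofReal b
    rw [ENNReal.ofReal_sum_of_nonneg fun i _ => by positivity,
      ENNReal.ofReal_pow (norm_nonneg _), ofReal_norm] at b'
    refine le_trans (le_of_eq (Finset.sum_congr rfl fun i hi => ?_)) b'
    rw [hxx i hi, integral_mul_eq_inner (hx x), ENNReal.ofReal_pow (norm_nonneg _),
      norm_inner_symm, ofReal_norm]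
  exact (ENNReal.ofReal_le_ofReal_iff (by positivity)).1 e2

end KernelOperators

/-! ### Measure and integration on the star graph -/

section StarMeasure

variable {n : ℕ}

theorem starMeasure_eq_sum (n : ℕ) : starMeasure n =
    Measure.sum fun j : Fin n => (volume.restrict (Ioi (0 : ℝ))).map (Prod.mk j) := by
  rw [starMeasure, Measure.count, Measure.prod_sum_left]
  simp only [Measure.dirac_prod]

instance : SigmaFinite (starMeasure n) := by
  unfold starMeasure
  infer_instance

theorem ae_star_iff {P : Fin n × ℝ → Prop} :
    (∀ᵐ p ∂starMeasure n, P p) ↔ ∀ j, ∀ᵐ x ∂volume.restrict (Ioi (0 : ℝ)), P (j, x) := by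
  rw [starMeasure_eq_sum, Measure.ae_sum_iff]
  exact forall_congr' fun j => (measurableEmbedding_prodMk_left j).ae_map_iff

theorem lintegral_star (F : Fin n × ℝ → ENNReal) :
    ∫⁻ p, F p ∂starMeasure n = ∑ j, ∫⁻ x in Ioi (0 : ℝ), F (j, x) := by
  rw [starMeasure_eq_sum, lintegral_sum_measure, tsum_fintype]
  exact Finset.sum_congr rfl fun j _ => (measurableEmbedding_prodMk_left j).lintegral_map _

theorem aestronglyMeasurable_star_iff {F : Fin n × ℝ → ℂ} :
    AEStronglyMeasurable F (starMeasure n) ↔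
      ∀ j, AEStronglyMeasurable (fun x => F (j, x)) (volume.restrict (Ioi (0 : ℝ))) := by
  rw [starMeasure_eq_sum, aestronglyMeasurable_sum_measure_iff]
  exact forall_congr' fun j => (measurableEmbedding_prodMk_left j).aestronglyMeasurable_map_iff

theorem integrable_star_iff {F : Fin n × ℝ → ℂ} : Integrable F (starMeasure n) ↔
    ∀ j, IntegrableOn (fun x => F (j, x)) (Ioi (0 : ℝ)) := by
  rw [starMeasure_eq_sum, Measure.sum_fintype, integrable_finsetSum_measure]
  simp only [Finset.mem_univ, forall_const]
  exact forall_congr' fun j => (measurableEmbedding_prodMk_left j).integrable_map_iff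

theorem integral_star {F : Fin n × ℝ → ℂ} (hF : Integrable F (starMeasure n)) :
    ∫ p, F p ∂starMeasure n = ∑ j, ∫ x in Ioi (0 : ℝ), F (j, x) := by
  rw [starMeasure_eq_sum, Measure.sum_fintype, integrable_finsetSum_measure] at hF
  rw [starMeasure_eq_sum, Measure.sum_fintype, integral_finsetSum_measure hF]
  exact Finset.sum_congr rfl fun j _ => (measurableEmbedding_prodMk_left j).integral_map _

theorem memLp_star_iff {F : Fin n × ℝ → ℂ} : MemLp F 2 (starMeasure n) ↔
    ∀ j, MemLp (fun x => F (j, x)) 2 (volume.restrict (Ioi (0 : ℝ))) := by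
  have key : ∀ {Y : Type} [MeasurableSpace Y] (μ : Measure Y) (G : Y → ℂ), MemLp G 2 μ ↔
      AEStronglyMeasurable G μ ∧ ∫⁻ y, ‖G y‖ₑ ^ 2 ∂μ < ⊤ := by
    intro Y _ μ G
    rw [lintegral_enorm_sq, MemLp]
    simp [ENNReal.pow_lt_top_iff]
  simp only [key, aestronglyMeasurable_star_iff, lintegral_star, ENNReal.sum_lt_top,
    Finset.mem_univ, forall_const, forall_and]

theorem Lp.memLp_edge (f : StarL2 n) (j : Fin n) :
    MemLp (fun x => f (j, x)) 2 (volume.restrict (Ioi (0 : ℝ))) :=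
  memLp_star_iff.1 (Lp.memLp f) j

end StarMeasure

/-! ### Exponentials -/

section Exponential

theorem norm_cexp_I_mul (ζ : ℂ) (s : ℝ) :
    ‖Complex.exp (Complex.I * ζ * s)‖ = Real.exp (-(ζ.im * s)) := by
  rw [Complex.norm_exp]
  congr 1
  simp [Complex.mul_re, Complex.mul_im]

theorem norm_cexp_I_mul_le_one {ζ : ℂ} (hζ : 0 ≤ ζ.im) {s : ℝ} (hs : 0 ≤ s) :
    ‖Complex.exp (Complex.I * ζ * s)‖ ≤ 1 := by
  rw [norm_cexp_I_mul]
  exact Real.exp_le_one_iff.2 (by nlinarith)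

theorem lintegral_exp_Ioi {r : ℝ} (hr : 0 < r) (t : ℝ) :
    ∫⁻ y in Ioi t, ENNReal.ofReal (Real.exp (-(r * (y - t)))) = ENNReal.ofReal (1 / r) := by
  have e : ∀ y : ℝ, Real.exp (-(r * (y - t))) = Real.exp (r * t) * Real.exp (-r * y) := fun y => by
    rw [← Real.exp_add]
    ring_nf
  rw [← ofReal_integral_eq_lintegral_ofReal]
  · simp only [e]
    rw [integral_const_mul, integral_exp_mul_Ioi (by linarith), neg_div_neg_eq, mul_div_assoc',
      ← Real.exp_add]
    simp
  · simp only [e]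
    exact (integrableOn_exp_mul_Ioi (by linarith) t).const_mul _
  · exact Eventually.of_forall fun y => (Real.exp_pos _).le

theorem lintegral_exp_Iio {r : ℝ} (hr : 0 < r) (x : ℝ) :
    ∫⁻ t in Iio x, ENNReal.ofReal (Real.exp (-(r * (x - t)))) = ENNReal.ofReal (1 / r) := by
  rw [← lintegral_exp_Ioi hr (-x), ← lintegral_indicator measurableSet_Iio,
    ← lintegral_indicator measurableSet_Ioi, ← lintegral_neg_eq_self]
  refine lintegral_congr fun t => ?_
  by_cases h : -t < x
  · rw [indicator_of_mem (by simpa using h), indicator_of_mem (by simp; linarith)]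
    ring_nf
  · rw [indicator_of_notMem (by simpa using h), indicator_of_notMem (by simp; linarith)]

end Exponential

/-! ### The exponential kernels on the edges -/

section EdgeKernels

variable {n : ℕ}

/-- The kernel `1_{t < x} e^{iζ(x - t)}`, acting on each edge separately. -/
def causalKernel (ζ : ℂ) (p q : Fin n × ℝ) : ℂ :=
  if p.1 = q.1 ∧ q.2 < p.2 then Complex.exp (Complex.I * ζ * ((p.2 - q.2 : ℝ) : ℂ)) else 0

theorem measurable_causalKernel (ζ : ℂ) :
    Measurable fun r : (Fin n × ℝ) × (Fin n × ℝ) => causalKernel ζ r.1 r.2 := by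
  unfold causalKernel
  refine Measurable.ite ?_ (by fun_prop) measurable_const
  exact (measurableSet_eq_fun (f := fun r : (Fin n × ℝ) × (Fin n × ℝ) => r.1.1)
    (g := fun r => r.2.1) (by fun_prop) (by fun_prop)).inter
    (measurableSet_lt (f := fun r : (Fin n × ℝ) × (Fin n × ℝ) => r.2.2)
      (g := fun r => r.1.2) (by fun_prop) (by fun_prop))

theorem enorm_causalKernel_pow (ζ : ℂ) (p q : Fin n × ℝ) {m : ℕ} (hm : m ≠ 0) :
    ‖causalKernel ζ p q‖ₑ ^ m = if p.1 = q.1 ∧ q.2 < p.2 then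
      ENNReal.ofReal (Real.exp (-(m * ζ.im * (p.2 - q.2)))) else 0 := by
  unfold causalKernel
  split_ifs
  · rw [← ofReal_norm, norm_cexp_I_mul, ← ENNReal.ofReal_pow (Real.exp_pos _).le,
      ← Real.exp_nat_mul]
    ring_nf
  · simp [hm]

theorem norm_causalKernel_le_one {ζ : ℂ} (hζ : 0 < ζ.im) (p q : Fin n × ℝ) :
    ‖causalKernel ζ p q‖ ≤ 1 := by
  unfold causalKernel
  split_ifs with h
  · exact norm_cexp_I_mul_le_one hζ.le (by linarith [h.2])
  · simp

theorem lintegral_causalKernel_right {ζ : ℂ} (hζ : 0 < ζ.im) (p : Fin n × ℝ) {m : ℕ}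
    (hm : m ≠ 0) : ∫⁻ q, ‖causalKernel ζ p q‖ₑ ^ m ∂starMeasure n ≤
      ENNReal.ofReal (1 / (m * ζ.im)) := by
  have hr : 0 < m * ζ.im := by positivity
  rw [lintegral_star, Finset.sum_eq_single p.1]
  · rw [← lintegral_exp_Iio hr p.2, ← lintegral_indicator measurableSet_Iio]
    refine (lintegral_mono' Measure.restrict_le_self fun x => ?_)
    dsimp only
    rw [enorm_causalKernel_pow _ _ _ hm]
    by_cases h : x < p.2 <;> simp [h]
  · intro k _ hk
    have : ∀ x, ‖causalKernel ζ p (k, x)‖ₑ ^ m = 0 := fun x => by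
      rw [enorm_causalKernel_pow _ _ _ hm]
      simp [hk.symm]
    simp [this]
  · simp

theorem lintegral_causalKernel_left {ζ : ℂ} (hζ : 0 < ζ.im) (q : Fin n × ℝ) {m : ℕ}
    (hm : m ≠ 0) : ∫⁻ p, ‖causalKernel ζ p q‖ₑ ^ m ∂starMeasure n ≤
      ENNReal.ofReal (1 / (m * ζ.im)) := by
  have hr : 0 < m * ζ.im := by positivity
  rw [lintegral_star, Finset.sum_eq_single q.1]
  · rw [← lintegral_exp_Ioi hr q.2]
    conv_rhs => rw [← lintegral_indicator measurableSet_Ioi]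
    refine (lintegral_mono' Measure.restrict_le_self fun x => ?_)
    dsimp only
    rw [enorm_causalKernel_pow _ _ _ hm]
    by_cases h : q.2 < x <;> simp [h]
  · intro k _ hk
    have : ∀ x, ‖causalKernel ζ (k, x) q‖ₑ ^ m = 0 := fun x => by
      rw [enorm_causalKernel_pow _ _ _ hm]
      simp [hk]
    simp [this]
  · simp

theorem memLp_of_lintegral_sq_le {F : Fin n × ℝ → ℂ} (hF : AEStronglyMeasurable F (starMeasure n))
    {C : ℝ} (h : ∫⁻ p, ‖F p‖ₑ ^ 2 ∂starMeasure n ≤ ENNReal.ofReal C) :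
    MemLp F 2 (starMeasure n) := by
  refine ⟨hF, ?_⟩
  rw [lintegral_enorm_sq] at h
  have := h.trans_lt ENNReal.ofReal_lt_top
  simpa [ENNReal.pow_lt_top_iff] using this

theorem memLp_causalKernel_right {ζ : ℂ} (hζ : 0 < ζ.im) (p : Fin n × ℝ) :
    MemLp (causalKernel ζ p) 2 (starMeasure n) :=
  memLp_of_lintegral_sq_le
    ((measurable_causalKernel ζ).comp measurable_prodMk_left).aestronglyMeasurable
    (lintegral_causalKernel_right hζ p two_ne_zero)

theorem memLp_causalKernel_left {ζ : ℂ} (hζ : 0 < ζ.im) (q : Fin n × ℝ) :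
    MemLp (fun p => causalKernel ζ p q) 2 (starMeasure n) :=
  memLp_of_lintegral_sq_le
    ((measurable_causalKernel ζ).comp measurable_prodMk_right).aestronglyMeasurable
    (lintegral_causalKernel_left hζ q two_ne_zero)

/-- `∫_0^x e^{iζ(x - t)} h(t) dt`, the solution of `u' = iζ u + h` with `u(0) = 0`. -/
def causal (ζ : ℂ) (h : ℝ → ℂ) (x : ℝ) : ℂ :=
  ∫ t in (0 : ℝ)..x, Complex.exp (Complex.I * ζ * ((x - t : ℝ) : ℂ)) * h t

/-- `∫_x^∞ e^{iζ(y - x)} h(y) dy`, the decaying solution of `w' = -iζ w - h`. -/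
def anticausal (ζ : ℂ) (h : ℝ → ℂ) (x : ℝ) : ℂ :=
  ∫ y in Ioi x, Complex.exp (Complex.I * ζ * ((y - x : ℝ) : ℂ)) * h y

theorem causal_congr {ζ : ℂ} {h h' : ℝ → ℂ} (H : h =ᵐ[volume.restrict (Ioi 0)] h') {x : ℝ}
    (hx : 0 ≤ x) : causal ζ h x = causal ζ h' x := by
  refine intervalIntegral.integral_congr_ae ?_
  rw [uIoc_of_le hx]
  filter_upwards [(ae_restrict_iff' measurableSet_Ioi).1 H] with t ht h1
  rw [ht h1.1]

theorem anticausal_congr {ζ : ℂ} {h h' : ℝ → ℂ} (H : h =ᵐ[volume.restrict (Ioi 0)] h') {x : ℝ}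
    (hx : 0 ≤ x) : anticausal ζ h x = anticausal ζ h' x := by
  refine integral_congr_ae ?_
  filter_upwards [ae_restrict_of_ae_restrict_of_subset (Ioi_subset_Ioi hx) H] with t ht
  rw [ht]

theorem integral_causalKernel {ζ : ℂ} {h : Fin n × ℝ → ℂ} {p : Fin n × ℝ} (hp : 0 ≤ p.2)
    (hi : Integrable (fun q => causalKernel ζ p q * h q) (starMeasure n)) :
    ∫ q, causalKernel ζ p q * h q ∂starMeasure n = causal ζ (fun t => h (p.1, t)) p.2 := by
  rw [integral_star hi, Finset.sum_eq_single p.1, causal, intervalIntegral.integral_of_le hp,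
    integral_Ioc_eq_integral_Ioo, ← integral_indicator measurableSet_Ioo,
    ← integral_indicator measurableSet_Ioi]
  · congr 1
    funext x
    by_cases h1 : 0 < x <;> by_cases h2 : x < p.2 <;> simp [h1, h2, causalKernel, indicator]
  · intro k _ hk
    simp [causalKernel, hk.symm]
  · simp

theorem integral_anticausalKernel {ζ : ℂ} {h : Fin n × ℝ → ℂ} {p : Fin n × ℝ} (hp : 0 ≤ p.2)
    (hi : Integrable (fun q => causalKernel ζ q p * h q) (starMeasure n)) :
    ∫ q, causalKernel ζ q p * h q ∂starMeasure n =
      anticausal ζ (fun t => h (p.1, t)) p.2 := by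
  rw [integral_star hi, Finset.sum_eq_single p.1, anticausal, ← integral_indicator measurableSet_Ioi,
    ← integral_indicator measurableSet_Ioi]
  · congr 1
    funext x
    by_cases h2 : p.2 < x
    · have h1 : 0 < x := hp.trans_lt h2
      simp [h1, h2, causalKernel, indicator]
    · simp [h2, causalKernel, indicator]
  · intro k _ hk
    simp [causalKernel, hk]
  · simp

theorem ae_star_nonneg : ∀ᵐ p ∂starMeasure n, 0 ≤ p.2 :=
  ae_star_iff.2 fun _ => (ae_restrict_mem measurableSet_Ioi).mono fun _ hx => le_of_lt hx

theorem exists_causalOp {ζ : ℂ} (hζ : 0 < ζ.im) :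
    ∃ T : StarL2 n →L[ℂ] StarL2 n, ∀ f, T f =ᵐ[starMeasure n]
      fun p => causal ζ (fun t => f (p.1, t)) p.2 := by
  obtain ⟨T, hT⟩ := exists_kernelOp_schur (μ := starMeasure n) (k := causalKernel ζ)
    (measurable_causalKernel ζ).aestronglyMeasurable (memLp_causalKernel_right hζ)
    (C := 1 / ζ.im) (by positivity)
    (fun p => by simpa using lintegral_causalKernel_right hζ p one_ne_zero)
    (fun p => by simpa using lintegral_causalKernel_left hζ p one_ne_zero)
  refine ⟨T, fun f => ?_⟩
  filter_upwards [hT f, ae_star_nonneg] with p hp h0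
  rw [hp, integral_causalKernel h0 (integrable_mul_lp (memLp_causalKernel_right hζ p) f)]

theorem exists_anticausalOp {ζ : ℂ} (hζ : 0 < ζ.im) :
    ∃ T : StarL2 n →L[ℂ] StarL2 n, ∀ f, T f =ᵐ[starMeasure n]
      fun p => anticausal ζ (fun t => f (p.1, t)) p.2 := by
  obtain ⟨T, hT⟩ := exists_kernelOp_schur (μ := starMeasure n) (k := fun p q => causalKernel ζ q p)
    ((measurable_causalKernel ζ).comp measurable_swap).aestronglyMeasurable
    (memLp_causalKernel_left hζ) (C := 1 / ζ.im) (by positivity)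
    (fun p => by simpa using lintegral_causalKernel_left hζ p one_ne_zero)
    (fun p => by simpa using lintegral_causalKernel_right hζ p one_ne_zero)
  refine ⟨T, fun f => ?_⟩
  filter_upwards [hT f, ae_star_nonneg] with p hp h0
  rw [hp, integral_anticausalKernel h0 (integrable_mul_lp (memLp_causalKernel_left hζ p) f)]

end EdgeKernels

/-! ### Weighted kernels -/

section WeightedKernels

variable {X : Type*} [MeasurableSpace X] {μ : Measure X} [SFinite μ]

/-- The kernel `a(p) c(p, q)` is Hilbert–Schmidt if `a` is square integrable and the sections
`c(p, ·)` are uniformly so. -/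
theorem exists_leftWeightedOp {a : X → ℂ} (ha : MemLp a 2 μ) {c : X → X → ℂ}
    (hc : Measurable fun r : X × X => c r.1 r.2) {B : ℝ} (hB : 0 ≤ B)
    (h : ∀ p, ∫⁻ q, ‖c p q‖ₑ ^ 2 ∂μ ≤ ENNReal.ofReal B ^ 2) :
    ∃ T : Lp ℂ 2 μ →L[ℂ] Lp ℂ 2 μ, (∀ f, T f =ᵐ[μ] fun p => a p * ∫ q, c p q * f q ∂μ) ∧
      HilbertSchmidtLE T (B * (eLpNorm a 2 μ).toReal) := by
  have hm : ∀ p, MemLp (c p) 2 μ := fun p => by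
    refine ⟨(hc.comp measurable_prodMk_left).aestronglyMeasurable, ?_⟩
    have := (h p).trans_lt (ENNReal.pow_lt_top ENNReal.ofReal_lt_top)
    rw [lintegral_enorm_sq] at this
    simpa [ENNReal.pow_lt_top_iff] using this
  obtain ⟨T, hT, hT2⟩ := exists_kernelOp_hilbertSchmidt (μ := μ) (k := fun p q => a p * c p q)
    (ha.1.comp_fst.mul hc.aestronglyMeasurable) (fun p => (hm p).const_mul (a p))
    (H := B * (eLpNorm a 2 μ).toReal) (by positivity) (by
      rw [ENNReal.ofReal_mul hB, ENNReal.ofReal_toReal ha.2.ne, mul_pow, ← lintegral_enorm_sq,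
        ← lintegral_const_mul' _ _ (by finiteness)]
      refine lintegral_mono fun p => ?_
      simp only [enorm_mul, mul_pow]
      rw [lintegral_const_mul' _ _ (by finiteness), mul_comm]
      gcongr
      exact h p)
  refine ⟨T, fun f => ?_, hT2⟩
  filter_upwards [hT f] with p hp
  rw [hp, ← integral_const_mul]
  simp only [mul_assoc]

/-- The kernel `c(p, q) b(q)` is Hilbert–Schmidt if `b` is square integrable and the sections
`c(·, q)` are uniformly so. -/
theorem exists_rightWeightedOp {b : X → ℂ} (hb : MemLp b 2 μ) {c : X → X → ℂ}
    (hc : Measurable fun r : X × X => c r.1 r.2) (hc1 : ∀ p q, ‖c p q‖ ≤ 1) {B : ℝ} (hB : 0 ≤ B)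
    (h : ∀ q, ∫⁻ p, ‖c p q‖ₑ ^ 2 ∂μ ≤ ENNReal.ofReal B ^ 2) :
    ∃ T : Lp ℂ 2 μ →L[ℂ] Lp ℂ 2 μ, (∀ f, T f =ᵐ[μ] fun p => ∫ q, c p q * (b q * f q) ∂μ) ∧
      HilbertSchmidtLE T (B * (eLpNorm b 2 μ).toReal) := by
  have hm : ∀ p, MemLp (fun q => c p q * b q) 2 μ := fun p =>
    hb.of_le ((hc.comp measurable_prodMk_left).aestronglyMeasurable.mul hb.1)
      (Eventually.of_forall fun q => by
        rw [norm_mul]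
        exact mul_le_of_le_one_left (norm_nonneg _) (hc1 p q))
  have hk : AEStronglyMeasurable (fun r : X × X => c r.1 r.2 * b r.2) (μ.prod μ) :=
    hc.aestronglyMeasurable.mul hb.1.comp_snd
  obtain ⟨T, hT, hT2⟩ := exists_kernelOp_hilbertSchmidt (μ := μ) (k := fun p q => c p q * b q)
    hk hm (H := B * (eLpNorm b 2 μ).toReal) (by positivity) (by
      rw [lintegral_lintegral_swap (hk.enorm.pow_const 2), ENNReal.ofReal_mul hB,
        ENNReal.ofReal_toReal hb.2.ne, mul_pow, ← lintegral_enorm_sq,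
        ← lintegral_const_mul' _ _ (by finiteness)]
      refine lintegral_mono fun q => ?_
      simp only [enorm_mul, mul_pow]
      rw [lintegral_mul_const' _ _ (by finiteness)]
      gcongr
      exact h q)
  refine ⟨T, fun f => ?_, hT2⟩
  filter_upwards [hT f] with p hp
  rw [hp]
  simp only [mul_assoc]

end WeightedKernels

/-! ### Absolutely continuous functions on the half-line -/

section Primitives

/-- On the half-line `[0, ∞)`, `F` is the absolutely continuous primitive of the locally
integrable function `f`. -/
def IsPrimitive (F f : ℝ → ℂ) : Prop :=
  ∀ x, 0 ≤ x → IntervalIntegrable f volume 0 x ∧ F x = F 0 + ∫ t in (0 : ℝ)..x, f t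

theorem IsPrimitive.intervalIntegrable {F f : ℝ → ℂ} (h : IsPrimitive F f) {x : ℝ} (hx : 0 ≤ x) :
    IntervalIntegrable f volume 0 x := (h x hx).1

theorem IsPrimitive.eq {F f : ℝ → ℂ} (h : IsPrimitive F f) {x : ℝ} (hx : 0 ≤ x) :
    F x = F 0 + ∫ t in (0 : ℝ)..x, f t := (h x hx).2

theorem IsPrimitive.continuousOn {F f : ℝ → ℂ} (h : IsPrimitive F f) {x : ℝ} (hx : 0 ≤ x) :
    ContinuousOn F (Icc 0 x) := by
  have h1 := intervalIntegral.continuousOn_primitive_interval' (h.intervalIntegrable hx)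
    (left_mem_uIcc (a := (0 : ℝ)) (b := x))
  rw [uIcc_of_le hx] at h1
  exact (continuousOn_const.add h1).congr fun t ht => h.eq ht.1

theorem IsPrimitive.add {F f G g : ℝ → ℂ} (hF : IsPrimitive F f) (hG : IsPrimitive G g) :
    IsPrimitive (fun x => F x + G x) (fun x => f x + g x) := fun x hx => by
  refine ⟨(hF.intervalIntegrable hx).add (hG.intervalIntegrable hx), ?_⟩
  dsimp only
  rw [intervalIntegral.integral_add (hF.intervalIntegrable hx) (hG.intervalIntegrable hx),
    hF.eq hx, hG.eq hx]
  ring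

theorem IsPrimitive.const_mul {F f : ℝ → ℂ} (hF : IsPrimitive F f) (c : ℂ) :
    IsPrimitive (fun x => c * F x) (fun x => c * f x) := fun x hx => by
  refine ⟨(hF.intervalIntegrable hx).const_mul c, ?_⟩
  dsimp only
  rw [intervalIntegral.integral_const_mul, hF.eq hx]
  ring

theorem IsPrimitive.congr {F f G g : ℝ → ℂ} (hF : IsPrimitive F f) (h : ∀ x, 0 ≤ x → G x = F x)
    (h' : ∀ x, 0 ≤ x → g x = f x) : IsPrimitive G g := fun x hx => by
  have e : EqOn f g (uIoc 0 x) := fun t ht => by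
    rw [uIoc_of_le hx] at ht
    exact (h' t ht.1.le).symm
  refine ⟨(hF.intervalIntegrable hx).congr e, ?_⟩
  rw [h x hx, h 0 le_rfl, hF.eq hx]
  congr 1
  refine intervalIntegral.integral_congr fun t ht => ?_
  rw [uIcc_of_le hx] at ht
  exact (h' t ht.1).symm

theorem isPrimitive_of_hasDerivAt {F f : ℝ → ℂ} (hF : ∀ x, HasDerivAt F (f x) x)
    (hf : Continuous f) : IsPrimitive F f := fun x hx => by
  refine ⟨hf.intervalIntegrable _ _, ?_⟩
  rw [intervalIntegral.integral_eq_sub_of_hasDerivAt (fun t _ => hF t) (hf.intervalIntegrable _ _)]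
  ring

/-- Integration by parts for the primitives of two integrable functions: the square `[0, x]²` is
divided by its diagonal. -/
theorem integral_mul_integral_eq {f g : ℝ → ℂ} {x : ℝ} (hx : 0 ≤ x)
    (hf : IntervalIntegrable f volume 0 x) (hg : IntervalIntegrable g volume 0 x) :
    (∫ t in (0 : ℝ)..x, f t * ∫ s in (0 : ℝ)..t, g s) +
      (∫ s in (0 : ℝ)..x, (∫ t in (0 : ℝ)..s, f t) * g s) =
      (∫ t in (0 : ℝ)..x, f t) * ∫ s in (0 : ℝ)..x, g s := by
  set ν := (volume : Measure ℝ).restrict (Ioc 0 x) with hν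
  rw [intervalIntegrable_iff_integrableOn_Ioc_of_le hx] at hf hg
  have hH : Integrable (fun p : ℝ × ℝ => f p.1 * g p.2) (ν.prod ν) := hf.mul_prod hg
  set A : Set (ℝ × ℝ) := {p | p.2 ≤ p.1} with hA
  have mA : MeasurableSet A := measurableSet_le measurable_snd measurable_fst
  have e0 : ∫ p, f p.1 * g p.2 ∂ν.prod ν =
      (∫ t in (0 : ℝ)..x, f t) * ∫ s in (0 : ℝ)..x, g s := by
    rw [integral_prod_mul, intervalIntegral.integral_of_le hx, intervalIntegral.integral_of_le hx]
  have e1 : ∫ p in A, f p.1 * g p.2 ∂ν.prod ν =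
      ∫ t in (0 : ℝ)..x, f t * ∫ s in (0 : ℝ)..t, g s := by
    rw [← integral_indicator mA, integral_prod _ (hH.indicator mA),
      intervalIntegral.integral_of_le hx]
    refine setIntegral_congr_fun measurableSet_Ioc fun t ht => ?_
    rw [intervalIntegral.integral_of_le ht.1.le, ← integral_const_mul,
      ← integral_indicator measurableSet_Ioc, ← integral_indicator measurableSet_Ioc]
    congr 1
    funext s
    by_cases h1 : 0 < s <;> by_cases h2 : s ≤ t
    · have h3 : s ≤ x := h2.trans ht.2
      simp [indicator, h1, h2, h3, hA]
    all_goals simp [indicator, h1, h2, hA]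
  have e2 : ∫ p in Aᶜ, f p.1 * g p.2 ∂ν.prod ν =
      ∫ s in (0 : ℝ)..x, (∫ t in (0 : ℝ)..s, f t) * g s := by
    rw [← integral_indicator mA.compl, integral_prod_symm _ (hH.indicator mA.compl),
      intervalIntegral.integral_of_le hx]
    refine setIntegral_congr_fun measurableSet_Ioc fun s hs => ?_
    rw [intervalIntegral.integral_of_le hs.1.le,
      show ∫ t in Ioc 0 s, f t = ∫ t in Ioo 0 s, f t from integral_Ioc_eq_integral_Ioo,
      ← integral_mul_const, ← integral_indicator measurableSet_Ioc,
      ← integral_indicator measurableSet_Ioo]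
    congr 1
    funext t
    by_cases h1 : 0 < t <;> by_cases h2 : t < s
    · have h3 : t ≤ x := h2.le.trans hs.2
      simp [indicator, h1, h2, h3, hA]
    all_goals simp [indicator, h1, h2, hA]
  rw [← e0, ← e1, ← e2, integral_add_compl mA hH]

/-- The product rule. -/
theorem IsPrimitive.mul {F f G g : ℝ → ℂ} (hF : IsPrimitive F f) (hG : IsPrimitive G g) :
    IsPrimitive (fun x => F x * G x) (fun x => f x * G x + F x * g x) := fun x hx => by
  have hf := hF.intervalIntegrable hx
  have hg := hG.intervalIntegrable hx
  have i1 : IntervalIntegrable (fun t => f t * G t) volume 0 x :=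
    hf.mul_continuousOn (by rw [uIcc_of_le hx]; exact hG.continuousOn hx)
  have i2 : IntervalIntegrable (fun t => F t * g t) volume 0 x :=
    hg.continuousOn_mul (by rw [uIcc_of_le hx]; exact hF.continuousOn hx)
  refine ⟨i1.add i2, ?_⟩
  have cF : ContinuousOn (fun t => ∫ s in (0 : ℝ)..t, f s) (uIcc 0 x) :=
    intervalIntegral.continuousOn_primitive_interval' hf left_mem_uIcc
  have cG : ContinuousOn (fun t => ∫ s in (0 : ℝ)..t, g s) (uIcc 0 x) :=
    intervalIntegral.continuousOn_primitive_interval' hg left_mem_uIcc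
  have e1 : ∫ t in (0 : ℝ)..x, f t * G t =
      (∫ t in (0 : ℝ)..x, f t) * G 0 + ∫ t in (0 : ℝ)..x, f t * ∫ s in (0 : ℝ)..t, g s := by
    rw [← intervalIntegral.integral_mul_const, ← intervalIntegral.integral_add
      (hf.mul_const _) (hf.mul_continuousOn cG)]
    refine intervalIntegral.integral_congr fun t ht => ?_
    rw [uIcc_of_le hx] at ht
    rw [hG.eq ht.1]
    ring
  have e2 : ∫ t in (0 : ℝ)..x, F t * g t =
      F 0 * (∫ t in (0 : ℝ)..x, g t) + ∫ t in (0 : ℝ)..x, (∫ s in (0 : ℝ)..t, f s) * g t := by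
    rw [← intervalIntegral.integral_const_mul, ← intervalIntegral.integral_add
      (hg.const_mul _) (hg.continuousOn_mul cF)]
    refine intervalIntegral.integral_congr fun t ht => ?_
    rw [uIcc_of_le hx] at ht
    rw [hF.eq ht.1]
    ring
  dsimp only
  rw [intervalIntegral.integral_add i1 i2, e1, e2, hF.eq hx, hG.eq hx]
  linear_combination -(integral_mul_integral_eq hx hf hg)

theorem IsPrimitive.tendsto {F f : ℝ → ℂ} (hF : IsPrimitive F f) (hf : IntegrableOn f (Ioi 0)) :
    Tendsto F atTop (𝓝 (F 0 + ∫ t in Ioi (0 : ℝ), f t)) := by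
  refine (tendsto_const_nhds.add (intervalIntegral_tendsto_integral_Ioi 0 hf tendsto_id)).congr' ?_
  filter_upwards [eventually_ge_atTop 0] with x hx
  exact (hF.eq hx).symm

/-- Integration by parts on the half-line for square integrable functions. -/
theorem IsPrimitive.integral_mul_eq {F f G g : ℝ → ℂ} (hF : IsPrimitive F f)
    (hG : IsPrimitive G g) (lF : MemLp F 2 (volume.restrict (Ioi 0)))
    (lf : MemLp f 2 (volume.restrict (Ioi 0))) (lG : MemLp G 2 (volume.restrict (Ioi 0)))
    (lg : MemLp g 2 (volume.restrict (Ioi 0))) :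
    ∫ x in Ioi (0 : ℝ), F x * g x = -(F 0 * G 0) - ∫ x in Ioi (0 : ℝ), f x * G x := by
  have i1 : IntegrableOn (fun x => f x * G x) (Ioi 0) := lf.integrable_mul lG
  have i2 : IntegrableOn (fun x => F x * g x) (Ioi 0) := lF.integrable_mul lg
  have i3 : IntegrableOn (fun x => F x * G x) (Ioi 0) := lF.integrable_mul lG
  have lim := (hF.mul hG).tendsto (i1.add i2)
  have hz := IntegrableAtFilter.eq_zero_of_tendsto (l := atTop) (μ := volume)
    ⟨Ioi 0, Ioi_mem_atTop 0, i3⟩ (fun s hs => by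
      obtain ⟨a, ha⟩ := mem_atTop_sets.1 hs
      exact measure_mono_top (s₁ := Ici a) ha Real.volume_Ici) lim
  rw [integral_add i1 i2] at hz
  linear_combination hz

theorem continuous_cexp_I_mul (ζ : ℂ) : Continuous fun t : ℝ => Complex.exp (Complex.I * ζ * t) := by
  fun_prop

theorem isPrimitive_cexp (ζ : ℂ) : IsPrimitive (fun t : ℝ => Complex.exp (Complex.I * ζ * t))
    (fun t : ℝ => Complex.I * ζ * Complex.exp (Complex.I * ζ * t)) := by
  refine isPrimitive_of_hasDerivAt (fun x => ?_) (by fun_prop)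
  have h : HasDerivAt (fun t : ℝ => Complex.I * ζ * (t : ℂ)) (Complex.I * ζ * 1) x :=
    (HasDerivAt.ofReal_comp (hasDerivAt_id _)).const_mul _
  convert! h.cexp using 1
  ring

theorem causal_eq (ζ : ℂ) (h : ℝ → ℂ) (x : ℝ) : causal ζ h x =
    Complex.exp (Complex.I * ζ * x) *
      ∫ t in (0 : ℝ)..x, Complex.exp (Complex.I * (-ζ) * t) * h t := by
  rw [causal, ← intervalIntegral.integral_const_mul]
  refine intervalIntegral.integral_congr fun t _ => ?_
  rw [← mul_assoc, ← Complex.exp_add]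
  push_cast
  ring_nf

theorem anticausal_eq (ζ : ℂ) (h : ℝ → ℂ) (x : ℝ) : anticausal ζ h x =
    Complex.exp (Complex.I * (-ζ) * x) *
      ∫ y in Ioi x, Complex.exp (Complex.I * ζ * y) * h y := by
  rw [anticausal, ← integral_const_mul]
  refine integral_congr_ae (Eventually.of_forall fun t => ?_)
  dsimp only
  rw [← mul_assoc, ← Complex.exp_add]
  push_cast
  ring_nf

theorem cexp_mul_cexp_neg (ζ : ℂ) (x : ℝ) :
    Complex.exp (Complex.I * ζ * x) * Complex.exp (Complex.I * (-ζ) * x) = 1 := by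
  rw [← Complex.exp_add]
  ring_nf
  exact Complex.exp_zero

@[simp]
theorem causal_apply_zero (ζ : ℂ) (h : ℝ → ℂ) : causal ζ h 0 = 0 := by
  simp [causal]

theorem isPrimitive_causal {ζ : ℂ} {h : ℝ → ℂ}
    (hh : ∀ x, 0 ≤ x → IntervalIntegrable h volume 0 x) :
    IsPrimitive (causal ζ h) (fun x => Complex.I * ζ * causal ζ h x + h x) := by
  have h1 : IsPrimitive (fun x => ∫ t in (0 : ℝ)..x, Complex.exp (Complex.I * (-ζ) * t) * h t)
      (fun t => Complex.exp (Complex.I * (-ζ) * t) * h t) := fun x hx =>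
    ⟨(hh x hx).continuousOn_mul (by fun_prop), by simp⟩
  refine ((isPrimitive_cexp ζ).mul h1).congr (fun x _ => causal_eq ζ h x) fun x _ => ?_
  rw [causal_eq]
  linear_combination (-h x) * cexp_mul_cexp_neg ζ x

theorem isPrimitive_anticausal {ζ : ℂ} {h : ℝ → ℂ}
    (hh : IntegrableOn (fun y : ℝ => Complex.exp (Complex.I * ζ * y) * h y) (Ioi 0)) :
    IsPrimitive (anticausal ζ h) (fun x => -(Complex.I * ζ * anticausal ζ h x) - h x) := by
  have h1 : IsPrimitive (fun x => ∫ y in Ioi x, Complex.exp (Complex.I * ζ * y) * h y)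
      (fun t => -(Complex.exp (Complex.I * ζ * t) * h t)) := fun x hx => by
    have hi : IntervalIntegrable (fun y : ℝ => Complex.exp (Complex.I * ζ * y) * h y) volume 0 x :=
      (intervalIntegrable_iff_integrableOn_Ioc_of_le hx).2 (hh.mono_set Ioc_subset_Ioi_self)
    refine ⟨hi.neg, ?_⟩
    have := intervalIntegral.integral_interval_add_Ioi hh (hh.mono_set (Ioi_subset_Ioi hx))
    dsimp only
    rw [intervalIntegral.integral_neg, ← this]
    ring
  refine ((isPrimitive_cexp (-ζ)).mul h1).congr (fun x _ => anticausal_eq ζ h x) fun x _ => ?_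
  rw [anticausal_eq]
  linear_combination (h x) * cexp_mul_cexp_neg ζ x

end Primitives

/-! ### The free resolvent -/

section Resolvent

variable {n : ℕ}

/-- The decaying exponential `e^{iζx}` on every edge. -/
def starExp (ζ : ℂ) (p : Fin n × ℝ) : ℂ := Complex.exp (Complex.I * ζ * p.2)

theorem memLp_exp {ζ : ℂ} (hζ : 0 < ζ.im) :
    MemLp (fun x : ℝ => Complex.exp (Complex.I * ζ * x)) 2 (volume.restrict (Ioi 0)) := by
  refine (memLp_congr_ae ?_).1 (memLp_star_iff.1 (memLp_causalKernel_left (n := 1) hζ (0, 0)) 0)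
  filter_upwards [ae_restrict_mem measurableSet_Ioi] with x hx
  simp [causalKernel, mem_Ioi.1 hx]

theorem memLp_starExp {ζ : ℂ} (hζ : 0 < ζ.im) :
    MemLp (starExp ζ : Fin n × ℝ → ℂ) 2 (starMeasure n) :=
  memLp_star_iff.2 fun _ => memLp_exp hζ

/-- `∑_j ∫_0^∞ e^{iζy} h_j(y) dy`. -/
def starPairing (ζ : ℂ) (h : Fin n × ℝ → ℂ) : ℂ := ∑ j, anticausal ζ (fun y => h (j, y)) 0

theorem starPairing_eq_integral {ζ : ℂ} {h : Fin n × ℝ → ℂ}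
    (hi : Integrable (fun p => starExp ζ p * h p) (starMeasure n)) :
    starPairing ζ h = ∫ p, starExp ζ p * h p ∂starMeasure n := by
  rw [integral_star hi]
  simp [starPairing, anticausal, starExp]

/-- The explicit solution `u` of `-u'' - ζ² u = h` in `L₂(Γ)` with the vertex conditions:
`u' = iζ u + w` and `w' = -iζ w - h` on each edge, and
`u_j(0) = (i / nζ) ∑_k ∫_0^∞ e^{iζy} h_k(y) dy` for all `j`. -/
def resolventFun (ζ : ℂ) (h : Fin n × ℝ → ℂ) (p : Fin n × ℝ) : ℂ :=
  causal ζ (anticausal ζ fun y => h (p.1, y)) p.2 +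
    Complex.I / (n * ζ) * starPairing ζ h * starExp ζ p

theorem starPairing_congr {ζ : ℂ} {h h' : Fin n × ℝ → ℂ} (H : h =ᵐ[starMeasure n] h') :
    starPairing ζ h = starPairing ζ h' :=
  Finset.sum_congr rfl fun j _ => anticausal_congr (ae_star_iff.1 H j) le_rfl

theorem resolventFun_congr {ζ : ℂ} {h h' : Fin n × ℝ → ℂ} (H : h =ᵐ[starMeasure n] h')
    {p : Fin n × ℝ} (hp : 0 ≤ p.2) : resolventFun ζ h p = resolventFun ζ h' p := by
  rw [resolventFun, resolventFun, starPairing_congr H]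
  congr 1
  refine causal_congr ?_ hp
  filter_upwards [ae_restrict_mem measurableSet_Ioi] with x hx
  exact anticausal_congr (ae_star_iff.1 H p.1) (le_of_lt hx)

/-- `resolventFun` defines a bounded operator, by Schur's test for the two factors of its main part. -/
theorem exists_resolventOp {ζ : ℂ} (hζ : 0 < ζ.im) :
    ∃ R : StarL2 n →L[ℂ] StarL2 n, ∀ f, R f =ᵐ[starMeasure n] resolventFun ζ f := by
  obtain ⟨S, hS⟩ := exists_causalOp (n := n) hζ
  obtain ⟨T, hT⟩ := exists_anticausalOp (n := n) hζ
  set e : StarL2 n := (memLp_starExp hζ).toLp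
  set e' : StarL2 n := (memLp_starExp hζ).star.toLp
  refine ⟨S ∘L T + (Complex.I / (n * ζ)) • (innerSL ℂ e').smulRight e, fun f => ?_⟩
  have h1 : (S ∘L T + (Complex.I / (n * ζ)) • (innerSL ℂ e').smulRight e) f =
      S (T f) + (Complex.I / (n * ζ) * starPairing ζ f) • e := by
    rw [starPairing_eq_integral (integrable_mul_lp (memLp_starExp hζ) f),
      integral_mul_eq_inner (memLp_starExp hζ) f]
    simp [mul_smul, e']
  rw [h1]
  filter_upwards [Lp.coeFn_add (S (T f)) ((Complex.I / (n * ζ) * starPairing ζ f) • e), hS (T f),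
    Lp.coeFn_smul (Complex.I / (n * ζ) * starPairing ζ f) e, (memLp_starExp (n := n) hζ).coeFn_toLp,
    ae_star_nonneg] with p h2 h3 h4 h5 h6
  rw [h2, Pi.add_apply, h3, h4, Pi.smul_apply, h5, smul_eq_mul, resolventFun]
  congr 1
  exact causal_congr (ae_star_iff.1 (hT f) p.1) h6

theorem integrableOn_exp_mul {ζ : ℂ} (hζ : 0 < ζ.im) {h : ℝ → ℂ}
    (hh : MemLp h 2 (volume.restrict (Ioi 0))) :
    IntegrableOn (fun y : ℝ => Complex.exp (Complex.I * ζ * y) * h y) (Ioi 0) :=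
  (memLp_exp hζ).integrable_mul hh

theorem intervalIntegrable_of_memLp {h : ℝ → ℂ} (hh : MemLp h 2 (volume.restrict (Ioi 0)))
    {x : ℝ} (hx : 0 ≤ x) : IntervalIntegrable h volume 0 x := by
  rw [intervalIntegrable_iff_integrableOn_Ioc_of_le hx]
  exact (hh.mono_measure (Measure.restrict_mono Ioc_subset_Ioi_self le_rfl)).integrable one_le_two

/-- For `Im ζ > 0` the number `ζ²` is not in `[0, ∞)`. -/
theorem eq_zero_of_ofReal_eq_sq_mul {ζ : ℂ} (hζ : 0 < ζ.im) {a b : ℝ} (ha : 0 ≤ a) (hb : 0 ≤ b)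
    (h : (a : ℂ) = ζ ^ 2 * b) : b = 0 := by
  have h1 := congrArg Complex.re h
  have h2 := congrArg Complex.im h
  simp only [sq, Complex.mul_re, Complex.mul_im, Complex.ofReal_re, Complex.ofReal_im] at h1 h2
  have h3 : ζ.re * b = 0 := by
    have : ζ.im * (ζ.re * b) = 0 := by linarith
    exact (mul_eq_zero.1 this).resolve_left hζ.ne'
  rcases mul_eq_zero.1 h3 with h4 | h4
  · rw [h4] at h1
    by_contra hb0
    have : 0 < b := lt_of_le_of_ne hb (Ne.symm hb0)
    have : 0 < ζ.im * ζ.im * b := by positivity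
    nlinarith
  · exact h4

theorem integrable_mul_conj {u v : ℝ → ℂ} (hu : MemLp u 2 (volume.restrict (Ioi 0)))
    (hv : MemLp v 2 (volume.restrict (Ioi 0))) :
    IntegrableOn (fun x => u x * conj (v x)) (Ioi 0) := hu.integrable_mul hv.star

theorem OperatorEq.sub {ψ₁ ψ₂ f₁ f₂ : StarL2 n} (h₁ : OperatorEq 0 ψ₁ f₁)
    (h₂ : OperatorEq 0 ψ₂ f₂) : OperatorEq 0 (ψ₁ - ψ₂) (f₁ - f₂) := by
  obtain ⟨u, du, hu, e, H⟩ := h₁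
  obtain ⟨v, dv, hv, e', H'⟩ := h₂
  refine ⟨fun j x => u j x - v j x, fun j x => du j x - dv j x, ?_, ?_, fun φ dφ hφ => ?_⟩
  · refine ⟨fun j => (hu.memLp j).sub (hv.memLp j),
      fun j => (hu.memLp_deriv j).sub (hv.memLp_deriv j), fun j x hx => ?_, fun i j => ?_⟩
    · rw [intervalIntegral.integral_sub (intervalIntegrable_of_memLp (hu.memLp_deriv j) hx)
        (intervalIntegrable_of_memLp (hv.memLp_deriv j) hx), hu.eq_integral j x hx,
        hv.eq_integral j x hx]
      ring
    · rw [hu.vertex i j, hv.vertex i j]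
  · filter_upwards [e, e', Lp.coeFn_sub ψ₁ ψ₂] with p h1 h2 h3
    rw [h3, Pi.sub_apply, h1, h2]
  · have k1 := H φ dφ hφ
    have k2 := H' φ dφ hφ
    simp only [Pi.zero_apply, Complex.ofReal_zero, zero_mul, integral_zero, Finset.sum_const_zero,
      add_zero] at k1 k2 ⊢
    have e1 : ∀ j, ∫ x in Ioi (0 : ℝ), (du j x - dv j x) * conj (dφ j x) =
        (∫ x in Ioi (0 : ℝ), du j x * conj (dφ j x)) - ∫ x in Ioi (0 : ℝ), dv j x * conj (dφ j x) :=
      fun j => by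
        rw [← integral_sub (integrable_mul_conj (hu.memLp_deriv j) (hφ.memLp_deriv j))
          (integrable_mul_conj (hv.memLp_deriv j) (hφ.memLp_deriv j))]
        simp only [sub_mul]
    have e2 : ∀ j, ∫ x in Ioi (0 : ℝ), (f₁ - f₂) (j, x) * conj (φ j x) =
        (∫ x in Ioi (0 : ℝ), f₁ (j, x) * conj (φ j x)) -
          ∫ x in Ioi (0 : ℝ), f₂ (j, x) * conj (φ j x) := fun j => by
        rw [← integral_sub (integrable_mul_conj (Lp.memLp_edge f₁ j) (hφ.memLp j))
          (integrable_mul_conj (Lp.memLp_edge f₂ j) (hφ.memLp j))]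
        refine integral_congr_ae ?_
        filter_upwards [ae_star_iff.1 (Lp.coeFn_sub f₁ f₂) j] with x hx
        rw [hx, Pi.sub_apply, sub_mul]
    simp only [e1, e2, Finset.sum_sub_distrib, k1, k2]

/-- `ζ²` is not an eigenvalue of `H₀ ≥ 0`: test the eigenvalue equation with the eigenfunction. -/
theorem OperatorEq.eq_zero {ζ : ℂ} (hζ : 0 < ζ.im) {ψ : StarL2 n}
    (h : OperatorEq 0 ψ (ζ ^ 2 • ψ)) : ψ = 0 := by
  obtain ⟨u, du, hu, e, H⟩ := h
  have k := H u du hu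
  have sq_int : ∀ v : ℝ → ℂ, ∫ x in Ioi (0 : ℝ), v x * conj (v x) =
      ((∫ x in Ioi (0 : ℝ), ‖v x‖ ^ 2 : ℝ) : ℂ) := fun v => by
    rw [← integral_complex_ofReal]
    simp only [Complex.mul_conj']
    push_cast
    rfl
  have eψ : ∀ j, ∫ x in Ioi (0 : ℝ), (ζ ^ 2 • ψ : StarL2 n) (j, x) * conj (u j x) =
      ζ ^ 2 * ((∫ x in Ioi (0 : ℝ), ‖u j x‖ ^ 2 : ℝ) : ℂ) := fun j => by
    rw [← sq_int, ← integral_const_mul]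
    refine integral_congr_ae ?_
    filter_upwards [ae_star_iff.1 (Lp.coeFn_smul (ζ ^ 2) ψ) j, ae_star_iff.1 e j] with x h1 h2
    rw [h1, Pi.smul_apply, h2, smul_eq_mul, mul_assoc]
  simp only [Pi.zero_apply, Complex.ofReal_zero, zero_mul, integral_zero, Finset.sum_const_zero,
      add_zero, eψ, sq_int, ← Finset.mul_sum, ← Complex.ofReal_sum] at k
  have hb := eq_zero_of_ofReal_eq_sq_mul hζ (Finset.sum_nonneg fun j _ => integral_nonneg fun x => by positivity)
    (Finset.sum_nonneg fun j _ => integral_nonneg fun x => by positivity) k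
  rw [Finset.sum_eq_zero_iff_of_nonneg fun j _ => integral_nonneg fun x => by positivity] at hb
  rw [Lp.eq_zero_iff_ae_eq_zero]
  refine e.trans (ae_star_iff.2 fun j => ?_)
  have h1 := (integral_eq_zero_iff_of_nonneg (fun x => by positivity)
    ((hu.memLp j).integrable_norm_pow two_ne_zero)).1 (hb j (Finset.mem_univ j))
  filter_upwards [h1] with x hx
  simpa using hx

/-- Integration by parts on each edge; the boundary terms cancel by the choice of `u_j(0)` in
`resolventFun`, which expresses the Kirchhoff condition. -/
theorem operatorEq_resolventOp {ζ : ℂ} (hn : n ≠ 0) (hζ : 0 < ζ.im)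
    {R : StarL2 n →L[ℂ] StarL2 n} (hR : ∀ f, R f =ᵐ[starMeasure n] resolventFun ζ f)
    (f : StarL2 n) : OperatorEq 0 (R f) (f + ζ ^ 2 • R f) := by
  have hζ0 : ζ ≠ 0 := by
    rintro rfl
    simp at hζ
  have hn0 : (n : ℂ) ≠ 0 := by exact_mod_cast hn
  obtain ⟨T, hT⟩ := exists_anticausalOp (n := n) hζ
  set w : Fin n → ℝ → ℂ := fun j => anticausal ζ fun y => f (j, y)
  set u : Fin n → ℝ → ℂ := fun j x => resolventFun ζ f (j, x)
  set c := Complex.I / (n * ζ) * starPairing ζ f with hc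
  have lw : ∀ j, MemLp (w j) 2 (volume.restrict (Ioi 0)) := fun j =>
    (memLp_congr_ae (ae_star_iff.1 (hT f) j)).1 (Lp.memLp_edge (T f) j)
  have lu : ∀ j, MemLp (u j) 2 (volume.restrict (Ioi 0)) := fun j =>
    (memLp_congr_ae (ae_star_iff.1 (hR f) j)).1 (Lp.memLp_edge (R f) j)
  have pw : ∀ j, IsPrimitive (w j) (fun x => -(Complex.I * ζ * w j x) - f (j, x)) := fun j =>
    isPrimitive_anticausal (integrableOn_exp_mul hζ (Lp.memLp_edge f j))
  have pu : ∀ j, IsPrimitive (u j) (fun x => Complex.I * ζ * u j x + w j x) := fun j => by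
    have h1 := isPrimitive_causal (ζ := ζ) fun x hx => intervalIntegrable_of_memLp (lw j) hx
    refine (h1.add ((isPrimitive_cexp ζ).const_mul c)).congr (fun x _ => rfl) fun x _ => ?_
    simp only [u, w, resolventFun, starExp]
    ring
  have u0 : ∀ j, u j 0 = c := fun j => by simp [u, resolventFun, starExp, hc]
  have ldu : ∀ j, MemLp (fun x => Complex.I * ζ * u j x + w j x) 2 (volume.restrict (Ioi 0)) :=
    fun j => ((lu j).const_mul _).add (lw j)
  refine ⟨u, fun j x => Complex.I * ζ * u j x + w j x,
    ⟨lu, ldu, fun j x hx => (pu j).eq hx, fun i j => by rw [u0, u0]⟩, hR f, fun φ dφ hφ => ?_⟩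
  have pφ : ∀ j, IsPrimitive (fun x => conj (φ j x)) (fun x => conj (dφ j x)) := fun j x hx => by
    have hi := intervalIntegrable_of_memLp (hφ.memLp_deriv j) hx
    refine ⟨intervalIntegrable_of_memLp (hφ.memLp_deriv j).star hx, ?_⟩
    dsimp only
    rw [hφ.eq_integral j x hx, map_add]
    congr 1
    rw [intervalIntegral.integral_of_le hx, intervalIntegral.integral_of_le hx, integral_conj]
  have key : ∀ j, ∫ x in Ioi (0 : ℝ), (Complex.I * ζ * u j x + w j x) * conj (dφ j x) =
      -((Complex.I * ζ * c + w j 0) * conj (φ j 0)) +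
        ∫ x in Ioi (0 : ℝ), (f + ζ ^ 2 • R f : StarL2 n) (j, x) * conj (φ j x) := fun j => by
    have pdu := ((pu j).const_mul (Complex.I * ζ)).add (pw j)
    have ldd : MemLp (fun x => Complex.I * ζ * (Complex.I * ζ * u j x + w j x) +
        (-(Complex.I * ζ * w j x) - f (j, x))) 2 (volume.restrict (Ioi 0)) :=
      ((ldu j).const_mul _).add (((lw j).const_mul _).neg.sub (Lp.memLp_edge f j))
    rw [pdu.integral_mul_eq (pφ j) (ldu j) ldd (hφ.memLp j).star (hφ.memLp_deriv j).star, u0,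
      sub_eq_add_neg, ← integral_neg]
    congr 1
    refine integral_congr_ae ?_
    filter_upwards [ae_star_iff.1 (Lp.coeFn_add f (ζ ^ 2 • R f)) j,
      ae_star_iff.1 (Lp.coeFn_smul (ζ ^ 2) (R f)) j, ae_star_iff.1 (hR f) j] with x h1 h2 h3
    rw [h1, Pi.add_apply, h2, Pi.smul_apply, h3, smul_eq_mul]
    linear_combination (-ζ ^ 2 * u j x * conj (φ j x)) * Complex.I_mul_I
  simp only [Pi.zero_apply, Complex.ofReal_zero, zero_mul, integral_zero, Finset.sum_const_zero,
    add_zero, key, Finset.sum_add_distrib]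
  have hv : ∀ j, conj (φ j 0) = conj (φ ⟨0, Nat.pos_of_ne_zero hn⟩ 0) := fun j => by
    rw [hφ.vertex j]
  simp only [hv, Finset.sum_neg_distrib, ← Finset.sum_mul]
  have kirch : ∑ j, (Complex.I * ζ * c + w j 0) = 0 := by
    rw [Finset.sum_add_distrib, Finset.sum_const, Finset.card_univ, Fintype.card_fin, nsmul_eq_mul, hc]
    change _ + starPairing ζ f = 0
    field_simp
    linear_combination (starPairing ζ f) * Complex.I_mul_I
  rw [kirch]
  ring

theorem isResolvent_resolventOp {ζ : ℂ} (hn : n ≠ 0) (hζ : 0 < ζ.im)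
    {R : StarL2 n →L[ℂ] StarL2 n} (hR : ∀ f, R f =ᵐ[starMeasure n] resolventFun ζ f) :
    IsResolvent 0 (ζ ^ 2) R := by
  refine ⟨operatorEq_resolventOp hn hζ hR, fun ψ f h => ?_⟩
  have h1 := (operatorEq_resolventOp hn hζ hR (f - ζ ^ 2 • ψ)).sub h
  have e : f - ζ ^ 2 • ψ + ζ ^ 2 • R (f - ζ ^ 2 • ψ) - f = ζ ^ 2 • (R (f - ζ ^ 2 • ψ) - ψ) := by
    rw [smul_sub]
    abel
  rw [e] at h1
  exact sub_eq_zero.1 (OperatorEq.eq_zero hζ h1)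

theorem IsResolvent.unique {V : Fin n → ℝ → ℝ} {z : ℂ} {R R' : StarL2 n →L[ℂ] StarL2 n}
    (h : IsResolvent V z R) (h' : IsResolvent V z R') : R = R' := by
  ext1 f
  have := h'.2 _ _ (h.1 f)
  rwa [add_sub_cancel_right, eq_comm] at this

end Resolvent

/-! ### The determinant of a diagonal matrix plus a matrix of rank one -/

section RankOneDet

variable {ι : Type*} [Fintype ι] [DecidableEq ι]

theorem det_diagonal_add_rankOne_of_ne_zero {g : ι → ℂ} (hg : ∀ i, g i ≠ 0) (c : ℂ) (w : ι → ℂ) :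
    (Matrix.of fun i j => (if i = j then g j else 0) + c * w j).det =
      ∏ j, g j + c * ∑ j, w j * ∏ k ∈ Finset.univ.erase j, g k := by
  have e : (Matrix.of fun i j => (if i = j then g j else 0) + c * w j) =
      Matrix.diagonal g * (1 + Matrix.replicateCol Unit (fun i => c / g i) *
        Matrix.replicateRow Unit w) := by
    ext i j
    rw [Matrix.diagonal_mul, Matrix.of_apply, Matrix.add_apply, Matrix.mul_apply, Matrix.one_apply]
    have := hg i
    split_ifs with h
    · subst h
      simp
      field_simp
    · simp
      field_simp
  rw [e, Matrix.det_mul, Matrix.det_diagonal, Matrix.det_one_add_replicateCol_mul_replicateRow,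
    mul_add, mul_one, dotProduct, Finset.mul_sum, Finset.mul_sum]
  congr 1
  refine Finset.sum_congr rfl fun j _ => ?_
  rw [← Finset.mul_prod_erase Finset.univ g (Finset.mem_univ j)]
  have := hg j
  field_simp

/-- The determinant of a diagonal matrix plus one of rank one, where the diagonal may vanish. -/
theorem det_diagonal_add_rankOne (g : ι → ℂ) (c : ℂ) (w : ι → ℂ) :
    (Matrix.of fun i j => (if i = j then g j else 0) + c * w j).det =
      ∏ j, g j + c * ∑ j, w j * ∏ k ∈ Finset.univ.erase j, g k := by
  -- Both sides are continuous in `g`, and `g + ε` has no zero entry for small `ε ≠ 0`.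
  set F : ℂ → ℂ := fun ε => (Matrix.of fun i j => (if i = j then g j + ε else 0) + c * w j).det
  set G : ℂ → ℂ := fun ε =>
    ∏ j, (g j + ε) + c * ∑ j, w j * ∏ k ∈ Finset.univ.erase j, (g k + ε)
  have hF : Continuous F := by
    refine Continuous.matrix_det ?_
    refine continuous_matrix fun i j => ?_
    simp only [Matrix.of_apply]
    split_ifs <;> fun_prop
  have hG : Continuous G := by fun_prop
  have hne : ∀ᶠ ε in 𝓝[≠] (0 : ℂ), F ε = G ε := by
    have h1 : ∀ j, ∀ᶠ ε in 𝓝[≠] (0 : ℂ), g j + ε ≠ 0 := fun j => by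
      by_cases hj : g j = 0
      · filter_upwards [self_mem_nhdsWithin] with ε hε
        simpa [hj] using hε
      · have : Tendsto (fun ε : ℂ => g j + ε) (𝓝[≠] 0) (𝓝 (g j + 0)) :=
          ((continuous_const.add continuous_id).tendsto 0).mono_left nhdsWithin_le_nhds
        rw [add_zero] at this
        exact this.eventually_ne hj
    filter_upwards [eventually_all.2 h1] with ε hε
    exact det_diagonal_add_rankOne_of_ne_zero hε c w
  have hlim := tendsto_nhds_unique_of_eventuallyEq
    ((hF.tendsto 0).mono_left (nhdsWithin_le_nhds (s := {0}ᶜ)))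
    ((hG.tendsto 0).mono_left nhdsWithin_le_nhds) hne
  simpa [F, G] using hlim

end RankOneDet

/-! ### The free resolvent between two multiplications -/

section Sandwich

variable {n : ℕ}

/-- The Hilbert–Schmidt constant `(2 Im ζ)^{-1/2}` of the edge kernels. -/
def kernelConst (ζ : ℂ) : ℝ := √(1 / (2 * ζ.im))

theorem ofReal_kernelConst_sq {ζ : ℂ} (hζ : 0 < ζ.im) :
    ENNReal.ofReal (kernelConst ζ) ^ 2 = ENNReal.ofReal (1 / ((2 : ℕ) * ζ.im)) := by
  rw [kernelConst, ← ENNReal.ofReal_pow (Real.sqrt_nonneg _), Real.sq_sqrt (by positivity)]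
  norm_num

theorem integrable_mul_of_memLp {b : Fin n × ℝ → ℂ} (hb : MemLp b 2 (starMeasure n))
    (f : StarL2 n) : Integrable (fun q => b q * f q) (starMeasure n) :=
  hb.integrable_mul (Lp.memLp f)

theorem integrable_causalKernel_mul_left {ζ : ℂ} (hζ : 0 < ζ.im) {h : Fin n × ℝ → ℂ}
    (hh : Integrable h (starMeasure n)) (p : Fin n × ℝ) :
    Integrable (fun q => causalKernel ζ q p * h q) (starMeasure n) :=
  hh.bdd_mul ((measurable_causalKernel ζ).comp measurable_prodMk_right).aestronglyMeasurable
    (c := 1) (Eventually.of_forall fun q => norm_causalKernel_le_one hζ q p)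

theorem exists_causalWeightedOp {ζ : ℂ} (hζ : 0 < ζ.im) {a : Fin n × ℝ → ℂ}
    (ha : MemLp a 2 (starMeasure n)) :
    ∃ T : StarL2 n →L[ℂ] StarL2 n,
      (∀ f, T f =ᵐ[starMeasure n] fun p => a p * causal ζ (fun t => f (p.1, t)) p.2) ∧
      HilbertSchmidtLE T (kernelConst ζ * (eLpNorm a 2 (starMeasure n)).toReal) := by
  obtain ⟨T, hT, hT2⟩ := exists_leftWeightedOp ha (c := causalKernel ζ)
    (measurable_causalKernel ζ) (Real.sqrt_nonneg _) fun p => by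
      rw [← kernelConst, ofReal_kernelConst_sq hζ]
      exact lintegral_causalKernel_right hζ p two_ne_zero
  refine ⟨T, fun f => ?_, hT2⟩
  filter_upwards [hT f, ae_star_nonneg] with p hp h0
  rw [hp, integral_causalKernel h0 (integrable_mul_lp (memLp_causalKernel_right hζ p) f)]

theorem exists_anticausalLeftWeightedOp {ζ : ℂ} (hζ : 0 < ζ.im) {a : Fin n × ℝ → ℂ}
    (ha : MemLp a 2 (starMeasure n)) :
    ∃ T : StarL2 n →L[ℂ] StarL2 n,
      (∀ f, T f =ᵐ[starMeasure n] fun p => a p * anticausal ζ (fun t => f (p.1, t)) p.2) ∧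
      HilbertSchmidtLE T (kernelConst ζ * (eLpNorm a 2 (starMeasure n)).toReal) := by
  obtain ⟨T, hT, hT2⟩ := exists_leftWeightedOp ha (c := fun p q => causalKernel ζ q p)
    ((measurable_causalKernel ζ).comp measurable_swap) (Real.sqrt_nonneg _) fun p => by
      rw [← kernelConst, ofReal_kernelConst_sq hζ]
      exact lintegral_causalKernel_left hζ p two_ne_zero
  refine ⟨T, fun f => ?_, hT2⟩
  filter_upwards [hT f, ae_star_nonneg] with p hp h0
  rw [hp, integral_anticausalKernel h0 (integrable_mul_lp (memLp_causalKernel_left hζ p) f)]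

theorem exists_anticausalRightWeightedOp {ζ : ℂ} (hζ : 0 < ζ.im) {b : Fin n × ℝ → ℂ}
    (hb : MemLp b 2 (starMeasure n)) :
    ∃ T : StarL2 n →L[ℂ] StarL2 n,
      (∀ f, T f =ᵐ[starMeasure n] fun p =>
        anticausal ζ (fun t => b (p.1, t) * f (p.1, t)) p.2) ∧
      HilbertSchmidtLE T (kernelConst ζ * (eLpNorm b 2 (starMeasure n)).toReal) := by
  obtain ⟨T, hT, hT2⟩ := exists_rightWeightedOp hb (c := fun p q => causalKernel ζ q p)
    ((measurable_causalKernel ζ).comp measurable_swap)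
    (fun p q => norm_causalKernel_le_one hζ q p) (Real.sqrt_nonneg _) fun p => by
      rw [← kernelConst, ofReal_kernelConst_sq hζ]
      exact lintegral_causalKernel_right hζ p two_ne_zero
  refine ⟨T, fun f => ?_, hT2⟩
  filter_upwards [hT f, ae_star_nonneg] with p hp h0
  rw [hp, integral_anticausalKernel (h := fun q => b q * f q) h0
    (integrable_causalKernel_mul_left hζ (integrable_mul_of_memLp hb f) p)]

instance : TopologicalSpace.SeparableSpace (StarL2 n) := by
  have : Fact ((2 : ENNReal) ≠ ⊤) := ⟨by norm_num⟩
  infer_instance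

/-- `A = a R₀(ζ²) b`, the free resolvent between multiplications by functions `a`, `b`. -/
def IsWeightedResolvent (ζ : ℂ) (a b : Fin n × ℝ → ℂ) (A : StarL2 n →L[ℂ] StarL2 n) : Prop :=
  ∀ f, A f =ᵐ[starMeasure n] fun p => a p * resolventFun ζ (fun q => b q * f q) p

theorem memLp_starExp_mul {ζ : ℂ} (hζ : 0 < ζ.im) {a : Fin n × ℝ → ℂ}
    (ha : MemLp a 2 (starMeasure n)) :
    MemLp (fun p => starExp ζ p * a p) 2 (starMeasure n) ∧
      (eLpNorm (fun p => starExp ζ p * a p) 2 (starMeasure n)).toReal ≤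
        (eLpNorm a 2 (starMeasure n)).toReal := by
  have hle : ∀ᵐ p ∂starMeasure n, ‖starExp ζ p * a p‖ ≤ ‖a p‖ := by
    filter_upwards [ae_star_nonneg] with p hp
    rw [norm_mul]
    exact mul_le_of_le_one_left (norm_nonneg _) (norm_cexp_I_mul_le_one hζ.le hp)
  exact ⟨ha.of_le ((memLp_starExp hζ).1.mul ha.1) hle,
    ENNReal.toReal_mono ha.2.ne (eLpNorm_mono_ae hle)⟩

/-- The trace norm of `a R₀(ζ²) b` is at most a constant times `‖a‖ ‖b‖`. -/
def sandwichConst (n : ℕ) (ζ : ℂ) : ℝ :=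
  kernelConst ζ * kernelConst ζ + ‖Complex.I / (n * ζ)‖

/-- The main part of `a R₀(ζ²) b` is the product of the Hilbert–Schmidt operators with the kernels
`a(x) 1_{t < x} e^{iζ(x - t)}` and `1_{t < y} e^{iζ(y - t)} b(y)`; the rest has rank one. -/
theorem exists_weightedResolvent {ζ : ℂ} (hζ : 0 < ζ.im) {a b : Fin n × ℝ → ℂ}
    (ha : MemLp a 2 (starMeasure n)) (hb : MemLp b 2 (starMeasure n)) :
    ∃ A : StarL2 n →L[ℂ] StarL2 n, IsWeightedResolvent ζ a b A ∧
      NuclearLE A (sandwichConst n ζ * ((eLpNorm a 2 (starMeasure n)).toReal *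
        (eLpNorm b 2 (starMeasure n)).toReal)) := by
  obtain ⟨P, hP, hP2⟩ := exists_causalWeightedOp hζ ha
  obtain ⟨Q, hQ, hQ2⟩ := exists_anticausalRightWeightedOp hζ hb
  obtain ⟨hea, hea'⟩ := memLp_starExp_mul hζ ha
  obtain ⟨heb, heb'⟩ := memLp_starExp_mul hζ hb
  set e : StarL2 n := hea.toLp with he
  set e' : StarL2 n := heb.star.toLp with he'
  have hne : ‖e‖ ≤ (eLpNorm a 2 (starMeasure n)).toReal := by rwa [he, Lp.norm_toLp]
  have hne' : ‖e'‖ ≤ (eLpNorm b 2 (starMeasure n)).toReal := by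
    rw [he', Lp.norm_toLp, eLpNorm_star]
    exact heb'
  refine ⟨P ∘L Q + (Complex.I / (n * ζ)) • (innerSL ℂ e').smulRight e, fun f => ?_, ?_⟩
  · have h1 : (P ∘L Q + (Complex.I / (n * ζ)) • (innerSL ℂ e').smulRight e) f =
        P (Q f) + (Complex.I / (n * ζ) * starPairing ζ fun q => b q * f q) • e := by
      rw [starPairing_eq_integral]
      · simp only [← mul_assoc]
        rw [integral_mul_eq_inner heb f]
        simp [mul_smul, e']
      · simpa only [← mul_assoc] using integrable_mul_lp heb f
    rw [h1]
    filter_upwards [Lp.coeFn_add (P (Q f))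
      ((Complex.I / (n * ζ) * starPairing ζ fun q => b q * f q) • e), hP (Q f),
      Lp.coeFn_smul (Complex.I / (n * ζ) * starPairing ζ fun q => b q * f q) e, hea.coeFn_toLp,
      ae_star_nonneg] with p h2 h3 h4 h5 h6
    rw [h2, Pi.add_apply, h3, h4, Pi.smul_apply, h5, smul_eq_mul, resolventFun,
      causal_congr (ae_star_iff.1 (hQ f) p.1) h6]
    ring
  · have n1 := (hP2.comp hQ2 (mul_nonneg (Real.sqrt_nonneg _) ENNReal.toReal_nonneg)
      (mul_nonneg (Real.sqrt_nonneg _) ENNReal.toReal_nonneg))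
    have n2 := (nuclearLE_rankOne e' e ((innerSL ℂ e').smulRight e) fun f => by
      simp).smul (Complex.I / (n * ζ))
    refine (n1.add n2).mono ?_
    rw [sandwichConst, add_mul]
    refine add_le_add (le_of_eq (by ring)) ?_
    rw [mul_comm (eLpNorm a 2 (starMeasure n)).toReal]
    exact mul_le_mul_of_nonneg_left
      (mul_le_mul hne' hne (norm_nonneg _) ENNReal.toReal_nonneg) (norm_nonneg _)

theorem integrableOn_edge {h : Fin n × ℝ → ℂ} (hh : Integrable h (starMeasure n)) (j : Fin n) :
    IntegrableOn (fun x => h (j, x)) (Ioi 0) := integrable_star_iff.1 hh j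

theorem integrableOn_exp_mul_of_integrableOn {ζ : ℂ} (hζ : 0 ≤ ζ.im) {h : ℝ → ℂ}
    (hh : IntegrableOn h (Ioi 0)) {x : ℝ} (hx : 0 ≤ x) :
    IntegrableOn (fun y : ℝ => Complex.exp (Complex.I * ζ * ((y - x : ℝ) : ℂ)) * h y) (Ioi x) := by
  refine (hh.mono_set (Ioi_subset_Ioi hx)).bdd_mul (c := 1)
    (by fun_prop) ?_
  filter_upwards [ae_restrict_mem measurableSet_Ioi] with y hy
  exact norm_cexp_I_mul_le_one hζ (by linarith [mem_Ioi.1 hy])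

theorem isPrimitive_anticausal_of_integrableOn {ζ : ℂ} (hζ : 0 ≤ ζ.im) {h : ℝ → ℂ}
    (hh : IntegrableOn h (Ioi 0)) :
    IsPrimitive (anticausal ζ h) (fun x => -(Complex.I * ζ * anticausal ζ h x) - h x) :=
  isPrimitive_anticausal (by simpa using integrableOn_exp_mul_of_integrableOn hζ hh le_rfl)

theorem anticausal_sub {ζ : ℂ} (hζ : 0 ≤ ζ.im) {h h' : ℝ → ℂ} (hh : IntegrableOn h (Ioi 0))
    (hh' : IntegrableOn h' (Ioi 0)) {x : ℝ} (hx : 0 ≤ x) :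
    anticausal ζ (fun y => h y - h' y) x = anticausal ζ h x - anticausal ζ h' x := by
  rw [anticausal, anticausal, anticausal,
    ← integral_sub (integrableOn_exp_mul_of_integrableOn hζ hh hx)
      (integrableOn_exp_mul_of_integrableOn hζ hh' hx)]
  simp only [mul_sub]

theorem causal_sub {ζ : ℂ} {h h' : ℝ → ℂ} {x : ℝ} (hh : IntervalIntegrable h volume 0 x)
    (hh' : IntervalIntegrable h' volume 0 x) :
    causal ζ (fun y => h y - h' y) x = causal ζ h x - causal ζ h' x := by
  rw [causal, causal, causal, ← intervalIntegral.integral_sub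
    (hh.continuousOn_mul (by fun_prop)) (hh'.continuousOn_mul (by fun_prop))]
  simp only [mul_sub]

theorem resolventFun_sub {ζ : ℂ} (hζ : 0 < ζ.im) {h h' : Fin n × ℝ → ℂ}
    (hh : Integrable h (starMeasure n)) (hh' : Integrable h' (starMeasure n)) {p : Fin n × ℝ}
    (hp : 0 ≤ p.2) :
    resolventFun ζ (fun q => h q - h' q) p = resolventFun ζ h p - resolventFun ζ h' p := by
  have hint : ∀ {g : Fin n × ℝ → ℂ}, Integrable g (starMeasure n) →
      IntervalIntegrable (anticausal ζ fun y => g (p.1, y)) volume 0 p.2 := fun hg => by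
    refine ContinuousOn.intervalIntegrable ?_
    rw [uIcc_of_le hp]
    exact (isPrimitive_anticausal_of_integrableOn hζ.le (integrableOn_edge hg p.1)).continuousOn hp
  have e1 : starPairing ζ (fun q => h q - h' q) = starPairing ζ h - starPairing ζ h' := by
    rw [starPairing, starPairing, starPairing, ← Finset.sum_sub_distrib]
    exact Finset.sum_congr rfl fun j _ =>
      anticausal_sub hζ.le (integrableOn_edge hh j) (integrableOn_edge hh' j) le_rfl
  have e2 : causal ζ (anticausal ζ fun y => h (p.1, y) - h' (p.1, y)) p.2 =
      causal ζ (anticausal ζ fun y => h (p.1, y)) p.2 -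
        causal ζ (anticausal ζ fun y => h' (p.1, y)) p.2 := by
    rw [← causal_sub (hint hh) (hint hh')]
    refine causal_congr ?_ hp
    filter_upwards [ae_restrict_mem measurableSet_Ioi] with x hx
    exact anticausal_sub hζ.le (integrableOn_edge hh p.1) (integrableOn_edge hh' p.1) (le_of_lt hx)
  rw [resolventFun, resolventFun, resolventFun, e1, e2]
  ring

theorem IsWeightedResolvent.sub_eq {ζ : ℂ} (hζ : 0 < ζ.im) {a b a' b' : Fin n × ℝ → ℂ}
    (hb : MemLp b 2 (starMeasure n)) (hb' : MemLp b' 2 (starMeasure n))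
    {A A' B₁ B₂ : StarL2 n →L[ℂ] StarL2 n} (hA : IsWeightedResolvent ζ a b A)
    (hA' : IsWeightedResolvent ζ a' b' A') (h₁ : IsWeightedResolvent ζ (a - a') b B₁)
    (h₂ : IsWeightedResolvent ζ a' (b - b') B₂) : A - A' = B₁ + B₂ := by
  ext1 f
  ext1
  have e1 : (A - A') f = A f - A' f := rfl
  have e2 : (B₁ + B₂) f = B₁ f + B₂ f := rfl
  rw [e1, e2]
  filter_upwards [hA f, hA' f, h₁ f, h₂ f, Lp.coeFn_sub (A f) (A' f), Lp.coeFn_add (B₁ f) (B₂ f),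
    ae_star_nonneg] with p p1 p2 p3 p4 p5 p6 p7
  rw [p5, p6, Pi.sub_apply, Pi.add_apply, p1, p2, p3, p4]
  simp only [Pi.sub_apply, sub_mul]
  rw [resolventFun_sub hζ (integrable_mul_of_memLp hb f) (integrable_mul_of_memLp hb' f) p7]
  ring

/-- Restriction of `a` to the points at distance less than `k` from the vertex. -/
def cutoff (k : ℕ) (a : Fin n × ℝ → ℂ) (p : Fin n × ℝ) : ℂ := if p.2 < k then a p else 0

theorem memLp_cutoff {a : Fin n × ℝ → ℂ} (ha : MemLp a 2 (starMeasure n)) (k : ℕ) :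
    MemLp (cutoff k a) 2 (starMeasure n) := by
  have : cutoff k a = ({p : Fin n × ℝ | p.2 < k}).indicator a := by
    funext p
    simp [cutoff, indicator]
  rw [this]
  exact ha.indicator (measurableSet_lt measurable_snd measurable_const)

theorem tendsto_eLpNorm_cutoff_sub {a : Fin n × ℝ → ℂ} (ha : MemLp a 2 (starMeasure n)) :
    Tendsto (fun k => (eLpNorm (cutoff k a - a) 2 (starMeasure n)).toReal) atTop (𝓝 0) := by
  have h1 : Tendsto (fun k => ∫⁻ p, ‖(cutoff k a - a) p‖ₑ ^ 2 ∂starMeasure n) atTop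
      (𝓝 (∫⁻ _, 0 ∂starMeasure n)) := by
    refine tendsto_lintegral_of_dominated_convergence' (fun p => ‖a p‖ₑ ^ 2)
      (fun k => ((memLp_cutoff ha k).1.sub ha.1).enorm.pow_const 2) (fun k => ?_) ?_ ?_
    · refine Eventually.of_forall fun p => ?_
      dsimp only
      gcongr
      by_cases h : p.2 < k <;> simp [cutoff, h]
    · rw [lintegral_enorm_sq]
      exact (ENNReal.pow_lt_top ha.2).ne
    · refine Eventually.of_forall fun p => ?_
      refine tendsto_const_nhds.congr' ?_
      obtain ⟨k, hk⟩ := exists_nat_gt p.2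
      filter_upwards [eventually_ge_atTop k] with m hm
      have : p.2 < m := hk.trans_le (by exact_mod_cast hm)
      simp [cutoff, this]
  simp only [lintegral_enorm_sq, lintegral_zero] at h1
  have h2 := (ENNReal.tendsto_toReal (by simp)).comp h1
  simp only [ENNReal.toReal_zero] at h2
  have h3 : Tendsto (fun k => ((eLpNorm (cutoff k a - a) 2 (starMeasure n)).toReal) ^ 2) atTop
      (𝓝 0) := h2.congr fun k => by simp
  have h4 := (Real.continuous_sqrt.tendsto 0).comp h3
  rw [Real.sqrt_zero] at h4
  exact h4.congr fun k => by simp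

/-- The determinants of the truncated operators converge to that of `a R₀(ζ²) b`. -/
theorem tendsto_fredholmDet_cutoff {ζ : ℂ} (hζ : 0 < ζ.im) {a b : Fin n × ℝ → ℂ}
    (ha : MemLp a 2 (starMeasure n)) (hb : MemLp b 2 (starMeasure n))
    {A : StarL2 n →L[ℂ] StarL2 n} (hA : IsWeightedResolvent ζ a b A) {τ : ℝ} (hτ : NuclearLE A τ)
    {Ak : ℕ → StarL2 n →L[ℂ] StarL2 n}
    (hAk : ∀ k, IsWeightedResolvent ζ (cutoff k a) (cutoff k b) (Ak k)) {d : ℕ → ℂ} {d₀ : ℂ}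
    (hd : ∀ k, Tendsto (compressedDet (Ak k)) atTop (𝓝 (d k)))
    (hd₀ : Tendsto (compressedDet A) atTop (𝓝 d₀)) : Tendsto d atTop (𝓝 d₀) := by
  set α : ℕ → ℝ := fun k => (eLpNorm (cutoff k a - a) 2 (starMeasure n)).toReal
  set β : ℕ → ℝ := fun k => (eLpNorm (cutoff k b - b) 2 (starMeasure n)).toReal
  have hcb : ∀ k, (eLpNorm (cutoff k b) 2 (starMeasure n)).toReal ≤
      (eLpNorm b 2 (starMeasure n)).toReal := fun k =>
    ENNReal.toReal_mono hb.2.ne (eLpNorm_mono fun p => by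
      by_cases h : p.2 < k <;> simp [cutoff, h])
  have hC : 0 ≤ sandwichConst n ζ := add_nonneg (mul_self_nonneg _) (norm_nonneg _)
  refine tendsto_fredholmDet (δ := fun k => sandwichConst n ζ *
    (α k * (eLpNorm b 2 (starMeasure n)).toReal) +
      sandwichConst n ζ * ((eLpNorm a 2 (starMeasure n)).toReal * β k)) hτ (fun k => ?_) ?_ hd hd₀
  · obtain ⟨B₁, h₁, h₁'⟩ := exists_weightedResolvent hζ ((memLp_cutoff ha k).sub ha)
      (memLp_cutoff hb k)
    obtain ⟨B₂, h₂, h₂'⟩ := exists_weightedResolvent hζ ha ((memLp_cutoff hb k).sub hb)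
    rw [IsWeightedResolvent.sub_eq hζ (memLp_cutoff hb k) hb (hAk k) hA h₁ h₂]
    refine (h₁'.mono ?_).add h₂'
    exact mul_le_mul_of_nonneg_left (mul_le_mul_of_nonneg_left (hcb k) ENNReal.toReal_nonneg) hC
  · have := (((tendsto_eLpNorm_cutoff_sub ha).mul_const
      (eLpNorm b 2 (starMeasure n)).toReal).const_mul (sandwichConst n ζ)).add
      (((tendsto_eLpNorm_cutoff_sub hb).const_mul
        (eLpNorm a 2 (starMeasure n)).toReal).const_mul (sandwichConst n ζ))
    simpa using this

end Sandwich

/-! ### The Volterra operator -/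

section Volterra

theorem anticausal_exp_mul (ζ η : ℂ) (h : ℝ → ℂ) (x : ℝ) :
    anticausal ζ (fun y => Complex.exp (Complex.I * η * y) * h y) x =
      Complex.exp (Complex.I * η * x) * anticausal (ζ + η) h x := by
  rw [anticausal, anticausal, ← integral_const_mul]
  refine integral_congr_ae (Eventually.of_forall fun t => ?_)
  dsimp only
  rw [← mul_assoc, ← mul_assoc, ← Complex.exp_add, ← Complex.exp_add]
  push_cast
  ring_nf

theorem anticausal_const_mul (ζ c : ℂ) (h : ℝ → ℂ) (x : ℝ) :
    anticausal ζ (fun y => c * h y) x = c * anticausal ζ h x := by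
  rw [anticausal, anticausal, ← integral_const_mul]
  refine integral_congr_ae (Eventually.of_forall fun t => ?_)
  dsimp only
  ring

theorem anticausal_congr_of_nonneg {ζ : ℂ} {h h' : ℝ → ℂ} (H : ∀ y, 0 ≤ y → h y = h' y) {x : ℝ}
    (hx : 0 ≤ x) : anticausal ζ h x = anticausal ζ h' x := by
  refine anticausal_congr ?_ hx
  filter_upwards [ae_restrict_mem measurableSet_Ioi] with y hy
  exact H y (le_of_lt hy)

theorem anticausal_add {ζ : ℂ} {h h' : ℝ → ℂ}
    (hh : IntegrableOn (fun y : ℝ => Complex.exp (Complex.I * ζ * y) * h y) (Ioi 0))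
    (hh' : IntegrableOn (fun y : ℝ => Complex.exp (Complex.I * ζ * y) * h' y) (Ioi 0)) {x : ℝ}
    (hx : 0 ≤ x) :
    anticausal ζ (fun y => h y + h' y) x = anticausal ζ h x + anticausal ζ h' x := by
  rw [anticausal_eq, anticausal_eq, anticausal_eq, ← mul_add,
    ← integral_add (hh.mono_set (Ioi_subset_Ioi hx)) (hh'.mono_set (Ioi_subset_Ioi hx))]
  simp only [mul_add]

theorem anticausal_eq_zero {ζ : ℂ} {h : ℝ → ℂ} {R : ℝ} (h0 : ∀ y, R ≤ y → h y = 0) {x : ℝ}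
    (hx : R ≤ x) : anticausal ζ h x = 0 := by
  rw [anticausal, setIntegral_congr_fun measurableSet_Ioi
    (g := fun _ => (0 : ℂ)) fun y hy => by simp [h0 y (hx.trans (le_of_lt hy))]]
  simp

theorem integrableOn_exp_mul_anticausal {ζ : ℂ} (hζ : 0 ≤ ζ.im) {h : ℝ → ℂ}
    (hh : IntegrableOn h (Ioi 0)) {R : ℝ} (hR : 0 ≤ R) (h0 : ∀ y, R ≤ y → h y = 0) (η : ℂ) :
    IntegrableOn (fun y : ℝ => Complex.exp (Complex.I * η * y) * anticausal ζ h y) (Ioi 0) := by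
  rw [← Ioc_union_Ioi_eq_Ioi hR]
  refine IntegrableOn.union ?_ ?_
  · refine (ContinuousOn.integrableOn_Icc ?_).mono_set Ioc_subset_Icc_self
    exact (continuous_cexp_I_mul η).continuousOn.mul
      ((isPrimitive_anticausal_of_integrableOn hζ hh).continuousOn hR)
  · refine integrableOn_zero.congr_fun (fun y hy => ?_) measurableSet_Ioi
    rw [anticausal_eq_zero h0 (le_of_lt hy), mul_zero]

/-- Variation of constants from infinity instead of the vertex. -/
theorem causal_eq_anticausal {ζ : ℂ} {w : ℝ → ℂ}
    (hw : IntegrableOn (fun y : ℝ => Complex.exp (Complex.I * (-ζ) * y) * w y) (Ioi 0)) {x : ℝ}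
    (hx : 0 ≤ x) : causal ζ w x =
      Complex.exp (Complex.I * ζ * x) * anticausal (-ζ) w 0 - anticausal (-ζ) w x := by
  have h1 := intervalIntegral.integral_interval_add_Ioi hw (hw.mono_set (Ioi_subset_Ioi hx))
  have h2 : anticausal (-ζ) w 0 =
      ∫ y in Ioi (0 : ℝ), Complex.exp (Complex.I * (-ζ) * y) * w y := by
    simp [anticausal_eq]
  rw [causal_eq, h2, anticausal_eq (-ζ) w x, ← h1, neg_neg]
  ring

variable {n : ℕ}

/-- `K = a S b`, where `S` is the Volterra operator that solves `-u'' - ζ² u = -h` on each edge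
with `u = 0` near infinity; `a` and `b` are supported in a bounded part of the graph. -/
def IsVolterra (ζ : ℂ) (a b : Fin n × ℝ → ℂ) (K : StarL2 n →L[ℂ] StarL2 n) : Prop :=
  ∀ f, K f =ᵐ[starMeasure n] fun p =>
    a p * anticausal (-ζ) (anticausal ζ fun y => b (p.1, y) * f (p.1, y)) p.2

theorem IsVolterra.unique {ζ : ℂ} {a b : Fin n × ℝ → ℂ} {K K' : StarL2 n →L[ℂ] StarL2 n}
    (h : IsVolterra ζ a b K) (h' : IsVolterra ζ a b K') : K = K' := by
  ext1 f
  ext1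
  exact (h f).trans (h' f).symm

/-- The weight that conjugates the Volterra operator to one of small trace norm. -/
def expWeight (R s : ℝ) (p : Fin n × ℝ) : ℂ := Complex.exp ((s * min (max p.2 0) R : ℝ) : ℂ)

theorem exists_expWeightOp (R : ℝ) (hR : 0 ≤ R) (s : ℝ) : ∃ T : StarL2 n →L[ℂ] StarL2 n,
    ∀ f, T f =ᵐ[starMeasure n] fun p => expWeight R s p * f p := by
  refine exists_mulOp (C := Real.exp (|s| * R)) ?_ (Real.exp_pos _).le fun p => ?_
  · unfold expWeight
    exact Continuous.aestronglyMeasurable (by fun_prop)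
  · rw [expWeight, Complex.norm_exp, Complex.ofReal_re]
    have h0 : 0 ≤ min (max p.2 0) R := le_min (le_max_right _ _) hR
    exact Real.exp_le_exp.2 (mul_le_mul (le_abs_self s) (min_le_right _ _) h0 (abs_nonneg s))

/-- The Volterra operator is similar to the one for which both exponential kernels decay faster by
the rate `s`.  The weights `e^{∓s x}` are bounded because the supports are. -/
theorem exists_volterra_conj {ζ : ℂ} {a b : Fin n × ℝ → ℂ}
    (ha : MemLp a 2 (starMeasure n)) (hb : MemLp b 2 (starMeasure n)) {R : ℝ} (hR : 0 ≤ R)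
    (ha0 : ∀ p, R ≤ p.2 → a p = 0) (hb0 : ∀ p, R ≤ p.2 → b p = 0) {s : ℝ}
    (h₁ : 0 < (Complex.I * s - ζ).im) (h₂ : 0 < (ζ + Complex.I * s).im) :
    ∃ M B N : StarL2 n →L[ℂ] StarL2 n, (∀ f, N (M f) = f) ∧ IsVolterra ζ a b (M ∘L B ∘L N) ∧
      NuclearLE B (kernelConst (Complex.I * s - ζ) * (eLpNorm a 2 (starMeasure n)).toReal *
        (kernelConst (ζ + Complex.I * s) * (eLpNorm b 2 (starMeasure n)).toReal)) := by
  obtain ⟨P, hP, hP2⟩ := exists_anticausalLeftWeightedOp h₁ ha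
  obtain ⟨Q, hQ, hQ2⟩ := exists_anticausalRightWeightedOp h₂ hb
  obtain ⟨M, hM⟩ := exists_expWeightOp (n := n) R hR (-s)
  obtain ⟨N, hN⟩ := exists_expWeightOp (n := n) R hR s
  refine ⟨M, P ∘L Q, N, fun f => ?_, fun f => ?_, hP2.comp hQ2
    (mul_nonneg (Real.sqrt_nonneg _) ENNReal.toReal_nonneg)
    (mul_nonneg (Real.sqrt_nonneg _) ENNReal.toReal_nonneg)⟩
  · ext1
    filter_upwards [hN (M f), hM f] with p h1 h2
    rw [h1, h2, expWeight, expWeight, ← mul_assoc, ← Complex.exp_add]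
    simp
  · have e : (M ∘L (P ∘L Q) ∘L N) f = M (P (Q (N f))) := rfl
    rw [e]
    filter_upwards [hM (P (Q (N f))), hP (Q (N f)), ae_star_nonneg] with p h1 h2 h0
    rw [h1, h2]
    by_cases hpR : R ≤ p.2
    · simp [ha0 p hpR]
    -- the weight `e^{s y}` moves from the right factor to the left one and cancels there
    have hin : ∀ t : ℝ, 0 ≤ t →
        anticausal (ζ + Complex.I * s) (fun y => b (p.1, y) * N f (p.1, y)) t =
          Complex.exp (Complex.I * (-(Complex.I * s)) * t) *
            anticausal ζ (fun y => b (p.1, y) * f (p.1, y)) t := fun t ht => by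
      have h3 : anticausal (ζ + Complex.I * s) (fun y => b (p.1, y) * N f (p.1, y)) t =
          anticausal (ζ + Complex.I * s) (fun y => Complex.exp (Complex.I * (-(Complex.I * s)) * y) *
            (b (p.1, y) * f (p.1, y))) t := by
        refine anticausal_congr ?_ ht
        filter_upwards [ae_star_iff.1 (hN f) p.1, ae_restrict_mem measurableSet_Ioi] with y hy hy0
        rw [hy]
        by_cases hyR : R ≤ y
        · simp [hb0 (p.1, y) hyR]
        · have : min (max y 0) R = y := by
            rw [max_eq_left (le_of_lt hy0), min_eq_left (le_of_not_ge hyR)]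
          rw [expWeight, this]
          have : Complex.I * (-(Complex.I * s)) * y = ((s * y : ℝ) : ℂ) := by
            push_cast
            linear_combination (-(s * y : ℂ)) * Complex.I_sq
          rw [this]
          ring
      rw [h3, anticausal_exp_mul, add_neg_cancel_right]
    have hout : anticausal (Complex.I * s - ζ) (fun t => Q (N f) (p.1, t)) p.2 =
        Complex.exp (Complex.I * (-(Complex.I * s)) * p.2) *
          anticausal (-ζ) (anticausal ζ fun y => b (p.1, y) * f (p.1, y)) p.2 := by
      have h3 : Complex.I * s - ζ + -(Complex.I * s) = -ζ := by ring
      rw [← h3, ← anticausal_exp_mul]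
      refine anticausal_congr ?_ h0
      filter_upwards [ae_star_iff.1 (hQ (N f)) p.1, ae_restrict_mem measurableSet_Ioi] with t h4 h5
      rw [h4]
      exact hin t (le_of_lt h5)
    rw [hout]
    have : expWeight R (-s) p * Complex.exp (Complex.I * (-(Complex.I * s)) * p.2) = 1 := by
      rw [expWeight, max_eq_left h0, min_eq_left (le_of_not_ge hpR), ← Complex.exp_add,
        ← Complex.exp_zero]
      congr 1
      push_cast
      linear_combination (-(s * p.2 : ℂ)) * Complex.I_sq
    linear_combination (a p * anticausal (-ζ) (anticausal ζ fun y => b (p.1, y) * f (p.1, y)) p.2) *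
      this

theorem tendsto_kernelConst {ζ : ℕ → ℂ} (h : Tendsto (fun k => (ζ k).im) atTop atTop) :
    Tendsto (fun k => kernelConst (ζ k)) atTop (𝓝 0) := by
  have h1 : Tendsto (fun k => 1 / (2 * (ζ k).im)) atTop (𝓝 0) :=
    Tendsto.div_atTop tendsto_const_nhds (h.const_mul_atTop two_pos)
  have h2 := (Real.continuous_sqrt.tendsto 0).comp h1
  rwa [Real.sqrt_zero] at h2

/-- A Volterra operator has no nonzero eigenvalues, and accordingly `det (1 - K) = 1`: conjugation
with exponential weights makes its trace norm arbitrarily small. -/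
theorem exists_volterra {ζ : ℂ} (hζ : 0 < ζ.im) {a b : Fin n × ℝ → ℂ}
    (ha : MemLp a 2 (starMeasure n)) (hb : MemLp b 2 (starMeasure n)) {R : ℝ} (hR : 0 ≤ R)
    (ha0 : ∀ p, R ≤ p.2 → a p = 0) (hb0 : ∀ p, R ≤ p.2 → b p = 0) :
    ∃ K : StarL2 n →L[ℂ] StarL2 n, IsVolterra ζ a b K ∧
      Tendsto (compressedDet (-K)) atTop (𝓝 1) := by
  set s : ℕ → ℝ := fun k => ζ.im + 1 + k
  have h₁ : ∀ k : ℕ, (Complex.I * s k - ζ).im = k + 1 := fun k => by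
    simp [s]
    ring
  have h₂ : ∀ k : ℕ, (ζ + Complex.I * s k).im = k + (2 * ζ.im + 1) := fun k => by
    simp [s]
    ring
  have hex := fun k => exists_volterra_conj (s := s k) ha hb hR ha0 hb0
    (by rw [h₁]; positivity) (by rw [h₂]; positivity)
  choose M B N hMN hV hB using hex
  refine ⟨M 0 ∘L B 0 ∘L N 0, hV 0, ?_⟩
  have hK : ∀ k, -(M 0 ∘L B 0 ∘L N 0) = M k ∘L (-B k) ∘L N k := fun k => by
    rw [(hV 0).unique (hV k)]
    ext1 f
    simp
  have hlim : ∀ k, Tendsto (compressedDet (-(M 0 ∘L B 0 ∘L N 0))) atTop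
      (𝓝 ((hB k).neg.exists_tendsto).choose) := fun k => by
    rw [hK k]
    exact (hB k).neg.tendsto_compressedDet_conj (hMN k) (hB k).neg.exists_tendsto.choose_spec
  have hd : ∀ k, Tendsto (compressedDet (-B k)) atTop (𝓝 (hB 0).neg.exists_tendsto.choose) :=
    fun k => by
      rw [tendsto_nhds_unique (hlim 0) (hlim k)]
      exact (hB k).neg.exists_tendsto.choose_spec
  have h0 := tendsto_fredholmDet (l := atTop) (A := fun k => -B k) nuclearLE_zero
    (fun k => by
      rw [sub_zero]
      exact (hB k).neg) ?_ hd (by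
        have : compressedDet (0 : StarL2 n →L[ℂ] StarL2 n) = fun _ => 1 :=
          funext compressedDet_zero
        rw [this]
        exact tendsto_const_nhds)
  · have := tendsto_nhds_unique tendsto_const_nhds h0
    rw [← this]
    exact hlim 0
  · have t1 := tendsto_kernelConst (ζ := fun k => Complex.I * s k - ζ) (by
      simp only [h₁]
      exact tendsto_natCast_atTop_atTop.atTop_add tendsto_const_nhds)
    have t2 := tendsto_kernelConst (ζ := fun k => ζ + Complex.I * s k) (by
      simp only [h₂]
      exact tendsto_natCast_atTop_atTop.atTop_add tendsto_const_nhds)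
    simpa using (t1.mul_const (eLpNorm a 2 (starMeasure n)).toReal).mul
      (t2.mul_const (eLpNorm b 2 (starMeasure n)).toReal)

end Volterra

/-! ### The determinant for potentials of bounded support -/

section TruncatedDet

/-- `g` is the Jost function of the potential `V` at energy `ζ²`, divided by `e^{iζx}`: the bounded
continuous solution of `g(x) = 1 + ∫_x^∞ ∫_t^∞ e^{2iζ(y - t)} V(y) g(y) dy dt`. -/
structure IsJost (ζ : ℂ) (V g : ℝ → ℂ) : Prop where
  continuousOn : ContinuousOn g (Ici 0)
  bounded : ∃ C : ℝ, ∀ x, 0 ≤ x → ‖g x‖ ≤ C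
  eq : ∀ x, 0 ≤ x → g x = 1 + anticausal 0 (anticausal (2 * ζ) fun y => V y * g y) x

variable {n : ℕ}

/-- For compactly supported `a`, `b` the operator `a R₀(ζ²) b` is minus a Volterra operator plus an
operator of rank `n`, one dimension for each edge. -/
theorem tendsto_compressedDet_of_truncated {ζ : ℂ} (hζ : 0 < ζ.im) {a b : Fin n × ℝ → ℂ}
    (ha : MemLp a 2 (starMeasure n)) (hb : MemLp b 2 (starMeasure n)) {R : ℝ} (hR : 0 ≤ R)
    (ha0 : ∀ p, R ≤ p.2 → a p = 0) (hb0 : ∀ p, R ≤ p.2 → b p = 0)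
    {A : StarL2 n →L[ℂ] StarL2 n} (hA : IsWeightedResolvent ζ a b A) {V g : Fin n → ℝ → ℂ}
    (hV : ∀ p : Fin n × ℝ, a p * b p = V p.1 p.2) (hg : ∀ j, IsJost ζ (V j) (g j)) :
    Tendsto (compressedDet A) atTop (𝓝 (∏ j, g j 0 + Complex.I / (n * ζ) *
      ∑ j, anticausal (2 * ζ) (fun y => V j y * g j y) 0 *
        ∏ k ∈ Finset.univ.erase j, g k 0)) := by
  obtain ⟨K, hK, hdet⟩ := exists_volterra hζ ha hb hR ha0 hb0
  have hint : ∀ (f : StarL2 n) (i : Fin n), IntegrableOn (fun y => b (i, y) * f (i, y)) (Ioi 0) :=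
    fun f i => integrableOn_edge (integrable_mul_of_memLp hb f) i
  have hz : ∀ (f : StarL2 n) (i : Fin n) (y : ℝ), R ≤ y → b (i, y) * f (i, y) = 0 :=
    fun f i y hy => by simp [hb0 (i, y) hy]
  have hexp : ∀ (f : StarL2 n) (i : Fin n), IntegrableOn (fun y : ℝ =>
      Complex.exp (Complex.I * ζ * y) * (b (i, y) * f (i, y))) (Ioi 0) := fun f i => by
    simpa using integrableOn_exp_mul_of_integrableOn hζ.le (hint f i) le_rfl
  have hadd : ∀ (f f' : StarL2 n) (i : Fin n) (x : ℝ), 0 ≤ x →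
      anticausal ζ (fun y => b (i, y) * (f + f') (i, y)) x =
        anticausal ζ (fun y => b (i, y) * f (i, y)) x +
          anticausal ζ (fun y => b (i, y) * f' (i, y)) x := fun f f' i x hx => by
    rw [← anticausal_add (hexp f i) (hexp f' i) hx]
    refine anticausal_congr ?_ hx
    filter_upwards [ae_star_iff.1 (Lp.coeFn_add f f') i] with y hy
    rw [hy, Pi.add_apply, mul_add]
  have hsmul : ∀ (c : ℂ) (f : StarL2 n) (i : Fin n) (x : ℝ), 0 ≤ x →
      anticausal ζ (fun y => b (i, y) * (c • f) (i, y)) x =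
        c * anticausal ζ (fun y => b (i, y) * f (i, y)) x := fun c f i x hx => by
    rw [← anticausal_const_mul]
    refine anticausal_congr ?_ hx
    filter_upwards [ae_star_iff.1 (Lp.coeFn_smul c f) i] with y hy
    rw [hy, Pi.smul_apply, smul_eq_mul]
    ring
  set ℓ : Fin n → StarL2 n →ₗ[ℂ] ℂ := fun i =>
    { toFun := fun f => anticausal (-ζ) (anticausal ζ fun y => b (i, y) * f (i, y)) 0 +
        Complex.I / (n * ζ) * starPairing ζ fun q => b q * f q
      map_add' := fun f f' => by
        have e1 : anticausal (-ζ) (anticausal ζ fun y => b (i, y) * (f + f') (i, y)) 0 =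
            anticausal (-ζ) (anticausal ζ fun y => b (i, y) * f (i, y)) 0 +
              anticausal (-ζ) (anticausal ζ fun y => b (i, y) * f' (i, y)) 0 := by
          rw [← anticausal_add (integrableOn_exp_mul_anticausal hζ.le (hint f i) hR (hz f i) (-ζ))
            (integrableOn_exp_mul_anticausal hζ.le (hint f' i) hR (hz f' i) (-ζ)) le_rfl]
          exact anticausal_congr_of_nonneg (hadd f f' i) le_rfl
        simp only [starPairing, hadd f f' _ 0 le_rfl, Finset.sum_add_distrib]
        rw [e1]
        ring
      map_smul' := fun c f => by
        have e1 : anticausal (-ζ) (anticausal ζ fun y => b (i, y) * (c • f) (i, y)) 0 =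
            c * anticausal (-ζ) (anticausal ζ fun y => b (i, y) * f (i, y)) 0 := by
          rw [← anticausal_const_mul]
          exact anticausal_congr_of_nonneg (hsmul c f i) le_rfl
        simp only [starPairing, hsmul c f _ 0 le_rfl, ← Finset.mul_sum]
        rw [e1]
        simp
        ring } with hℓ
  have hmem : ∀ j, MemLp (fun p : Fin n × ℝ => if p.1 = j then a p * (starExp ζ p * g j p.2) else 0)
      2 (starMeasure n) := fun j => by
    obtain ⟨C, hC⟩ := (hg j).bounded
    refine ha.of_le_mul (c := C) ?_ ?_
    · refine aestronglyMeasurable_star_iff.2 fun i => ?_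
      by_cases hij : i = j
      · simp only [hij, if_true]
        exact (aestronglyMeasurable_star_iff.1 ha.1 j).mul
          ((continuous_cexp_I_mul ζ).aestronglyMeasurable.mul
            (((hg j).continuousOn.mono Ioi_subset_Ici_self).aestronglyMeasurable
              measurableSet_Ioi))
      · simp only [hij, if_false]
        exact aestronglyMeasurable_const
    · filter_upwards [ae_star_nonneg] with p hp
      have hC0 : 0 ≤ C := (norm_nonneg _).trans (hC p.2 hp)
      split_ifs
      · rw [norm_mul, norm_mul, mul_comm]
        refine mul_le_mul_of_nonneg_right ?_ (norm_nonneg _)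
        calc ‖starExp ζ p‖ * ‖g j p.2‖ ≤ 1 * C := mul_le_mul
              (norm_cexp_I_mul_le_one hζ.le hp) (hC p.2 hp) (norm_nonneg _) zero_le_one
          _ = C := one_mul C
      · rw [norm_zero]
        positivity
  set φ : Fin n → StarL2 n := fun j => (hmem j).toLp with hφ
  set w : Fin n → ℝ → ℂ := fun j => anticausal (2 * ζ) fun y => V j y * g j y with hw
  have hin : ∀ i j (t : ℝ), 0 ≤ t → anticausal ζ (fun y => b (i, y) * φ j (i, y)) t =
      if i = j then Complex.exp (Complex.I * ζ * t) * w j t else 0 := fun i j t ht => by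
    have h1 : (fun y => b (i, y) * φ j (i, y)) =ᵐ[volume.restrict (Ioi 0)] fun y =>
        if i = j then Complex.exp (Complex.I * ζ * y) * (V j y * g j y) else 0 := by
      filter_upwards [ae_star_iff.1 (hmem j).coeFn_toLp i] with y hy
      rw [hφ, hy]
      split_ifs with hij
      · subst hij
        rw [← hV (i, y), starExp]
        ring
      · simp
    rw [anticausal_congr h1 ht]
    split_ifs
    · rw [anticausal_exp_mul, hw, two_mul]
    · simp [anticausal]
  have hout : ∀ i j (x : ℝ), 0 ≤ x →
      anticausal (-ζ) (anticausal ζ fun y => b (i, y) * φ j (i, y)) x =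
        if i = j then Complex.exp (Complex.I * ζ * x) * (g j x - 1) else 0 := fun i j x hx => by
    rw [anticausal_congr_of_nonneg (hin i j) hx]
    split_ifs
    · rw [anticausal_exp_mul, (hg j).eq x hx, neg_add_cancel, add_sub_cancel_left]
    · simp [anticausal]
  have hpair : ∀ j, starPairing ζ (fun q => b q * φ j q) = w j 0 := fun j => by
    rw [starPairing]
    simp only [hin _ j 0 le_rfl]
    simp
  have key := tendsto_compressedDet_finiteRank_update (A := A) ℓ φ (fun f => ?_) hdet
  · rw [one_mul] at key
    have e : (1 : Matrix (Fin n) (Fin n) ℂ) + Matrix.of (fun i j => ℓ i (φ j)) =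
        Matrix.of fun i j => (if i = j then g j 0 else 0) + Complex.I / (n * ζ) * w j 0 := by
      ext i j
      simp only [Matrix.add_apply, Matrix.of_apply, Matrix.one_apply, hℓ, LinearMap.coe_mk,
        AddHom.coe_mk]
      rw [hpair, hout i j 0 le_rfl]
      split_ifs <;> simp
      ring
    rwa [e, det_diagonal_add_rankOne] at key
  · -- `(1 - K) φ i` is `a e^{iζx}` on the edge `i`
    have hφK : ∀ i, φ i + (-K) (φ i) =ᵐ[starMeasure n] fun p =>
        if p.1 = i then a p * starExp ζ p else 0 := fun i => by
      have e1 : φ i + (-K) (φ i) = φ i - K (φ i) := by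
        rw [sub_eq_add_neg]
        rfl
      rw [e1]
      filter_upwards [Lp.coeFn_sub (φ i) (K (φ i)), hK (φ i), (hmem i).coeFn_toLp,
        ae_star_nonneg] with p h1 h2 h3 h4
      rw [h1, Pi.sub_apply, h2, hout _ _ _ h4, hφ, h3]
      split_ifs
      · rw [starExp]
        ring
      · simp
    ext1
    have e2 : (-K) f + ∑ i, ℓ i f • (φ i + (-K) (φ i)) =
        ∑ i, ℓ i f • (φ i + (-K) (φ i)) - K f := by
      rw [sub_eq_add_neg, add_comm]
      rfl
    rw [e2]
    have h5 : ∀ᵐ p ∂starMeasure n, ∀ i, (ℓ i f • (φ i + (-K) (φ i)) : StarL2 n) p =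
        ℓ i f * if p.1 = i then a p * starExp ζ p else 0 := by
      refine ae_all_iff.2 fun i => ?_
      filter_upwards [Lp.coeFn_smul (ℓ i f) (φ i + (-K) (φ i)), hφK i] with p h1 h2
      rw [h1, Pi.smul_apply, h2, smul_eq_mul]
    filter_upwards [hA f, Lp.coeFn_sub (∑ i, ℓ i f • (φ i + (-K) (φ i))) (K f), hK f,
      Lp.coeFn_finsetSum Finset.univ fun i => ℓ i f • (φ i + (-K) (φ i)), h5,
      ae_star_nonneg] with p h1 h2 h3 h4 h5 h6
    rw [h1, h2, Pi.sub_apply, h3, h4, Finset.sum_apply]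
    simp only [h5]
    simp only [mul_ite, mul_zero, Finset.sum_ite_eq, Finset.mem_univ, if_true]
    rw [resolventFun, causal_eq_anticausal
      (integrableOn_exp_mul_anticausal hζ.le (hint f p.1) hR (hz f p.1) (-ζ)) h6, hℓ]
    simp only [LinearMap.coe_mk, AddHom.coe_mk, starExp]
    ring

end TruncatedDet

/-! ### Majorants of the potential -/

section Majorant

/-- A nonnegative function with finite zeroth and first moments on the half-line. -/
structure IsMajorant (W : ℝ → ℝ) : Prop where
  nonneg : ∀ y, 0 ≤ W y
  integrable : Integrable W
  integrableOn_mul : IntegrableOn (fun y => y * W y) (Ioi 0)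

/-- `∫_t^∞ W`. -/
def tail (W : ℝ → ℝ) (t : ℝ) : ℝ := ∫ y in Ioi t, W y

/-- `∫_x^∞ ∫_t^∞ W(y) dy dt` for `x ≥ 0`. -/
def tailTail (W : ℝ → ℝ) (x : ℝ) : ℝ := (∫ t in Ioi (0 : ℝ), tail W t) - ∫ t in (0 : ℝ)..x, tail W t

variable {W : ℝ → ℝ}

theorem IsMajorant.tail_nonneg (hW : IsMajorant W) (t : ℝ) : 0 ≤ tail W t :=
  integral_nonneg hW.nonneg

theorem IsMajorant.tail_eq (hW : IsMajorant W) (t : ℝ) :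
    tail W t = tail W 0 - ∫ y in (0 : ℝ)..t, W y := by
  have := intervalIntegral.integral_interval_add_Ioi (a := 0) (b := t)
    hW.integrable.integrableOn hW.integrable.integrableOn
  rw [tail, tail, ← this]
  ring

theorem IsMajorant.continuous_tail (hW : IsMajorant W) : Continuous (tail W) := by
  have : tail W = fun t => tail W 0 - ∫ y in (0 : ℝ)..t, W y := funext hW.tail_eq
  rw [this]
  exact continuous_const.sub
    (intervalIntegral.continuous_primitive (fun a b => hW.integrable.intervalIntegrable) 0)

theorem IsMajorant.tendsto_tail (hW : IsMajorant W) : Tendsto (tail W) atTop (𝓝 0) := by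
  have : tail W = fun t => tail W 0 - ∫ y in (0 : ℝ)..t, W y := funext hW.tail_eq
  rw [this]
  have := (tendsto_const_nhds (x := tail W 0)).sub (intervalIntegral_tendsto_integral_Ioi 0
    hW.integrable.integrableOn tendsto_id)
  simpa [tail] using this

/-- By Tonelli's theorem, `∫_0^∞ ∫_t^∞ W(y) dy dt = ∫_0^∞ y W(y) dy`. -/
theorem IsMajorant.integrableOn_tail (hW : IsMajorant W) : IntegrableOn (tail W) (Ioi 0) := by
  have hm : AEStronglyMeasurable (fun p : ℝ × ℝ => {q : ℝ × ℝ | q.1 < q.2}.indicator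
      (fun q => W q.2) p) ((volume.restrict (Ioi 0)).prod volume) :=
    (hW.integrable.1.comp_snd).indicator (measurableSet_lt measurable_fst measurable_snd)
  have h1 : Integrable (fun p : ℝ × ℝ => {q : ℝ × ℝ | q.1 < q.2}.indicator (fun q => W q.2) p)
      ((volume.restrict (Ioi 0)).prod volume) := by
    have hval : ∀ y : ℝ, (fun x : ℝ => {q : ℝ × ℝ | q.1 < q.2}.indicator (fun q => W q.2) (x, y)) =
        (Iio y).indicator fun _ => W y := fun y => by
      funext x
      simp [indicator]
    refine (integrable_prod_iff' hm).2 ⟨Eventually.of_forall fun y => ?_, ?_⟩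
    · rw [hval, integrable_indicator_iff measurableSet_Iio, integrableOn_const_iff]
      right
      rw [Measure.restrict_apply measurableSet_Iio, Iio_inter_Ioi]
      simp
    · have h2 : (fun y => ∫ x in Ioi (0 : ℝ),
          ‖{q : ℝ × ℝ | q.1 < q.2}.indicator (fun q => W q.2) (x, y)‖) =
          (Ioi 0).indicator fun y => y * W y := by
        funext y
        have h3 : (fun x : ℝ => ‖{q : ℝ × ℝ | q.1 < q.2}.indicator (fun q => W q.2) (x, y)‖) =
            (Iio y).indicator fun _ => W y := by
          funext x
          rw [congrFun (hval y) x]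
          by_cases h : x < y <;> simp [indicator, h, hW.nonneg y]
        rw [h3, integral_indicator measurableSet_Iio, Measure.restrict_restrict measurableSet_Iio,
          Iio_inter_Ioi, setIntegral_const]
        by_cases h : 0 < y
        · simp [h, h.le]
        · simp [h]
      rw [h2, integrable_indicator_iff measurableSet_Ioi]
      exact hW.integrableOn_mul
  refine h1.integral_prod_left.congr (Eventually.of_forall fun t => ?_)
  dsimp only
  rw [tail, ← integral_indicator measurableSet_Ioi]
  congr 1

theorem IsMajorant.hasDerivAt_tailTail (hW : IsMajorant W) (x : ℝ) :
    HasDerivAt (tailTail W) (-tail W x) x :=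
  (hW.continuous_tail.integral_hasStrictDerivAt 0 x).hasDerivAt.const_sub _

theorem IsMajorant.tendsto_tailTail (hW : IsMajorant W) : Tendsto (tailTail W) atTop (𝓝 0) := by
  have := (tendsto_const_nhds (x := ∫ t in Ioi (0 : ℝ), tail W t)).sub
    (intervalIntegral_tendsto_integral_Ioi 0 hW.integrableOn_tail tendsto_id)
  rw [sub_self] at this
  exact this

theorem IsMajorant.antitone_tailTail (hW : IsMajorant W) : Antitone (tailTail W) := by
  refine antitone_of_deriv_nonpos (fun x => (hW.hasDerivAt_tailTail x).differentiableAt) fun x => ?_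
  rw [(hW.hasDerivAt_tailTail x).deriv]
  exact neg_nonpos.2 (hW.tail_nonneg x)

/-- The weight in which the integral operator of the Jost equation is a contraction. -/
def jostWeight (W : ℝ → ℝ) (x : ℝ) : ℝ := Real.exp (2 * tailTail W x)

theorem jostWeight_pos (W : ℝ → ℝ) (x : ℝ) : 0 < jostWeight W x := Real.exp_pos _

theorem IsMajorant.one_le_jostWeight (hW : IsMajorant W) (x : ℝ) : 1 ≤ jostWeight W x :=
  Real.one_le_exp (mul_nonneg two_pos.le (hW.antitone_tailTail.le_of_tendsto hW.tendsto_tailTail x))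

theorem IsMajorant.antitone_jostWeight (hW : IsMajorant W) : Antitone (jostWeight W) :=
  fun _ _ h => Real.exp_le_exp.2 (mul_le_mul_of_nonneg_left (hW.antitone_tailTail h) two_pos.le)

theorem IsMajorant.integral_jostWeight_mul_tail (hW : IsMajorant W) (x : ℝ) :
    IntegrableOn (fun t => jostWeight W t * tail W t) (Ioi x) ∧
      ∫ t in Ioi x, jostWeight W t * tail W t ≤ jostWeight W x / 2 := by
  have hd : ∀ t ∈ Ici x, HasDerivAt (fun t => -jostWeight W t / 2) (jostWeight W t * tail W t) t :=
    fun t _ => by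
      have := (((hW.hasDerivAt_tailTail t).const_mul 2).exp.neg.div_const 2)
      convert! this using 1
      rw [jostWeight]
      ring
  have h0 : ∀ t ∈ Ioi x, 0 ≤ jostWeight W t * tail W t := fun t _ =>
    mul_nonneg (jostWeight_pos W t).le (hW.tail_nonneg t)
  have hl : Tendsto (fun t => -jostWeight W t / 2) atTop (𝓝 (-1 / 2)) := by
    have := (Real.continuous_exp.tendsto _).comp (hW.tendsto_tailTail.const_mul 2)
    rw [mul_zero, Real.exp_zero] at this
    exact this.neg.div_const 2
  refine ⟨integrableOn_Ioi_deriv_of_nonneg' hd h0 hl, ?_⟩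
  rw [integral_Ioi_of_hasDerivAt_of_nonneg' hd h0 hl]
  linarith

end Majorant

/-! ### The integral operator of the Jost equation -/

section JostOperator

variable {W : ℝ → ℝ} {V : ℝ → ℂ}

/-- `V` is a measurable potential on the half-line with `|V| ≤ W`. -/
structure IsDominated (W : ℝ → ℝ) (V : ℝ → ℂ) : Prop where
  aestronglyMeasurable : AEStronglyMeasurable V (volume.restrict (Ioi 0))
  le : ∀ y, 0 < y → ‖V y‖ ≤ W y

theorem IsDominated.integrableOn_mul (hV : IsDominated W V) (hW : IsMajorant W) {φ : ℝ → ℂ}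
    (hφ : ContinuousOn φ (Ici 0)) {C : ℝ} (hC : ∀ x, 0 ≤ x → ‖φ x‖ ≤ C) :
    IntegrableOn (fun y => V y * φ y) (Ioi 0) := by
  refine (hW.integrable.integrableOn.mul_const C).mono' (hV.aestronglyMeasurable.mul
    ((hφ.mono Ioi_subset_Ici_self).aestronglyMeasurable measurableSet_Ioi)) ?_
  filter_upwards [ae_restrict_mem measurableSet_Ioi] with y hy
  rw [norm_mul]
  exact mul_le_mul (hV.le y hy) (hC y (le_of_lt hy)) (norm_nonneg _) (hW.nonneg y)

theorem norm_exp_mul_le {ζ : ℂ} (hζ : 0 ≤ ζ.im) {x y : ℝ} (h : x ≤ y) (z : ℂ) :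
    ‖Complex.exp (Complex.I * ζ * ((y - x : ℝ) : ℂ)) * z‖ ≤ ‖z‖ := by
  rw [norm_mul]
  exact mul_le_of_le_one_left (norm_nonneg _) (norm_cexp_I_mul_le_one hζ (by linarith))

theorem norm_anticausal_mul_le (hV : IsDominated W V) (hW : IsMajorant W) {ζ : ℂ} (hζ : 0 ≤ ζ.im)
    {φ : ℝ → ℂ} {C : ℝ} (hC : 0 ≤ C) (hφ : ∀ y, 0 ≤ y → ‖φ y‖ ≤ C * jostWeight W y) {t : ℝ}
    (ht : 0 ≤ t) :
    ‖anticausal ζ (fun y => V y * φ y) t‖ ≤ C * (jostWeight W t * tail W t) := by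
  have e : C * (jostWeight W t * tail W t) = ∫ y in Ioi t, W y * (C * jostWeight W t) := by
    rw [integral_mul_const, tail]
    ring
  rw [e, anticausal]
  refine norm_integral_le_of_norm_le (hW.integrable.integrableOn.mul_const _) ?_
  filter_upwards [ae_restrict_mem measurableSet_Ioi] with y hy
  have hy' : t < y := hy
  refine (norm_exp_mul_le hζ hy'.le _).trans ?_
  rw [norm_mul]
  refine mul_le_mul (hV.le y (by linarith)) ((hφ y (by linarith)).trans ?_) (norm_nonneg _)
    (hW.nonneg y)
  exact mul_le_mul_of_nonneg_left (hW.antitone_jostWeight hy'.le) hC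

/-- In the weighted supremum norm the integral operator of the Jost equation has norm at most `1/2`. -/
theorem norm_anticausal_anticausal_le (hV : IsDominated W V) (hW : IsMajorant W) {ζ : ℂ}
    (hζ : 0 ≤ ζ.im) {φ : ℝ → ℂ} {C : ℝ} (hC : 0 ≤ C)
    (hφ : ∀ y, 0 ≤ y → ‖φ y‖ ≤ C * jostWeight W y) {x : ℝ} (hx : 0 ≤ x) :
    ‖anticausal 0 (anticausal ζ fun y => V y * φ y) x‖ ≤ C / 2 * jostWeight W x := by
  obtain ⟨h1, h2⟩ := hW.integral_jostWeight_mul_tail x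
  have h3 : ‖anticausal 0 (anticausal ζ fun y => V y * φ y) x‖ ≤
      ∫ t in Ioi x, C * (jostWeight W t * tail W t) := by
    refine norm_integral_le_of_norm_le (h1.const_mul C) ?_
    filter_upwards [ae_restrict_mem measurableSet_Ioi] with t ht
    have ht' : x < t := ht
    exact (norm_exp_mul_le (by simp) ht'.le _).trans
      (norm_anticausal_mul_le hV hW hζ hC hφ (by linarith))
  rw [integral_const_mul] at h3
  refine h3.trans ?_
  calc C * ∫ t in Ioi x, jostWeight W t * tail W t ≤ C * (jostWeight W x / 2) :=
        mul_le_mul_of_nonneg_left h2 hC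
    _ = C / 2 * jostWeight W x := by ring

/-- The homogeneous Jost equation has no nonzero bounded solution. -/
theorem eq_zero_of_eq_anticausal (hV : IsDominated W V) (hW : IsMajorant W) {ζ : ℂ}
    (hζ : 0 ≤ ζ.im) {φ : ℝ → ℂ} {C : ℝ} (hC : ∀ x, 0 ≤ x → ‖φ x‖ ≤ C)
    (h : ∀ x, 0 ≤ x → φ x = anticausal 0 (anticausal ζ fun y => V y * φ y) x) {x : ℝ}
    (hx : 0 ≤ x) : φ x = 0 := by
  have hC0 : 0 ≤ C := (norm_nonneg _).trans (hC 0 le_rfl)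
  have hk : ∀ k : ℕ, ∀ y, 0 ≤ y → ‖φ y‖ ≤ C * (1 / 2) ^ k * jostWeight W y := fun k => by
    induction k with
    | zero =>
      intro y hy
      rw [pow_zero, mul_one]
      exact (hC y hy).trans (le_mul_of_one_le_right hC0 (hW.one_le_jostWeight y))
    | succ k ih =>
      intro y hy
      rw [h y hy]
      refine (norm_anticausal_anticausal_le hV hW hζ (by positivity) ih hy).trans (le_of_eq ?_)
      ring
  have hl : Tendsto (fun k : ℕ => C * (1 / 2) ^ k * jostWeight W x) atTop
      (𝓝 (C * 0 * jostWeight W x)) :=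
    ((tendsto_pow_atTop_nhds_zero_of_lt_one (by norm_num) (by norm_num)).const_mul C).mul_const _
  have := ge_of_tendsto' hl fun k => hk k x hx
  rw [mul_zero, zero_mul] at this
  exact norm_le_zero_iff.1 this

theorem IsPrimitive.continuousOn_Ici {F f : ℝ → ℂ} (h : IsPrimitive F f) :
    ContinuousOn F (Ici 0) := fun x hx => by
  have hx' : 0 ≤ x := hx
  have h1 := (h.continuousOn (x := x + 1) (by linarith)) x ⟨hx', by linarith⟩
  refine h1.mono_of_mem_nhdsWithin ?_
  filter_upwards [self_mem_nhdsWithin, mem_nhdsWithin_of_mem_nhds (Iio_mem_nhds (lt_add_one x))]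
    with y h2 h3
  exact ⟨h2, le_of_lt h3⟩

theorem isPrimitive_anticausal_mul (hV : IsDominated W V) (hW : IsMajorant W) {ζ : ℂ}
    (hζ : 0 ≤ ζ.im) {φ : ℝ → ℂ} (hφ : ContinuousOn φ (Ici 0)) {C : ℝ}
    (hC : ∀ x, 0 ≤ x → ‖φ x‖ ≤ C) :
    IsPrimitive (anticausal ζ fun y => V y * φ y)
      (fun x => -(Complex.I * ζ * anticausal ζ (fun y => V y * φ y) x) - V x * φ x) :=
  isPrimitive_anticausal_of_integrableOn hζ (hV.integrableOn_mul hW hφ hC)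

theorem norm_anticausal_mul_le_tail (hV : IsDominated W V) (hW : IsMajorant W) {ζ : ℂ}
    (hζ : 0 ≤ ζ.im) {φ : ℝ → ℂ} {C : ℝ} (hC : ∀ x, 0 ≤ x → ‖φ x‖ ≤ C) {t : ℝ} (ht : 0 ≤ t) :
    ‖anticausal ζ (fun y => V y * φ y) t‖ ≤ C * jostWeight W 0 * tail W t := by
  have hC0 : 0 ≤ C := (norm_nonneg _).trans (hC 0 le_rfl)
  refine (norm_anticausal_mul_le hV hW hζ hC0 (fun y hy => (hC y hy).trans
    (le_mul_of_one_le_right hC0 (hW.one_le_jostWeight y))) ht).trans ?_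
  rw [mul_assoc]
  exact mul_le_mul_of_nonneg_left (mul_le_mul_of_nonneg_right (hW.antitone_jostWeight ht)
    (hW.tail_nonneg t)) hC0

theorem integrableOn_anticausal_mul (hV : IsDominated W V) (hW : IsMajorant W) {ζ : ℂ}
    (hζ : 0 ≤ ζ.im) {φ : ℝ → ℂ} (hφ : ContinuousOn φ (Ici 0)) {C : ℝ}
    (hC : ∀ x, 0 ≤ x → ‖φ x‖ ≤ C) :
    IntegrableOn (anticausal ζ fun y => V y * φ y) (Ioi 0) := by
  refine (hW.integrableOn_tail.const_mul (C * jostWeight W 0)).mono' ?_ ?_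
  · exact ((isPrimitive_anticausal_mul hV hW hζ hφ hC).continuousOn_Ici.mono
      Ioi_subset_Ici_self).aestronglyMeasurable measurableSet_Ioi
  · filter_upwards [ae_restrict_mem measurableSet_Ioi] with t ht
    exact norm_anticausal_mul_le_tail hV hW hζ hC (le_of_lt ht)

theorem isPrimitive_anticausal_anticausal (hV : IsDominated W V) (hW : IsMajorant W) {ζ : ℂ}
    (hζ : 0 ≤ ζ.im) {φ : ℝ → ℂ} (hφ : ContinuousOn φ (Ici 0)) {C : ℝ}
    (hC : ∀ x, 0 ≤ x → ‖φ x‖ ≤ C) :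
    IsPrimitive (anticausal 0 (anticausal ζ fun y => V y * φ y))
      (fun x => -anticausal ζ (fun y => V y * φ y) x) := by
  have := isPrimitive_anticausal_of_integrableOn (ζ := 0) (by simp)
    (integrableOn_anticausal_mul hV hW hζ hφ hC)
  simpa using this

theorem tendsto_anticausal {ι : Type*} {l : Filter ι} [l.IsCountablyGenerated] {ζ : ι → ℂ} {ζ₀ : ℂ}
    (hζ : ∀ᶠ i in l, 0 ≤ (ζ i).im) (hl : Tendsto ζ l (𝓝 ζ₀)) {h : ι → ℝ → ℂ} {h₀ : ℝ → ℂ}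
    {B : ℝ → ℝ} (hB : IntegrableOn B (Ioi 0))
    (hm : ∀ᶠ i in l, AEStronglyMeasurable (h i) (volume.restrict (Ioi 0)))
    (hb : ∀ᶠ i in l, ∀ y, 0 < y → ‖h i y‖ ≤ B y)
    (ht : ∀ y, 0 < y → Tendsto (fun i => h i y) l (𝓝 (h₀ y))) {x : ℝ} (hx : 0 ≤ x) :
    Tendsto (fun i => anticausal (ζ i) (h i) x) l (𝓝 (anticausal ζ₀ h₀ x)) := by
  refine tendsto_integral_filter_of_dominated_convergence B ?_ ?_
    (hB.mono_set (Ioi_subset_Ioi hx)) ?_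
  · filter_upwards [hm] with i hi
    exact AEStronglyMeasurable.mul (by fun_prop)
      (hi.mono_measure (Measure.restrict_mono (Ioi_subset_Ioi hx) le_rfl))
  · filter_upwards [hζ, hb] with i h1 h2
    filter_upwards [ae_restrict_mem measurableSet_Ioi] with y hy
    have hy' : x < y := hy
    exact (norm_exp_mul_le h1 hy'.le _).trans (h2 y (by linarith))
  · filter_upwards [ae_restrict_mem measurableSet_Ioi] with y hy
    have hy' : x < y := hy
    refine Tendsto.mul ?_ (ht y (by linarith))
    exact (Complex.continuous_exp.tendsto _).comp ((hl.const_mul _).mul_const _)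

theorem hasSum_anticausal {ζ : ℂ} (hζ : 0 ≤ ζ.im) {h : ℕ → ℝ → ℂ} {h₀ : ℝ → ℂ} {B : ℝ → ℝ}
    (hB : IntegrableOn B (Ioi 0))
    (hm : ∀ m, AEStronglyMeasurable (h m) (volume.restrict (Ioi 0)))
    (hb : ∀ m y, 0 < y → ‖h m y‖ ≤ (1 / 2) ^ m * B y)
    (hs : ∀ y, 0 < y → HasSum (fun m => h m y) (h₀ y)) {x : ℝ} (hx : 0 ≤ x) :
    HasSum (fun m => anticausal ζ (h m) x) (anticausal ζ h₀ x) := by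
  refine hasSum_integral_of_dominated_convergence (fun m y => (1 / 2) ^ m * B y) (fun m => ?_)
    (fun m => ?_) ?_ ?_ ?_
  · exact AEStronglyMeasurable.mul (by fun_prop)
      ((hm m).mono_measure (Measure.restrict_mono (Ioi_subset_Ioi hx) le_rfl))
  · filter_upwards [ae_restrict_mem measurableSet_Ioi] with y hy
    have hy' : x < y := hy
    exact (norm_exp_mul_le hζ hy'.le _).trans (hb m y (by linarith))
  · exact Eventually.of_forall fun y => (summable_geometric_of_lt_one (by norm_num)
      (by norm_num)).mul_right _
  · simp only [tsum_mul_right]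
    exact (hB.mono_set (Ioi_subset_Ioi hx)).const_mul _
  · filter_upwards [ae_restrict_mem measurableSet_Ioi] with y hy
    have hy' : x < y := hy
    exact (hs y (by linarith)).mul_left _

end JostOperator

/-! ### Jost functions -/

section Jost

variable {W : ℝ → ℝ} {V : ℝ → ℂ}

/-- The terms of the Neumann series of the Jost equation. -/
def jostTerm (ζ : ℂ) (V : ℝ → ℂ) : ℕ → ℝ → ℂ
  | 0 => fun _ => 1
  | m + 1 => anticausal 0 (anticausal (2 * ζ) fun y => V y * jostTerm ζ V m y)

/-- The solution of the Jost equation. -/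
def jost (ζ : ℂ) (V : ℝ → ℂ) (x : ℝ) : ℂ := ∑' m, jostTerm ζ V m x

/-- Minus the derivative of `jost`. -/
def jostSlope (ζ : ℂ) (V : ℝ → ℂ) : ℝ → ℂ := anticausal (2 * ζ) fun y => V y * jost ζ V y

theorem two_mul_im_nonneg {ζ : ℂ} (hζ : 0 ≤ ζ.im) : 0 ≤ (2 * ζ).im := by
  simpa using hζ

theorem norm_jostTerm_le_jostWeight (hV : IsDominated W V) (hW : IsMajorant W) {ζ : ℂ} (hζ : 0 ≤ ζ.im)
    (m : ℕ) : ∀ x, 0 ≤ x → ‖jostTerm ζ V m x‖ ≤ (1 / 2) ^ m * jostWeight W x := by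
  induction m with
  | zero =>
    intro x _
    simpa [jostTerm] using hW.one_le_jostWeight x
  | succ m ih =>
    intro x hx
    refine (norm_anticausal_anticausal_le hV hW (two_mul_im_nonneg hζ) (by positivity) ih hx).trans
      (le_of_eq ?_)
    ring

theorem norm_jostTerm_le (hV : IsDominated W V) (hW : IsMajorant W) {ζ : ℂ} (hζ : 0 ≤ ζ.im)
    (m : ℕ) (x : ℝ) (hx : 0 ≤ x) : ‖jostTerm ζ V m x‖ ≤ (1 / 2) ^ m * jostWeight W 0 :=
  (norm_jostTerm_le_jostWeight hV hW hζ m x hx).trans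
    (mul_le_mul_of_nonneg_left (hW.antitone_jostWeight hx) (by positivity))

theorem continuousOn_jostTerm (hV : IsDominated W V) (hW : IsMajorant W) {ζ : ℂ} (hζ : 0 ≤ ζ.im)
    (m : ℕ) : ContinuousOn (jostTerm ζ V m) (Ici 0) := by
  induction m with
  | zero => exact continuousOn_const
  | succ m ih =>
    exact (isPrimitive_anticausal_anticausal hV hW (two_mul_im_nonneg hζ) ih
      (norm_jostTerm_le hV hW hζ m)).continuousOn_Ici

theorem summable_jostWeight (W : ℝ → ℝ) : Summable fun m : ℕ => (1 / 2) ^ m * jostWeight W 0 :=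
  (summable_geometric_of_lt_one (by norm_num) (by norm_num)).mul_right _

theorem hasSum_jost (hV : IsDominated W V) (hW : IsMajorant W) {ζ : ℂ} (hζ : 0 ≤ ζ.im) {x : ℝ}
    (hx : 0 ≤ x) : HasSum (fun m => jostTerm ζ V m x) (jost ζ V x) :=
  (Summable.of_norm_bounded (summable_jostWeight W)
    fun m => norm_jostTerm_le hV hW hζ m x hx).hasSum

theorem norm_jost_le (hV : IsDominated W V) (hW : IsMajorant W) {ζ : ℂ} (hζ : 0 ≤ ζ.im) (x : ℝ)
    (hx : 0 ≤ x) : ‖jost ζ V x‖ ≤ 2 * jostWeight W 0 := by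
  have h1 : HasSum (fun m : ℕ => (1 / 2 : ℝ) ^ m * jostWeight W 0) (2 * jostWeight W 0) :=
    hasSum_geometric_two.mul_right _
  rw [← h1.tsum_eq]
  exact tsum_of_norm_bounded h1.summable.hasSum fun m => norm_jostTerm_le hV hW hζ m x hx

theorem continuousOn_jost (hV : IsDominated W V) (hW : IsMajorant W) {ζ : ℂ} (hζ : 0 ≤ ζ.im) :
    ContinuousOn (jost ζ V) (Ici 0) :=
  continuousOn_tsum (fun m => continuousOn_jostTerm hV hW hζ m) (summable_jostWeight W)
    fun m x hx => norm_jostTerm_le hV hW hζ m x hx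

theorem aestronglyMeasurable_of_continuousOn {φ : ℝ → ℂ} (hφ : ContinuousOn φ (Ici 0)) :
    AEStronglyMeasurable φ (volume.restrict (Ioi 0)) :=
  (hφ.mono Ioi_subset_Ici_self).aestronglyMeasurable measurableSet_Ioi

theorem isJost_jost (hV : IsDominated W V) (hW : IsMajorant W) {ζ : ℂ} (hζ : 0 ≤ ζ.im) :
    IsJost ζ V (jost ζ V) := by
  refine ⟨continuousOn_jost hV hW hζ, ⟨_, norm_jost_le hV hW hζ⟩, fun x hx => ?_⟩
  have h2 := two_mul_im_nonneg hζ
  have hs : ∀ t, 0 ≤ t → HasSum (fun m => anticausal (2 * ζ) (fun y => V y * jostTerm ζ V m y) t)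
      (anticausal (2 * ζ) (fun y => V y * jost ζ V y) t) := fun t ht => by
    refine hasSum_anticausal h2 (h := fun m y => V y * jostTerm ζ V m y)
      (B := fun y => W y * jostWeight W 0)
      (hW.integrable.integrableOn.mul_const _)
      (fun m => hV.aestronglyMeasurable.mul
        (aestronglyMeasurable_of_continuousOn (continuousOn_jostTerm hV hW hζ m)))
      (fun m y hy => ?_) (fun y hy => (hasSum_jost hV hW hζ hy.le).mul_left _) ht
    rw [norm_mul, mul_left_comm]
    exact mul_le_mul (hV.le y hy) (norm_jostTerm_le hV hW hζ m y hy.le) (norm_nonneg _)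
      (hW.nonneg y)
  have hT : HasSum (fun m => anticausal 0 (anticausal (2 * ζ) fun y => V y * jostTerm ζ V m y) x)
      (anticausal 0 (anticausal (2 * ζ) fun y => V y * jost ζ V y) x) := by
    refine hasSum_anticausal (by simp)
      (h := fun m => anticausal (2 * ζ) fun y => V y * jostTerm ζ V m y)
      (B := fun t => jostWeight W 0 * jostWeight W 0 * tail W t)
      (hW.integrableOn_tail.const_mul _) (fun m => aestronglyMeasurable_of_continuousOn
        (isPrimitive_anticausal_mul hV hW h2 (continuousOn_jostTerm hV hW hζ m)
          (norm_jostTerm_le hV hW hζ m)).continuousOn_Ici)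
      (fun m t ht => ?_) (fun t ht => hs t ht.le) hx
    refine (norm_anticausal_mul_le_tail hV hW h2 (norm_jostTerm_le hV hW hζ m) ht.le).trans
      (le_of_eq ?_)
    ring
  exact (hasSum_jost hV hW hζ hx).unique (HasSum.zero_add (f := fun m => jostTerm ζ V m x) hT)

/-- Bounded solutions of the inhomogeneous Jost equation are multiples of the Jost function. -/
theorem eq_const_mul_jost (hV : IsDominated W V) (hW : IsMajorant W) {ζ : ℂ} (hζ : 0 ≤ ζ.im)
    {u : ℝ → ℂ} (hu : ContinuousOn u (Ici 0)) {C : ℝ} (hC : ∀ x, 0 ≤ x → ‖u x‖ ≤ C) {c : ℂ}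
    (h : ∀ x, 0 ≤ x → u x = c + anticausal 0 (anticausal (2 * ζ) fun y => V y * u y) x) {x : ℝ}
    (hx : 0 ≤ x) : u x = c * jost ζ V x := by
  have h2 := two_mul_im_nonneg hζ
  set v : ℝ → ℂ := fun x => c * jost ζ V x with hv
  have hvc : ContinuousOn v (Ici 0) := continuousOn_const.mul (continuousOn_jost hV hW hζ)
  have hvC : ∀ x, 0 ≤ x → ‖v x‖ ≤ ‖c‖ * (2 * jostWeight W 0) := fun x hx => by
    rw [hv, norm_mul]
    exact mul_le_mul_of_nonneg_left (norm_jost_le hV hW hζ x hx) (norm_nonneg c)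
  have hve : ∀ x, 0 ≤ x → v x = c + anticausal 0 (anticausal (2 * ζ) fun y => V y * v y) x :=
    fun x hx => by
      have e1 : (fun y => V y * v y) = fun y => c * (V y * jost ζ V y) := by
        funext y
        rw [hv]
        ring
      have e2 : (anticausal (2 * ζ) fun y => V y * v y) =
          fun t => c * anticausal (2 * ζ) (fun y => V y * jost ζ V y) t := by
        rw [e1]
        exact funext fun t => anticausal_const_mul _ _ _ _
      rw [e2, anticausal_const_mul]
      change c * jost ζ V x = _
      rw [(isJost_jost hV hW hζ).eq x hx]
      ring
  have h0 := eq_zero_of_eq_anticausal hV hW h2 (φ := fun x => u x - v x)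
    (C := C + ‖c‖ * (2 * jostWeight W 0))
    (fun x hx => (norm_sub_le _ _).trans (add_le_add (hC x hx) (hvC x hx))) (fun x hx => ?_) hx
  · exact sub_eq_zero.1 h0
  · have e3 : ∀ t, 0 ≤ t → anticausal (2 * ζ) (fun y => V y * (u y - v y)) t =
        anticausal (2 * ζ) (fun y => V y * u y) t - anticausal (2 * ζ) (fun y => V y * v y) t :=
      fun t ht => by
        rw [← anticausal_sub h2 (hV.integrableOn_mul hW hu hC) (hV.integrableOn_mul hW hvc hvC) ht]
        simp only [mul_sub]
    rw [anticausal_congr_of_nonneg e3 hx, anticausal_sub (by simp)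
      (integrableOn_anticausal_mul hV hW h2 hu hC) (integrableOn_anticausal_mul hV hW h2 hvc hvC)
      hx, h x hx, hve x hx]
    ring

section Limit

variable {ι : Type*} {l : Filter ι} [l.IsCountablyGenerated] {ζ : ι → ℂ} {ζ₀ : ℂ}
  {Vs : ι → ℝ → ℂ}

theorem tendsto_jostTerm (hW : IsMajorant W) (hVs : ∀ i, IsDominated W (Vs i))
    (hζ : ∀ᶠ i in l, 0 ≤ (ζ i).im) (hl : Tendsto ζ l (𝓝 ζ₀))
    (ht : ∀ y, 0 < y → Tendsto (fun i => Vs i y) l (𝓝 (V y))) (m : ℕ) :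
    ∀ x, 0 ≤ x → Tendsto (fun i => jostTerm (ζ i) (Vs i) m x) l (𝓝 (jostTerm ζ₀ V m x)) := by
  have hζ2 : ∀ᶠ i in l, 0 ≤ (2 * ζ i).im := hζ.mono fun i hi => two_mul_im_nonneg hi
  induction m with
  | zero => exact fun x _ => tendsto_const_nhds
  | succ m ih =>
    intro x hx
    refine tendsto_anticausal (Eventually.of_forall fun i => by simp) tendsto_const_nhds
      (B := fun t => (1 / 2) ^ m * jostWeight W 0 * jostWeight W 0 * tail W t)
      (hW.integrableOn_tail.const_mul _) ?_ ?_ (fun t ht' => ?_) hx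
    · filter_upwards [hζ] with i hi
      exact aestronglyMeasurable_of_continuousOn (isPrimitive_anticausal_mul (hVs i) hW
        (two_mul_im_nonneg hi) (continuousOn_jostTerm (hVs i) hW hi m)
        (norm_jostTerm_le (hVs i) hW hi m)).continuousOn_Ici
    · filter_upwards [hζ] with i hi y hy
      exact norm_anticausal_mul_le_tail (hVs i) hW (two_mul_im_nonneg hi)
        (norm_jostTerm_le (hVs i) hW hi m) hy.le
    · refine tendsto_anticausal hζ2 (hl.const_mul 2)
        (B := fun y => W y * ((1 / 2) ^ m * jostWeight W 0))
        (hW.integrable.integrableOn.mul_const _) ?_ ?_ (fun y hy => (ht y hy).mul (ih y hy.le))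
        ht'.le
      · filter_upwards [hζ] with i hi
        exact (hVs i).aestronglyMeasurable.mul
          (aestronglyMeasurable_of_continuousOn (continuousOn_jostTerm (hVs i) hW hi m))
      · filter_upwards [hζ] with i hi y hy
        rw [norm_mul]
        exact mul_le_mul ((hVs i).le y hy) (norm_jostTerm_le (hVs i) hW hi m y hy.le)
          (norm_nonneg _) (hW.nonneg y)

/-- The Jost function depends continuously on the energy, down to the real axis, and on the
potential. -/
theorem tendsto_jost (hW : IsMajorant W) (hVs : ∀ i, IsDominated W (Vs i))
    (hζ : ∀ᶠ i in l, 0 ≤ (ζ i).im) (hl : Tendsto ζ l (𝓝 ζ₀))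
    (ht : ∀ y, 0 < y → Tendsto (fun i => Vs i y) l (𝓝 (V y))) {x : ℝ} (hx : 0 ≤ x) :
    Tendsto (fun i => jost (ζ i) (Vs i) x) l (𝓝 (jost ζ₀ V x)) := by
  refine tendsto_tsum_of_dominated_convergence (summable_jostWeight W)
    (fun m => tendsto_jostTerm hW hVs hζ hl ht m x hx) ?_
  filter_upwards [hζ] with i hi m
  exact norm_jostTerm_le (hVs i) hW hi m x hx

theorem tendsto_jostSlope (hW : IsMajorant W) (hVs : ∀ i, IsDominated W (Vs i))
    (hζ : ∀ᶠ i in l, 0 ≤ (ζ i).im) (hl : Tendsto ζ l (𝓝 ζ₀))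
    (ht : ∀ y, 0 < y → Tendsto (fun i => Vs i y) l (𝓝 (V y))) {x : ℝ} (hx : 0 ≤ x) :
    Tendsto (fun i => jostSlope (ζ i) (Vs i) x) l (𝓝 (jostSlope ζ₀ V x)) := by
  refine tendsto_anticausal (hζ.mono fun i hi => two_mul_im_nonneg hi) (hl.const_mul 2)
    (B := fun y => W y * (2 * jostWeight W 0)) (hW.integrable.integrableOn.mul_const _) ?_ ?_
    (fun y hy => (ht y hy).mul (tendsto_jost hW hVs hζ hl ht hy.le)) hx
  · filter_upwards [hζ] with i hi
    exact (hVs i).aestronglyMeasurable.mul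
      (aestronglyMeasurable_of_continuousOn (continuousOn_jost (hVs i) hW hi))
  · filter_upwards [hζ] with i hi y hy
    rw [norm_mul]
    exact mul_le_mul ((hVs i).le y hy) (norm_jost_le (hVs i) hW hi y hy.le)
      (norm_nonneg _) (hW.nonneg y)

end Limit

end Jost

/-! ### The Wronskian and the limit of zero energy -/

section Wronskian

variable {W : ℝ → ℝ} {V : ℝ → ℂ}

theorem isPrimitive_const (c : ℂ) : IsPrimitive (fun _ => c) fun _ => 0 :=
  isPrimitive_of_hasDerivAt (fun x => hasDerivAt_const x c) continuous_const

theorem jost_eq (hV : IsDominated W V) (hW : IsMajorant W) {ζ : ℂ} (hζ : 0 ≤ ζ.im) {x : ℝ}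
    (hx : 0 ≤ x) : jost ζ V x = 1 + anticausal 0 (jostSlope ζ V) x :=
  (isJost_jost hV hW hζ).eq x hx

theorem isPrimitive_jost (hV : IsDominated W V) (hW : IsMajorant W) {ζ : ℂ} (hζ : 0 ≤ ζ.im) :
    IsPrimitive (jost ζ V) fun x => -jostSlope ζ V x :=
  ((isPrimitive_const 1).add (isPrimitive_anticausal_anticausal hV hW (two_mul_im_nonneg hζ)
    (continuousOn_jost hV hW hζ) (norm_jost_le hV hW hζ))).congr
    (fun _ hx => jost_eq hV hW hζ hx) fun _ _ => (zero_add _).symm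

theorem isPrimitive_jostSlope (hV : IsDominated W V) (hW : IsMajorant W) {ζ : ℂ} (hζ : 0 ≤ ζ.im) :
    IsPrimitive (jostSlope ζ V)
      fun x => -(Complex.I * (2 * ζ) * jostSlope ζ V x) - V x * jost ζ V x :=
  isPrimitive_anticausal_mul hV hW (two_mul_im_nonneg hζ) (continuousOn_jost hV hW hζ)
    (norm_jost_le hV hW hζ)

theorem norm_jostSlope_le (hV : IsDominated W V) (hW : IsMajorant W) {ζ : ℂ} (hζ : 0 ≤ ζ.im)
    {x : ℝ} (hx : 0 ≤ x) :
    ‖jostSlope ζ V x‖ ≤ 2 * jostWeight W 0 * jostWeight W 0 * tail W x :=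
  norm_anticausal_mul_le_tail hV hW (two_mul_im_nonneg hζ) (norm_jost_le hV hW hζ) hx

theorem integrableOn_jostSlope (hV : IsDominated W V) (hW : IsMajorant W) {ζ : ℂ}
    (hζ : 0 ≤ ζ.im) : IntegrableOn (jostSlope ζ V) (Ioi 0) :=
  integrableOn_anticausal_mul hV hW (two_mul_im_nonneg hζ) (continuousOn_jost hV hW hζ)
    (norm_jost_le hV hW hζ)

theorem tendsto_jost_atTop (hV : IsDominated W V) (hW : IsMajorant W) {ζ : ℂ} (hζ : 0 ≤ ζ.im) :
    Tendsto (jost ζ V) atTop (𝓝 1) := by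
  have h1 := (isPrimitive_jost hV hW hζ).tendsto (integrableOn_jostSlope hV hW hζ).neg
  have h2 : anticausal 0 (jostSlope ζ V) 0 = ∫ t in Ioi (0 : ℝ), jostSlope ζ V t := by
    simp [anticausal]
  rw [jost_eq hV hW hζ le_rfl, h2, integral_neg, add_neg_cancel_right] at h1
  exact h1

theorem tendsto_jostSlope_atTop (hV : IsDominated W V) (hW : IsMajorant W) {ζ : ℂ}
    (hζ : 0 ≤ ζ.im) : Tendsto (jostSlope ζ V) atTop (𝓝 0) := by
  refine squeeze_zero_norm' (a := fun x => 2 * jostWeight W 0 * jostWeight W 0 * tail W x) ?_ ?_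
  · filter_upwards [eventually_ge_atTop 0] with x hx
    exact norm_jostSlope_le hV hW hζ hx
  · simpa using hW.tendsto_tail.const_mul (2 * jostWeight W 0 * jostWeight W 0)

theorem im_zero_nonneg : (0 : ℝ) ≤ (0 : ℂ).im := le_rfl

theorem aestronglyMeasurable_jost_mul_jostSlope (hV : IsDominated W V) (hW : IsMajorant W) {ζ : ℂ}
    (hζ : 0 ≤ ζ.im) : AEStronglyMeasurable (fun x => jost 0 V x * jostSlope ζ V x)
      (volume.restrict (Ioi 0)) :=
  (aestronglyMeasurable_of_continuousOn (continuousOn_jost hV hW im_zero_nonneg)).mul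
    (aestronglyMeasurable_of_continuousOn (isPrimitive_jostSlope hV hW hζ).continuousOn_Ici)

theorem norm_jost_mul_jostSlope_le (hV : IsDominated W V) (hW : IsMajorant W) {ζ : ℂ}
    (hζ : 0 ≤ ζ.im) {x : ℝ} (hx : 0 ≤ x) : ‖jost 0 V x * jostSlope ζ V x‖ ≤
      2 * jostWeight W 0 * (2 * jostWeight W 0 * jostWeight W 0 * tail W x) := by
  rw [norm_mul]
  exact mul_le_mul (norm_jost_le hV hW im_zero_nonneg x hx) (norm_jostSlope_le hV hW hζ hx)
    (norm_nonneg _) (mul_nonneg two_pos.le (jostWeight_pos W 0).le)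

theorem integrableOn_jost_mul_jostSlope (hV : IsDominated W V) (hW : IsMajorant W) {ζ : ℂ}
    (hζ : 0 ≤ ζ.im) : IntegrableOn (fun x => jost 0 V x * jostSlope ζ V x) (Ioi 0) := by
  refine ((hW.integrableOn_tail.const_mul (2 * jostWeight W 0 * jostWeight W 0)).const_mul
    (2 * jostWeight W 0)).mono'
    (aestronglyMeasurable_jost_mul_jostSlope hV hW hζ) ?_
  filter_upwards [ae_restrict_mem measurableSet_Ioi] with x hx
  exact norm_jost_mul_jostSlope_le hV hW hζ (le_of_lt hx)

/-- The Wronskian of the Jost functions at energies `0` and `ζ²`. -/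
theorem jost_wronskian (hV : IsDominated W V) (hW : IsMajorant W) {ζ : ℂ} (hζ : 0 ≤ ζ.im) :
    jostSlope 0 V 0 * jost ζ V 0 - jost 0 V 0 * jostSlope ζ V 0 =
      -(2 * Complex.I * ζ * ∫ x in Ioi (0 : ℝ), jost 0 V x * jostSlope ζ V x) := by
  have hU : IsPrimitive
      (fun x => jostSlope 0 V x * jost ζ V x + (-1) * (jost 0 V x * jostSlope ζ V x))
      (fun x => 2 * Complex.I * ζ * (jost 0 V x * jostSlope ζ V x)) := by
    refine (((isPrimitive_jostSlope hV hW im_zero_nonneg).mul (isPrimitive_jost hV hW hζ)).add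
      (((isPrimitive_jost hV hW im_zero_nonneg).mul
        (isPrimitive_jostSlope hV hW hζ)).const_mul (-1))).congr (fun _ _ => rfl) fun x _ => ?_
    ring
  have h1 := hU.tendsto ((integrableOn_jost_mul_jostSlope hV hW hζ).const_mul _)
  have h2 := ((tendsto_jostSlope_atTop hV hW im_zero_nonneg).mul (tendsto_jost_atTop hV hW hζ)).add
    (((tendsto_jost_atTop hV hW im_zero_nonneg).mul
      (tendsto_jostSlope_atTop hV hW hζ)).const_mul (-1))
  have h3 := tendsto_nhds_unique h1 h2
  rw [integral_const_mul] at h3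
  linear_combination h3

/-- Since `g' = -w` for the zero-energy Jost function `g` and its slope `w`, the integral of
`2 g w = -(g²)'` is `g(0)² - 1`. -/
theorem integral_jost_mul_jostSlope (hV : IsDominated W V) (hW : IsMajorant W) :
    2 * ∫ x in Ioi (0 : ℝ), jost 0 V x * jostSlope 0 V x = jost 0 V 0 ^ 2 - 1 := by
  have hg := isPrimitive_jost hV hW im_zero_nonneg
  have hU : IsPrimitive (fun x => jost 0 V x * jost 0 V x)
      (fun x => -2 * (jost 0 V x * jostSlope 0 V x)) :=
    (hg.mul hg).congr (fun _ _ => rfl) fun x _ => by ring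
  have h1 := hU.tendsto ((integrableOn_jost_mul_jostSlope hV hW im_zero_nonneg).const_mul _)
  have h2 := (tendsto_jost_atTop hV hW im_zero_nonneg).mul
    (tendsto_jost_atTop hV hW im_zero_nonneg)
  have h3 := tendsto_nhds_unique h1 h2
  rw [integral_const_mul] at h3
  linear_combination -h3

/-- The filter of `ζ → 0` in the open upper half-plane. -/
abbrev upperNhdsZero : Filter ℂ := 𝓝[{ζ : ℂ | 0 < ζ.im}] 0

theorem eventually_upperNhdsZero : ∀ᶠ ζ in upperNhdsZero, 0 < ζ.im := self_mem_nhdsWithin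

theorem tendsto_upperNhdsZero : Tendsto (fun ζ : ℂ => ζ) upperNhdsZero (𝓝 0) :=
  tendsto_id.mono_left nhdsWithin_le_nhds

theorem eventually_upperNhdsZero_ne : ∀ᶠ ζ in upperNhdsZero, ζ ≠ 0 := by
  filter_upwards [eventually_upperNhdsZero] with ζ hζ h
  simp [h] at hζ

instance : upperNhdsZero.NeBot := by
  rw [← mem_closure_iff_nhdsWithin_neBot, Complex.closure_setOfPred_lt_im]
  simp

/-- `θ'(0)`, up to the sign, for the Jost function `θ(x) = e^{iζx} g(x)`. -/
def jostDeriv (ζ : ℂ) (V : ℝ → ℂ) : ℂ := jostSlope ζ V 0 - Complex.I * ζ * jost ζ V 0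

theorem tendsto_jost_zero (hV : IsDominated W V) (hW : IsMajorant W) :
    Tendsto (fun ζ => jost ζ V 0) upperNhdsZero (𝓝 (jost 0 V 0)) :=
  tendsto_jost hW (fun _ => hV) (eventually_upperNhdsZero.mono fun _ h => h.le)
    tendsto_upperNhdsZero (fun _ _ => tendsto_const_nhds) le_rfl

theorem tendsto_jostDeriv_zero (hV : IsDominated W V) (hW : IsMajorant W) :
    Tendsto (fun ζ => jostDeriv ζ V) upperNhdsZero (𝓝 (jostSlope 0 V 0)) := by
  have h1 := tendsto_jostSlope (V := V) hW (fun _ => hV)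
    (eventually_upperNhdsZero.mono fun _ h => h.le)
    tendsto_upperNhdsZero (fun _ _ => tendsto_const_nhds) le_rfl
  simpa [jostDeriv] using h1.sub
    ((tendsto_upperNhdsZero.const_mul Complex.I).mul (tendsto_jost_zero hV hW))

/-- The first order asymptotics of the Wronskian of the Jost functions.  It needs no second moment
of `V`, although the values of the Jost functions need not be differentiable at `ζ = 0`. -/
theorem tendsto_jost_wronskian (hV : IsDominated W V) (hW : IsMajorant W) :
    Tendsto (fun ζ => (jostSlope 0 V 0 * jost ζ V 0 - jost 0 V 0 * jostDeriv ζ V) /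
      (Complex.I * ζ)) upperNhdsZero (𝓝 1) := by
  have h1 : Tendsto (fun ζ => ∫ x in Ioi (0 : ℝ), jost 0 V x * jostSlope ζ V x) upperNhdsZero
      (𝓝 (∫ x in Ioi (0 : ℝ), jost 0 V x * jostSlope 0 V x)) := by
    refine tendsto_integral_filter_of_dominated_convergence
      (fun x => 2 * jostWeight W 0 * (2 * jostWeight W 0 * jostWeight W 0 * tail W x)) ?_ ?_
      ((hW.integrableOn_tail.const_mul _).const_mul _) ?_
    · filter_upwards [eventually_upperNhdsZero] with ζ hζ
      exact aestronglyMeasurable_jost_mul_jostSlope hV hW hζ.le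
    · filter_upwards [eventually_upperNhdsZero] with ζ hζ
      filter_upwards [ae_restrict_mem measurableSet_Ioi] with x hx
      exact norm_jost_mul_jostSlope_le hV hW hζ.le (le_of_lt hx)
    · filter_upwards [ae_restrict_mem measurableSet_Ioi] with x hx
      exact (tendsto_jostSlope hW (fun _ => hV) (eventually_upperNhdsZero.mono fun _ h => h.le)
        tendsto_upperNhdsZero (fun _ _ => tendsto_const_nhds) (le_of_lt hx)).const_mul _
  have h2 := (h1.const_mul (-2)).add ((tendsto_jost_zero hV hW).const_mul (jost 0 V 0))
  have h3 : -2 * (∫ x in Ioi (0 : ℝ), jost 0 V x * jostSlope 0 V x) + jost 0 V 0 * jost 0 V 0 =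
      1 := by
    linear_combination -integral_jost_mul_jostSlope hV hW
  rw [h3] at h2
  refine h2.congr' ?_
  filter_upwards [eventually_upperNhdsZero, eventually_upperNhdsZero_ne] with ζ hζ hζ0
  rw [eq_div_iff (mul_ne_zero Complex.I_ne_zero hζ0), jostDeriv]
  linear_combination -jost_wronskian hV hW hζ.le

/-- The zero-energy Jost function and its derivative do not both vanish at the vertex. -/
theorem jostSlope_ne_zero_of_jost_eq_zero (hV : IsDominated W V) (hW : IsMajorant W) (h : jost 0 V 0 = 0) :
    jostSlope 0 V 0 ≠ 0 := fun h' => by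
  have := tendsto_jost_wronskian hV hW
  simp only [h, h', zero_mul, sub_zero, zero_div] at this
  exact zero_ne_one (tendsto_nhds_unique tendsto_const_nhds this)

theorem conj_anticausal_zero {h : ℝ → ℂ} (hh : ∀ y, 0 ≤ y → conj (h y) = h y) {x : ℝ}
    (hx : 0 ≤ x) : conj (anticausal 0 h x) = anticausal 0 h x := by
  have e : ∀ h : ℝ → ℂ, anticausal 0 h x = ∫ y in Ioi x, h y := fun h => by simp [anticausal]
  rw [e, ← integral_conj]
  refine setIntegral_congr_fun measurableSet_Ioi fun y hy => hh y (hx.trans (le_of_lt hy))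

theorem conj_jostTerm (hV : ∀ y, conj (V y) = V y) (m : ℕ) :
    ∀ x, 0 ≤ x → conj (jostTerm 0 V m x) = jostTerm 0 V m x := by
  induction m with
  | zero =>
    intro x _
    simp [jostTerm]
  | succ m ih =>
    intro x hx
    refine conj_anticausal_zero (fun t ht => ?_) hx
    rw [mul_zero]
    exact conj_anticausal_zero (fun y hy => by rw [map_mul, hV, ih y hy]) ht

theorem conj_jost (hV : IsDominated W V) (hW : IsMajorant W) (hr : ∀ y, conj (V y) = V y) {x : ℝ}
    (hx : 0 ≤ x) : conj (jost 0 V x) = jost 0 V x := by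
  have h1 := hasSum_jost hV hW im_zero_nonneg hx
  have h2 := Complex.hasSum_conj'.2 h1
  simp only [conj_jostTerm hr _ x hx] at h2
  exact h2.unique h1

theorem conj_jostSlope (hV : IsDominated W V) (hW : IsMajorant W) (hr : ∀ y, conj (V y) = V y)
    {x : ℝ} (hx : 0 ≤ x) : conj (jostSlope 0 V x) = jostSlope 0 V x := by
  rw [jostSlope, mul_zero]
  exact conj_anticausal_zero (fun y hy => by rw [map_mul, hr, conj_jost hV hW hr hy]) hx

end Wronskian

/-! ### Bounded zero-energy solutions on an edge -/

section EdgeSolutions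

variable {W : ℝ → ℝ} {V : ℝ → ℂ}

theorem IsPrimitive.hasDerivWithinAt {F f : ℝ → ℂ} (h : IsPrimitive F f)
    (hf : ContinuousOn f (Ici 0)) {x : ℝ} (hx : 0 ≤ x) : HasDerivWithinAt F (f x) (Ici 0) x := by
  have hc : Continuous fun t : ℝ => f (max t 0) :=
    hf.comp_continuous (by fun_prop) fun t => le_max_right t 0
  have h1 : HasDerivAt (fun y => F 0 + ∫ t in (0 : ℝ)..y, f (max t 0)) (f (max x 0)) x :=
    (hc.integral_hasStrictDerivAt 0 x).hasDerivAt.const_add _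
  rw [max_eq_left hx] at h1
  have h2 : ∀ y ∈ Ici (0 : ℝ), F y = F 0 + ∫ t in (0 : ℝ)..y, f (max t 0) := fun y hy => by
    rw [h.eq hy]
    congr 1
    refine intervalIntegral.integral_congr fun t ht => ?_
    rw [uIcc_of_le hy] at ht
    rw [max_eq_left ht.1]
  exact h1.hasDerivWithinAt.congr h2 (h2 x hx)

/-- Bounded zero-energy solutions on a half-line are multiples of the Jost function. -/
theorem exists_eq_const_mul_jost (hV : IsDominated W V) (hW : IsMajorant W) {u du : ℝ → ℂ}
    (hu : ∀ x, 0 ≤ x → HasDerivWithinAt u (du x) (Ici 0) x)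
    (hdu : IsPrimitive du fun t => V t * u t) {C : ℝ} (hC : ∀ x, 0 ≤ x → ‖u x‖ ≤ C) :
    ∃ c : ℂ, (∀ x, 0 ≤ x → u x = c * jost 0 V x) ∧ du 0 = -(c * jostSlope 0 V 0) := by
  have huc : ContinuousOn u (Ici 0) := fun x hx => (hu x hx).continuousWithinAt
  have hint := hV.integrableOn_mul hW huc hC
  set w : ℝ → ℂ := anticausal 0 fun y => V y * u y with hw
  have hwi : IntegrableOn w (Ioi 0) := integrableOn_anticausal_mul hV hW im_zero_nonneg huc hC
  have hw_eq : ∀ x, w x = ∫ y in Ioi x, V y * u y := fun x => by simp [hw, anticausal]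
  set D : ℂ := du 0 + w 0 with hD
  have hdw : ∀ x, 0 ≤ x → du x = D - w x := fun x hx => by
    have h1 := intervalIntegral.integral_interval_add_Ioi hint (hint.mono_set (Ioi_subset_Ioi hx))
    rw [hdu.eq hx, hD, hw_eq, hw_eq, ← h1]
    ring
  have hux : ∀ x, 0 ≤ x → u x = u 0 + D * x - ∫ t in (0 : ℝ)..x, w t := fun x hx => by
    have hwx : IntervalIntegrable w volume 0 x :=
      (intervalIntegrable_iff_integrableOn_Ioc_of_le hx).2 (hwi.mono_set Ioc_subset_Ioi_self)
    have hdx : IntervalIntegrable du volume 0 x := by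
      refine ContinuousOn.intervalIntegrable ?_
      rw [uIcc_of_le hx]
      exact hdu.continuousOn hx
    have h1 := intervalIntegral.integral_eq_sub_of_hasDeriv_right_of_le hx
      (huc.mono Icc_subset_Ici_self)
      (fun t ht => (hu t ht.1.le).mono fun y hy => ht.1.le.trans (le_of_lt hy)) hdx
    have h2 : ∫ t in (0 : ℝ)..x, du t = ∫ t in (0 : ℝ)..x, (D - w t) := by
      refine intervalIntegral.integral_congr fun t ht => ?_
      rw [uIcc_of_le hx] at ht
      exact hdw t ht.1
    rw [h2, intervalIntegral.integral_sub intervalIntegrable_const hwx,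
      intervalIntegral.integral_const, sub_zero, Complex.real_smul] at h1
    linear_combination -h1
  -- `u` grows like `D x`, and it is bounded
  have hD0 : D = 0 := by
    by_contra hne
    have hpos : 0 < ‖D‖ := norm_pos_iff.2 hne
    set M : ℝ := ∫ t in Ioi (0 : ℝ), ‖w t‖ with hM
    have hM0 : 0 ≤ M := integral_nonneg fun _ => norm_nonneg _
    have hC0 : 0 ≤ C := (norm_nonneg _).trans (hC 0 le_rfl)
    have hle : ∀ x, 0 ≤ x → ‖D‖ * x ≤ C + C + M := fun x hx => by
      have e : D * x = u x - u 0 + ∫ t in (0 : ℝ)..x, w t := by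
        rw [hux x hx]
        ring
      have e2 : ‖D‖ * x = ‖D * x‖ := by
        rw [norm_mul, Complex.norm_real, Real.norm_of_nonneg hx]
      rw [e2, e]
      refine (norm_add_le _ _).trans (add_le_add ((norm_sub_le _ _).trans
        (add_le_add (hC x hx) (hC 0 le_rfl))) ?_)
      rw [intervalIntegral.integral_of_le hx]
      exact (norm_integral_le_integral_norm _).trans (setIntegral_mono_set hwi.norm
        (Eventually.of_forall fun _ => norm_nonneg _) Ioc_subset_Ioi_self.eventuallyLE)
    have h1 := hle ((C + C + M + 1) / ‖D‖) (by positivity)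
    rw [mul_div_cancel₀ _ hpos.ne'] at h1
    linarith
  refine ⟨u 0 - ∫ t in Ioi (0 : ℝ), w t, ?_⟩
  have hj : ∀ x, 0 ≤ x → u x = (u 0 - ∫ t in Ioi (0 : ℝ), w t) * jost 0 V x := fun x hx => by
    refine eq_const_mul_jost hV hW im_zero_nonneg huc hC (fun y hy => ?_) hx
    have h1 := intervalIntegral.integral_interval_add_Ioi hwi (hwi.mono_set (Ioi_subset_Ioi hy))
    have h2 : anticausal 0 w y = ∫ t in Ioi y, w t := by simp [anticausal]
    rw [mul_zero, ← hw, h2, hux y hy, hD0, ← h1]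
    ring
  refine ⟨hj, ?_⟩
  have h3 : du 0 = -w 0 := by
    linear_combination hD0 - hD
  rw [h3, hw, jostSlope, mul_zero, ← anticausal_const_mul]
  congr 1
  refine anticausal_congr_of_nonneg (fun y hy => ?_) le_rfl
  rw [hj y hy]
  ring

end EdgeSolutions

/-! ### The dimension of the space of solutions -/

section VertexSpace

variable {ι : Type*} [Fintype ι]

/-- The coefficient vectors `c` for which the functions `c_j θ_j` with `θ_j(0) = a_j` and
`θ_j'(0) = -β_j` satisfy the vertex conditions. -/
def vertexSpace (a β : ι → ℂ) : Submodule ℂ (ι → ℂ) where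
  carrier := {c | (∀ i j, c i * a i = c j * a j) ∧ ∑ j, c j * β j = 0}
  zero_mem' := by simp
  add_mem' := by
    rintro c c' ⟨h1, h2⟩ ⟨h1', h2'⟩
    refine ⟨fun i j => ?_, ?_⟩
    · simp only [Pi.add_apply, add_mul, h1 i j, h1' i j]
    · simp only [Pi.add_apply, add_mul, Finset.sum_add_distrib, h2, h2', add_zero]
  smul_mem' := by
    rintro s c ⟨h1, h2⟩
    refine ⟨fun i j => ?_, ?_⟩
    · simp only [Pi.smul_apply, smul_eq_mul, mul_assoc, h1 i j]
    · simp only [Pi.smul_apply, smul_eq_mul, mul_assoc, ← Finset.mul_sum, h2, mul_zero]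

theorem mem_vertexSpace {a β c : ι → ℂ} :
    c ∈ vertexSpace a β ↔ (∀ i j, c i * a i = c j * a j) ∧ ∑ j, c j * β j = 0 := Iff.rfl

/-- If no `a_j` vanishes, then `c` is determined by the common value of `c_j a_j`, and there is one
more equation `∑ β_j / a_j = 0`. -/
theorem finrank_vertexSpace_of_sum_eq_zero [Nonempty ι] {a β : ι → ℂ} (ha : ∀ j, a j ≠ 0)
    (h : ∑ j, β j / a j = 0) : Module.finrank ℂ (vertexSpace a β) = 1 := by
  obtain ⟨i₀⟩ := ‹Nonempty ι›
  have e : vertexSpace a β = ℂ ∙ fun j => 1 / a j := by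
    ext c
    rw [mem_vertexSpace, Submodule.mem_span_singleton]
    constructor
    · rintro ⟨h1, -⟩
      refine ⟨c i₀ * a i₀, funext fun j => ?_⟩
      rw [Pi.smul_apply, smul_eq_mul, h1 i₀ j]
      field_simp [ha j]
    · rintro ⟨s, rfl⟩
      refine ⟨fun i j => ?_, ?_⟩
      · simp [ha]
      · have : ∀ j, (s • fun j => 1 / a j) j * β j = s * (β j / a j) := fun j => by
          simp only [Pi.smul_apply, smul_eq_mul]
          ring
        simp only [this, ← Finset.mul_sum, h, mul_zero]
  rw [e]
  refine finrank_span_singleton fun h0 => ?_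
  have := congrFun h0 i₀
  simp [ha] at this

theorem finrank_vertexSpace_of_sum_ne_zero {a β : ι → ℂ} (ha : ∀ j, a j ≠ 0)
    (h : ∑ j, β j / a j ≠ 0) : Module.finrank ℂ (vertexSpace a β) = 0 := by
  have e : vertexSpace a β = ⊥ := by
    rw [Submodule.eq_bot_iff]
    rintro c ⟨h1, h2⟩
    funext i
    have h3 : ∑ j, c j * β j = c i * a i * ∑ j, β j / a j := by
      rw [Finset.mul_sum]
      refine Finset.sum_congr rfl fun j _ => ?_
      rw [h1 i j]
      field_simp [ha j]
    rw [h3] at h2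
    have h4 := (mul_eq_zero.1 h2).resolve_right h
    exact (mul_eq_zero.1 h4).resolve_right (ha i)
  rw [e, finrank_bot]

/-- If some `a_j` vanishes, then the common value of `c_j a_j` is zero, `c` is supported on
`{j | a_j = 0}`, and there is one more equation for it. -/
theorem finrank_vertexSpace_of_exists {a β : ι → ℂ} {i₀ : ι} (hi₀ : a i₀ = 0)
    (h : ∀ j, a j = 0 → β j ≠ 0) :
    Module.finrank ℂ (vertexSpace a β) + 1 = Fintype.card {j // a j = 0} := by
  classical
  set f : Module.Dual ℂ ({j // a j = 0} → ℂ) := ∑ j, β j.1 • LinearMap.proj j with hf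
  have hf_apply : ∀ c, f c = ∑ j, c j * β j.1 := fun c => by
    simp [hf, mul_comm]
  have hf0 : f ≠ 0 := fun h0 => by
    have := congrArg (fun g : Module.Dual ℂ ({j // a j = 0} → ℂ) => g (Pi.single ⟨i₀, hi₀⟩ 1)) h0
    simp only [hf_apply, LinearMap.zero_apply] at this
    rw [Finset.sum_eq_single ⟨i₀, hi₀⟩ (fun j _ hj => by simp [hj]) (by simp)] at this
    simp only [Pi.single_eq_same, one_mul] at this
    exact h i₀ hi₀ this
  set X : ({j // a j = 0} → ℂ) →ₗ[ℂ] ι → ℂ :=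
    Function.ExtendByZero.linearMap ℂ (Subtype.val : {j // a j = 0} → ι) with hX
  have hX1 : ∀ c (j : {j // a j = 0}), X c j.1 = c j := fun c j =>
    Subtype.val_injective.extend_apply c 0 j
  have hX0 : ∀ c j, a j ≠ 0 → X c j = 0 := fun c j hj =>
    Function.extend_apply' (f := (Subtype.val : {j // a j = 0} → ι)) c 0 j (by simpa using hj)
  have hsum : ∀ c : ι → ℂ, (∀ j, a j ≠ 0 → c j = 0) →
      ∑ j, c j * β j = ∑ j : {j // a j = 0}, c j.1 * β j.1 := fun c hc => by
    rw [← Fintype.sum_subtype_add_sum_subtype (fun j => a j = 0) fun j => c j * β j]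
    simp [fun j : {j // a j ≠ 0} => hc j.1 j.2]
  have hinj : Function.Injective X := fun c c' hcc => by
    funext j
    rw [← hX1 c j, ← hX1 c' j, hcc]
  have e : vertexSpace a β = (LinearMap.ker f).map X := by
    ext c
    rw [mem_vertexSpace, Submodule.mem_map]
    constructor
    · rintro ⟨h1, h2⟩
      have hc : ∀ j, a j ≠ 0 → c j = 0 := fun j hj => by
        have := h1 j i₀
        rw [hi₀, mul_zero] at this
        exact (mul_eq_zero.1 this).resolve_right hj
      refine ⟨fun j => c j.1, ?_, ?_⟩
      · rw [LinearMap.mem_ker, hf_apply, ← hsum c hc, h2]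
      · funext j
        by_cases hj : a j = 0
        · exact hX1 _ ⟨j, hj⟩
        · rw [hX0 _ j hj, hc j hj]
    · rintro ⟨c, hc, rfl⟩
      have h0 : ∀ j, X c j * a j = 0 := fun j => by
        by_cases hj : a j = 0
        · rw [hj, mul_zero]
        · rw [hX0 c j hj, zero_mul]
      refine ⟨fun i j => by rw [h0, h0], ?_⟩
      rw [hsum _ (hX0 c)]
      simp only [hX1]
      rwa [LinearMap.mem_ker, hf_apply] at hc
  rw [e, ← (Submodule.equivMapOfInjective X hinj (LinearMap.ker f)).finrank_eq,
    Module.Dual.finrank_ker_add_one_of_ne_zero hf0, Module.finrank_fintype_fun_eq_card]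

end VertexSpace

/-! ### Asymptotics of the vertex sum -/

section VertexAsymptotics

theorem sum_sq_ne_zero {ι : Type*} {r : ι → ℂ} (hr : ∀ j, conj (r j) = r j) {s : Finset ι}
    {i₀ : ι} (hi : i₀ ∈ s) (h0 : r i₀ ≠ 0) : ∑ j ∈ s, r j ^ 2 ≠ 0 := by
  have h1 : ∀ j, r j ^ 2 = ((‖r j‖ ^ 2 : ℝ) : ℂ) := fun j => by
    rw [Complex.ofReal_pow, ← Complex.mul_conj', hr, sq]
  simp only [h1]
  rw [← Complex.ofReal_sum]
  refine Complex.ofReal_ne_zero.2 (ne_of_gt ?_)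
  exact Finset.sum_pos' (fun j _ => by positivity) ⟨i₀, hi, by positivity⟩

variable {ι : Type*} [Fintype ι] [DecidableEq ι] {l : Filter ℂ} {G L : ι → ℂ → ℂ} {a β : ι → ℂ}

/-- The sum `∑ L_j ∏_{k ≠ j} G_k`: it vanishes iff multiples of solutions with the values `G_j`
and the derivatives `-L_j` at the vertex satisfy the vertex conditions. -/
def vertexSum (G L : ι → ℂ) : ℂ := ∑ j, L j * ∏ k ∈ Finset.univ.erase j, G k

theorem tendsto_vertexSum (hG : ∀ j, Tendsto (G j) l (𝓝 (a j)))
    (hL : ∀ j, Tendsto (L j) l (𝓝 (β j))) :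
    Tendsto (fun ζ => vertexSum (fun j => G j ζ) fun j => L j ζ) l (𝓝 (vertexSum a β)) :=
  tendsto_finsetSum _ fun j _ => (hL j).mul (tendsto_finsetProd _ fun k _ => hG k)

theorem vertexSum_eq (ha : ∀ j, a j ≠ 0) (β : ι → ℂ) :
    vertexSum a β = (∏ j, a j) * ∑ j, β j / a j := by
  rw [vertexSum, Finset.mul_sum]
  refine Finset.sum_congr rfl fun j _ => ?_
  rw [← Finset.mul_prod_erase Finset.univ a (Finset.mem_univ j)]
  field_simp [ha j]

/-- The case of a nontrivial solution that does not vanish at the vertex. -/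
theorem tendsto_vertexSum_div (hl : ∀ᶠ ζ in l, ζ ≠ 0) (hG : ∀ j, Tendsto (G j) l (𝓝 (a j)))
    (hq : ∀ j, Tendsto (fun ζ => (β j * G j ζ - a j * L j ζ) / (Complex.I * ζ)) l (𝓝 1))
    (ha : ∀ j, a j ≠ 0) (h : ∑ j, β j / a j = 0) :
    Tendsto (fun ζ => vertexSum (fun j => G j ζ) (fun j => L j ζ) / ζ) l
      (𝓝 (-Complex.I * ((∏ j, a j) * ∑ j, (1 / a j) ^ 2))) := by
  have h1 : Tendsto (fun ζ => -Complex.I * vertexSum (fun j => G j ζ) fun j =>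
      (1 / a j) * ((β j * G j ζ - a j * L j ζ) / (Complex.I * ζ))) l
      (𝓝 (-Complex.I * vertexSum a fun j => 1 / a j * 1)) :=
    (tendsto_vertexSum hG fun j => (hq j).const_mul (1 / a j)).const_mul _
  have h2 : vertexSum a (fun j => 1 / a j * 1) = (∏ j, a j) * ∑ j, (1 / a j) ^ 2 := by
    rw [vertexSum_eq ha]
    congr 1
    refine Finset.sum_congr rfl fun j _ => ?_
    ring
  rw [h2] at h1
  refine h1.congr' ?_
  filter_upwards [hl] with ζ hζ
  have h3 : vertexSum (fun j => G j ζ) (fun j => L j ζ) =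
      (∏ j, G j ζ) * (∑ j, β j / a j) - Complex.I * ζ * vertexSum (fun j => G j ζ) fun j =>
        (1 / a j) * ((β j * G j ζ - a j * L j ζ) / (Complex.I * ζ)) := by
    rw [vertexSum, vertexSum, Finset.mul_sum, Finset.mul_sum, ← Finset.sum_sub_distrib]
    refine Finset.sum_congr rfl fun j _ => ?_
    rw [← Finset.mul_prod_erase Finset.univ (fun j => G j ζ) (Finset.mem_univ j)]
    have := ha j
    field_simp
    ring
  rw [h3, h, mul_zero, zero_sub, eq_div_iff hζ]
  ring

/-- The case where some of the solutions vanish at the vertex. -/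
theorem tendsto_vertexSum_div_pow (hl : ∀ᶠ ζ in l, ζ ≠ 0) (hl0 : Tendsto (fun ζ => ζ) l (𝓝 0))
    (hG : ∀ j, Tendsto (G j) l (𝓝 (a j))) (hL : ∀ j, Tendsto (L j) l (𝓝 (β j)))
    (hq : ∀ j, Tendsto (fun ζ => (β j * G j ζ - a j * L j ζ) / (Complex.I * ζ)) l (𝓝 1))
    (h : ∀ j, a j = 0 → β j ≠ 0) :
    Tendsto (fun ζ => vertexSum (fun j => G j ζ) (fun j => L j ζ) * ζ /
        ζ ^ (Finset.univ.filter fun j => a j = 0).card) l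
      (𝓝 ((∏ j, if a j = 0 then Complex.I / β j else a j) *
        (-Complex.I * ∑ j ∈ Finset.univ.filter fun j => a j = 0, β j ^ 2))) := by
  set γ : ι → ℂ := fun j => if a j = 0 then Complex.I / β j else a j with hγ
  have hγ0 : ∀ j, γ j ≠ 0 := fun j => by
    rw [hγ]
    dsimp only
    split_ifs with hj
    · exact div_ne_zero Complex.I_ne_zero (h j hj)
    · exact hj
  -- the factors that tend to zero are rescaled by `z j = ζ`
  set z : ℂ → ι → ℂ := fun ζ j => if a j = 0 then ζ else 1 with hz
  have h1 : ∀ j, Tendsto (fun ζ => G j ζ / z ζ j) l (𝓝 (γ j)) := fun j => by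
    by_cases hj : a j = 0
    · have h2 := (hq j).mul_const (Complex.I / β j)
      rw [one_mul] at h2
      simp only [hγ, hz, hj, if_true]
      refine h2.congr' ?_
      filter_upwards [hl] with ζ hζ
      have := h j hj
      rw [hj]
      field_simp
      ring
    · simpa only [hγ, hz, hj, if_false, div_one] using hG j
  have h2 : ∀ j, Tendsto (fun ζ => (if a j = 0 then 1 else ζ) * L j ζ) l
      (𝓝 ((if a j = 0 then 1 else 0) * β j)) := fun j => by
    by_cases hj : a j = 0
    · simpa only [hj, if_true, one_mul] using hL j
    · simpa only [hj, if_false] using hl0.mul (hL j)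
  have h3 := tendsto_vertexSum h1 h2
  have h4 : vertexSum γ (fun j => (if a j = 0 then 1 else 0) * β j) = (∏ j, γ j) *
      (-Complex.I * ∑ j ∈ Finset.univ.filter fun j => a j = 0, β j ^ 2) := by
    rw [vertexSum_eq hγ0, Finset.sum_filter]
    congr 1
    rw [Finset.mul_sum]
    refine Finset.sum_congr rfl fun j _ => ?_
    by_cases hj : a j = 0
    · have := h j hj
      simp only [hγ, hj, if_true]
      field_simp
      linear_combination Complex.I_sq
    · simp [hj]
  rw [h4] at h3
  refine h3.congr' ?_
  filter_upwards [hl] with ζ hζ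
  have hz0 : ∀ j, z ζ j ≠ 0 := fun j => by
    simp only [hz]
    split_ifs
    · exact hζ
    · exact one_ne_zero
  have hprod : ∏ j, z ζ j = ζ ^ (Finset.univ.filter fun j => a j = 0).card := by
    rw [hz, Finset.prod_ite]
    simp
  rw [← hprod, eq_div_iff (Finset.prod_ne_zero_iff.2 fun j _ => hz0 j), vertexSum, vertexSum,
    Finset.sum_mul, Finset.sum_mul]
  refine Finset.sum_congr rfl fun j _ => ?_
  rw [Finset.prod_div_distrib, ← Finset.mul_prod_erase Finset.univ (z ζ) (Finset.mem_univ j)]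
  have h5 : ∏ k ∈ Finset.univ.erase j, z ζ k ≠ 0 := Finset.prod_ne_zero_iff.2 fun j _ => hz0 j
  have h6 : (if a j = 0 then 1 else ζ) * z ζ j = ζ := by
    simp only [hz]
    split_ifs <;> ring
  field_simp
  linear_combination (L j ζ * ∏ k ∈ Finset.univ.erase j, G k ζ) * h6

/-- The order of vanishing of `vertexSum` at `ζ = 0` is the dimension of `vertexSpace`. -/
theorem exists_tendsto_vertexSum [Nonempty ι] (hl : ∀ᶠ ζ in l, ζ ≠ 0)
    (hl0 : Tendsto (fun ζ => ζ) l (𝓝 0))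
    (hG : ∀ j, Tendsto (G j) l (𝓝 (a j))) (hL : ∀ j, Tendsto (L j) l (𝓝 (β j)))
    (hq : ∀ j, Tendsto (fun ζ => (β j * G j ζ - a j * L j ζ) / (Complex.I * ζ)) l (𝓝 1))
    (h : ∀ j, a j = 0 → β j ≠ 0) (har : ∀ j, conj (a j) = a j) (hβr : ∀ j, conj (β j) = β j) :
    ∃ c : ℂ, c ≠ 0 ∧ Tendsto (fun ζ => vertexSum (fun j => G j ζ) (fun j => L j ζ) /
      ζ ^ Module.finrank ℂ (vertexSpace a β)) l (𝓝 c) := by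
  by_cases hP : ∃ i, a i = 0
  · obtain ⟨i₀, hi₀⟩ := hP
    refine ⟨_, ?_, (tendsto_vertexSum_div_pow hl hl0 hG hL hq h).congr' ?_⟩
    · refine mul_ne_zero (Finset.prod_ne_zero_iff.2 fun j _ => ?_)
        (mul_ne_zero (neg_ne_zero.2 Complex.I_ne_zero)
          (sum_sq_ne_zero hβr (i₀ := i₀) (by simp [hi₀]) (h i₀ hi₀)))
      split_ifs with hj
      · exact div_ne_zero Complex.I_ne_zero (h j hj)
      · exact hj
    · filter_upwards [hl] with ζ hζ
      rw [← Fintype.card_subtype, ← finrank_vertexSpace_of_exists hi₀ h, pow_succ,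
        mul_div_mul_right _ _ hζ]
  · have ha : ∀ j, a j ≠ 0 := fun j hj => hP ⟨j, hj⟩
    by_cases hs : ∑ j, β j / a j = 0
    · refine ⟨_, ?_, (tendsto_vertexSum_div hl hG hq ha hs).congr fun ζ => ?_⟩
      · obtain ⟨i₀⟩ := ‹Nonempty ι›
        refine mul_ne_zero (neg_ne_zero.2 Complex.I_ne_zero) (mul_ne_zero
          (Finset.prod_ne_zero_iff.2 fun j _ => ha j)
          (sum_sq_ne_zero (fun j => ?_) (Finset.mem_univ i₀) (one_div_ne_zero (ha i₀))))
        rw [map_div₀, map_one, har]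
      · rw [finrank_vertexSpace_of_sum_eq_zero ha hs, pow_one]
    · refine ⟨_, ?_, (tendsto_vertexSum hG hL).congr fun ζ => ?_⟩
      · rw [vertexSum_eq ha]
        exact mul_ne_zero (Finset.prod_ne_zero_iff.2 fun j _ => ha j) hs
      · rw [finrank_vertexSpace_of_sum_ne_zero ha hs, pow_zero, div_one]

end VertexAsymptotics

/-! ### Potentials with a finite first moment -/

section Potential

/-- `|V|`, extended by zero to the negative half-line. -/
def edgeMajorant (V : ℝ → ℝ) : ℝ → ℝ := (Ioi 0).indicator fun y => |V y|

variable {V : ℝ → ℝ}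

theorem aestronglyMeasurable_of_moment (h : IntegrableOn (fun x => (1 + x) * V x) (Ioi 0)) :
    AEStronglyMeasurable V (volume.restrict (Ioi 0)) := by
  have h1 : AEStronglyMeasurable (fun x : ℝ => (1 + x)⁻¹ * ((1 + x) * V x))
      (volume.restrict (Ioi 0)) :=
    AEStronglyMeasurable.mul (Measurable.aestronglyMeasurable (by fun_prop)) h.1
  refine h1.congr ?_
  filter_upwards [ae_restrict_mem measurableSet_Ioi] with x hx
  have : 1 + x ≠ 0 := by linarith [mem_Ioi.1 hx]
  field_simp

theorem integrableOn_of_moment (h : IntegrableOn (fun x => (1 + x) * V x) (Ioi 0)) :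
    IntegrableOn V (Ioi 0) := by
  refine Integrable.mono h (aestronglyMeasurable_of_moment h) ?_
  filter_upwards [ae_restrict_mem measurableSet_Ioi] with x hx
  have hx' : 0 < x := hx
  rw [norm_mul]
  refine le_mul_of_one_le_left (norm_nonneg _) ?_
  rw [Real.norm_of_nonneg (by linarith)]
  linarith

theorem isMajorant_edgeMajorant (h : IntegrableOn (fun x => (1 + x) * V x) (Ioi 0)) :
    IsMajorant (edgeMajorant V) := by
  have h0 := integrableOn_of_moment h
  refine ⟨fun y => indicator_nonneg (fun _ _ => abs_nonneg _) y,
    (integrable_indicator_iff measurableSet_Ioi).2 h0.norm, ?_⟩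
  refine (h.norm.sub h0.norm).congr ?_
  filter_upwards [ae_restrict_mem measurableSet_Ioi] with x hx
  have hx' : 0 < x := hx
  simp only [Pi.sub_apply, norm_mul, edgeMajorant, indicator_of_mem hx, Real.norm_eq_abs]
  rw [abs_of_pos (by linarith : 0 < 1 + x)]
  ring

theorem isDominated_edgeMajorant (h : IntegrableOn (fun x => (1 + x) * V x) (Ioi 0)) :
    IsDominated (edgeMajorant V) fun y => (V y : ℂ) := by
  refine ⟨Complex.continuous_ofReal.comp_aestronglyMeasurable (aestronglyMeasurable_of_moment h),
    fun y hy => ?_⟩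
  simp [edgeMajorant, hy]

theorem isDominated_truncated (h : IntegrableOn (fun x => (1 + x) * V x) (Ioi 0)) (k : ℕ) :
    IsDominated (edgeMajorant V) fun y => if y < k then (V y : ℂ) else 0 := by
  refine ⟨?_, fun y hy => ?_⟩
  · refine ((isDominated_edgeMajorant h).aestronglyMeasurable.indicator
      (measurableSet_Iio (a := (k : ℝ)))).congr (Eventually.of_forall fun y => ?_)
    simp [indicator]
  · split_ifs
    · exact (isDominated_edgeMajorant h).le y hy
    · simpa using (isMajorant_edgeMajorant h).nonneg y

end Potential

/-! ### The zero-energy space -/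

section ZeroEnergy

variable {n : ℕ} {V : Fin n → ℝ → ℝ}

/-- The values of the zero-energy Jost functions at the vertex. -/
def jostValue (V : Fin n → ℝ → ℝ) (j : Fin n) : ℂ := jost 0 (fun y => (V j y : ℂ)) 0

/-- Minus the derivatives of the zero-energy Jost functions at the vertex. -/
def jostSlopeValue (V : Fin n → ℝ → ℝ) (j : Fin n) : ℂ := jostSlope 0 (fun y => (V j y : ℂ)) 0

/-- `c ↦ (c_j θ_j)_j`, with the zero-energy Jost functions `θ_j`. -/
def jostCombination (V : Fin n → ℝ → ℝ) : (Fin n → ℂ) →ₗ[ℂ] Fin n → ℝ → ℂ where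
  toFun c j x := if x < 0 then 0 else c j * jost 0 (fun y => (V j y : ℂ)) x
  map_add' c c' := by
    funext j x
    by_cases h : x < 0 <;> simp [h, add_mul]
  map_smul' s c := by
    funext j x
    by_cases h : x < 0 <;> simp [h, mul_assoc]

theorem jostCombination_apply_of_nonneg (c : Fin n → ℂ) (j : Fin n) {x : ℝ} (hx : 0 ≤ x) :
    jostCombination V c j x = c j * jost 0 (fun y => (V j y : ℂ)) x := if_neg hx.not_gt

theorem jostCombination_apply_of_neg (c : Fin n → ℂ) (j : Fin n) {x : ℝ} (hx : x < 0) :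
    jostCombination V c j x = 0 := if_pos hx

theorem jostCombination_injective (hV : FirstMoment V) :
    Function.Injective (jostCombination V) := by
  refine (injective_iff_map_eq_zero _).2 fun c hc => funext fun j => ?_
  have h1 := (tendsto_jost_atTop (isDominated_edgeMajorant (hV j)) (isMajorant_edgeMajorant (hV j))
    im_zero_nonneg).const_mul (c j)
  rw [mul_one] at h1
  refine tendsto_nhds_unique h1 (tendsto_const_nhds.congr' ?_)
  filter_upwards [eventually_ge_atTop 0] with x hx
  rw [← jostCombination_apply_of_nonneg c j hx, hc]
  rfl

theorem isZeroEnergySolution_jostCombination (hV : FirstMoment V) {c : Fin n → ℂ}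
    (hc : c ∈ vertexSpace (jostValue V) (jostSlopeValue V)) :
    IsZeroEnergySolution V (jostCombination V c)
      fun j x => -(c j * jostSlope 0 (fun y => (V j y : ℂ)) x) := by
  have hd := fun j => isDominated_edgeMajorant (hV j)
  have hm := fun j => isMajorant_edgeMajorant (hV j)
  have hslope : ∀ j, IsPrimitive (fun x => -(c j * jostSlope 0 (fun y => (V j y : ℂ)) x))
      fun t => (V j t : ℂ) * jostCombination V c j t := fun j => by
    refine ((isPrimitive_jostSlope (hd j) (hm j) im_zero_nonneg).const_mul (-c j)).congr
      (fun x _ => by ring) fun x hx => ?_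
    rw [jostCombination_apply_of_nonneg c j hx]
    ring
  refine ⟨fun j x hx => ?_, fun j x hx => (hslope j).intervalIntegrable hx,
    fun j x hx => (hslope j).eq hx, ?_, fun i j => ?_, ?_⟩
  · refine IsPrimitive.hasDerivWithinAt ?_ (hslope j).continuousOn_Ici hx
    refine ((isPrimitive_jost (hd j) (hm j) im_zero_nonneg).const_mul (c j)).congr
      (fun x hx => jostCombination_apply_of_nonneg c j hx) fun x _ => ?_
    ring
  · refine ⟨∑ j, ‖c j‖ * (2 * jostWeight (edgeMajorant (V j)) 0), fun j x hx => ?_⟩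
    rw [jostCombination_apply_of_nonneg c j hx, norm_mul]
    refine (mul_le_mul_of_nonneg_left (norm_jost_le (hd j) (hm j) im_zero_nonneg x hx)
      (norm_nonneg _)).trans ?_
    exact Finset.single_le_sum (f := fun j => ‖c j‖ * (2 * jostWeight (edgeMajorant (V j)) 0))
      (fun j _ => mul_nonneg (norm_nonneg _) (mul_nonneg two_pos.le (jostWeight_pos _ _).le))
      (Finset.mem_univ j)
  · rw [jostCombination_apply_of_nonneg c i le_rfl, jostCombination_apply_of_nonneg c j le_rfl]
    exact hc.1 i j
  · rw [Finset.sum_neg_distrib]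
    exact neg_eq_zero.2 hc.2

/-- The bounded zero-energy solutions are the combinations of the Jost functions that satisfy the
vertex conditions. -/
theorem zeroEnergySpace_eq_map (hV : FirstMoment V) :
    zeroEnergySpace V = (vertexSpace (jostValue V) (jostSlopeValue V)).map (jostCombination V) := by
  ext u
  rw [Submodule.mem_map]
  constructor
  · rintro ⟨h0, du, hu⟩
    obtain ⟨C, hC⟩ := hu.bounded
    have hex := fun j => exists_eq_const_mul_jost (isDominated_edgeMajorant (hV j))
      (isMajorant_edgeMajorant (hV j)) (hu.hasDeriv j)
      (fun x hx => ⟨hu.integrable j x hx, hu.deriv_eq j x hx⟩) (hC j)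
    choose c hc hc' using hex
    refine ⟨c, ⟨fun i j => ?_, ?_⟩, ?_⟩
    · have := hu.vertex i j
      rwa [hc i 0 le_rfl, hc j 0 le_rfl] at this
    · have := hu.kirchhoff
      simp only [hc', Finset.sum_neg_distrib] at this
      exact neg_eq_zero.1 this
    · funext j x
      rcases lt_or_ge x 0 with hx | hx
      · rw [jostCombination_apply_of_neg c j hx, h0 j x hx]
      · rw [jostCombination_apply_of_nonneg c j hx, hc j x hx]
  · rintro ⟨c, hc, rfl⟩
    exact ⟨fun j x hx => jostCombination_apply_of_neg c j hx, _,
      isZeroEnergySolution_jostCombination hV hc⟩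

theorem finiteDimensional_zeroEnergySpace (hV : FirstMoment V) :
    FiniteDimensional ℂ (zeroEnergySpace V) := by
  rw [zeroEnergySpace_eq_map hV]
  infer_instance

theorem resonanceMultiplicity_eq (hV : FirstMoment V) : resonanceMultiplicity V =
    Module.finrank ℂ (vertexSpace (jostValue V) (jostSlopeValue V)) := by
  rw [resonanceMultiplicity, zeroEnergySpace_eq_map hV]
  exact (Submodule.equivMapOfInjective _ (jostCombination_injective hV) _).finrank_eq.symm

end ZeroEnergy

/-! ### The perturbation determinant -/

section PerturbationDeterminant

variable {n : ℕ} {V : Fin n → ℝ → ℝ}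

/-- `√|V|` as a complex-valued function on the graph. -/
def sqrtAbs (V : Fin n → ℝ → ℝ) (p : Fin n × ℝ) : ℂ := (Real.sqrt |V p.1 p.2| : ℂ)

/-- `√V = (sgn V) √|V|` as a complex-valued function on the graph. -/
def signedSqrt (V : Fin n → ℝ → ℝ) (p : Fin n × ℝ) : ℂ :=
  ((Real.sign (V p.1 p.2) * Real.sqrt |V p.1 p.2| : ℝ) : ℂ)

theorem sign_mul_abs (r : ℝ) : Real.sign r * |r| = r := by
  rcases lt_trichotomy r 0 with h | h | h
  · rw [Real.sign_of_neg h, abs_of_neg h]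
    ring
  · simp [h]
  · rw [Real.sign_of_pos h, abs_of_pos h, one_mul]

theorem signedSqrt_mul_sqrtAbs (p : Fin n × ℝ) :
    signedSqrt V p * sqrtAbs V p = (V p.1 p.2 : ℂ) := by
  rw [signedSqrt, sqrtAbs, ← Complex.ofReal_mul, mul_assoc, Real.mul_self_sqrt (abs_nonneg _),
    sign_mul_abs]

theorem measurable_sign : Measurable Real.sign := by
  have : Real.sign = fun r : ℝ => if r < 0 then -1 else if 0 < r then 1 else 0 := by
    funext r
    rw [Real.sign]
  rw [this]
  exact Measurable.ite measurableSet_Iio measurable_const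
    (Measurable.ite measurableSet_Ioi measurable_const measurable_const)

theorem memLp_sqrtAbs (hV : FirstMoment V) : MemLp (sqrtAbs V) 2 (starMeasure n) := by
  refine memLp_star_iff.2 fun j => ?_
  have hm : AEStronglyMeasurable (fun x => sqrtAbs V (j, x)) (volume.restrict (Ioi 0)) :=
    Complex.continuous_ofReal.comp_aestronglyMeasurable
      (Real.continuous_sqrt.comp_aestronglyMeasurable
        (aestronglyMeasurable_of_moment (hV j)).norm)
  refine (memLp_two_iff_integrable_sq_norm hm).2
    ((integrableOn_of_moment (hV j)).norm.congr (Eventually.of_forall fun x => ?_))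
  simp [sqrtAbs, Real.sq_sqrt (abs_nonneg _)]

theorem memLp_signedSqrt (hV : FirstMoment V) : MemLp (signedSqrt V) 2 (starMeasure n) := by
  refine (memLp_sqrtAbs hV).of_le (aestronglyMeasurable_star_iff.2 fun j => ?_)
    (Eventually.of_forall fun p => ?_)
  · have hm := (aestronglyMeasurable_of_moment (hV j)).aemeasurable
    exact (Complex.measurable_ofReal.comp_aemeasurable ((measurable_sign.comp_aemeasurable hm).mul
      (Real.continuous_sqrt.measurable.comp_aemeasurable hm.norm))).aestronglyMeasurable
  · rw [signedSqrt, sqrtAbs, Complex.ofReal_mul, norm_mul]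
    refine mul_le_of_le_one_left (norm_nonneg _) ?_
    rw [Complex.norm_real]
    rcases Real.sign_apply_eq (V p.1 p.2) with h | h | h <;> simp [h]

theorem IsWeightedResolvent.isSandwich {ζ : ℂ} {R A : StarL2 n →L[ℂ] StarL2 n}
    (hR : ∀ f, R f =ᵐ[starMeasure n] resolventFun ζ f)
    (hA : IsWeightedResolvent ζ (signedSqrt V) (sqrtAbs V) A) : IsSandwich V R A := by
  intro f g hg
  filter_upwards [hA f, hR g, ae_star_nonneg] with p h1 h2 h3
  rw [h1, h2]
  exact congrArg (signedSqrt V p * ·) (resolventFun_congr hg h3).symm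

/-- A bounded operator that vanishes on the functions supported in `{|V| ≤ N}`, for every `N`, is
zero. -/
theorem eq_zero_of_forall_cutoff (hV : FirstMoment V) {B : StarL2 n →L[ℂ] StarL2 n}
    (h : ∀ (N : ℕ) (f f' : StarL2 n),
      (f' =ᵐ[starMeasure n] fun p => if |V p.1 p.2| ≤ N then f p else 0) → B f' = 0) : B = 0 := by
  ext1 x
  -- `k = B† B x` is orthogonal to all these functions
  set k : StarL2 n := ContinuousLinearMap.adjoint B (B x) with hk
  have hmeas : ∀ N : ℕ, AEStronglyMeasurable
      (fun p : Fin n × ℝ => if |V p.1 p.2| ≤ N then (1 : ℂ) else 0) (starMeasure n) := fun N => by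
    refine aestronglyMeasurable_star_iff.2 fun j => ?_
    have hm : Measurable fun r : ℝ => if |r| ≤ N then (1 : ℂ) else 0 :=
      Measurable.ite (measurableSet_le measurable_norm measurable_const) measurable_const
        measurable_const
    exact (hm.comp_aemeasurable
      (aestronglyMeasurable_of_moment (hV j)).aemeasurable).aestronglyMeasurable
  have hN : ∀ N : ℕ, ∀ᵐ p ∂starMeasure n, |V p.1 p.2| ≤ N → k p = 0 := fun N => by
    obtain ⟨T, hT⟩ := exists_mulOp (hmeas N) zero_le_one fun p => by split_ifs <;> simp
    have e1 : ⟪T k, T k⟫_ℂ = ⟪k, T k⟫_ℂ := by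
      rw [L2.inner_def, L2.inner_def]
      refine integral_congr_ae ?_
      filter_upwards [hT k] with p hp
      rw [hp]
      split_ifs <;> simp
    have e2 : B (T k) = 0 := h N k (T k) (by
      filter_upwards [hT k] with p hp
      rw [hp]
      split_ifs <;> simp)
    have e3 : ⟪k, T k⟫_ℂ = 0 := by
      rw [hk, ContinuousLinearMap.adjoint_inner_left, ← hk, e2, inner_zero_right]
    rw [e3, inner_self_eq_zero] at e1
    have e4 := hT k
    rw [e1] at e4
    filter_upwards [e4, Lp.coeFn_zero ℂ 2 (starMeasure n)] with p h1 h2 h3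
    rw [h2, if_pos h3, one_mul] at h1
    exact h1.symm
  have hk0 : k = 0 := by
    ext1
    filter_upwards [ae_all_iff.2 hN, Lp.coeFn_zero ℂ 2 (starMeasure n)] with p h1 h2
    obtain ⟨N, hN⟩ := exists_nat_ge |V p.1 p.2|
    rw [h1 N hN, h2]
    rfl
  have h5 : ⟪B x, B x⟫_ℂ = 0 := by
    rw [← ContinuousLinearMap.adjoint_inner_left, ← hk, hk0, inner_zero_left]
  exact inner_self_eq_zero.1 h5

/-- The functions `f` with `√|V| f ∈ L₂` are dense, so that the sandwiched resolvent is unique. -/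
theorem IsSandwich.unique (hV : FirstMoment V) {R A A' : StarL2 n →L[ℂ] StarL2 n}
    (h : IsSandwich V R A) (h' : IsSandwich V R A') : A = A' := by
  refine sub_eq_zero.1 (eq_zero_of_forall_cutoff hV fun N f f' hf => ?_)
  have hmeas : AEStronglyMeasurable
      (fun p : Fin n × ℝ => if |V p.1 p.2| ≤ N then sqrtAbs V p else 0) (starMeasure n) := by
    refine aestronglyMeasurable_star_iff.2 fun j => ?_
    have hm : Measurable fun r : ℝ => if |r| ≤ N then (Real.sqrt |r| : ℂ) else 0 :=
      Measurable.ite (measurableSet_le measurable_norm measurable_const)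
        (Complex.measurable_ofReal.comp (Real.continuous_sqrt.measurable.comp measurable_norm))
        measurable_const
    exact (hm.comp_aemeasurable
      (aestronglyMeasurable_of_moment (hV j)).aemeasurable).aestronglyMeasurable
  obtain ⟨T, hT⟩ := exists_mulOp hmeas (Real.sqrt_nonneg N) fun p => by
    split_ifs with hp
    · rw [sqrtAbs, Complex.norm_real, Real.norm_of_nonneg (Real.sqrt_nonneg _)]
      exact Real.sqrt_le_sqrt hp
    · simp
  have hg : T f =ᵐ[starMeasure n] fun p => (Real.sqrt |V p.1 p.2| : ℂ) * f' p := by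
    filter_upwards [hT f, hf] with p h1 h2
    rw [h1, h2]
    split_ifs
    · rfl
    · simp
  have : A f' = A' f' := by
    ext1
    exact (h f' (T f) hg).trans (h' f' (T f) hg).symm
  rw [sub_apply, this, sub_self]

theorem IsPerturbationDet.unique (hV : FirstMoment V) {z d d' : ℂ} (h : IsPerturbationDet V z d)
    (h' : IsPerturbationDet V z d') : d = d' := by
  obtain ⟨R, A, hR, hA, -, hd⟩ := h
  obtain ⟨R', A', hR', hA', -, hd'⟩ := h'
  obtain rfl := hR.unique hR'
  obtain rfl := hA.unique hV hA'
  exact tendsto_nhds_unique hd hd'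

theorem IsPerturbationDet.perturbationDet_eq (hV : FirstMoment V) {z d : ℂ}
    (h : IsPerturbationDet V z d) : perturbationDet V z = d := by
  have hex : ∃ d, IsPerturbationDet V z d := ⟨d, h⟩
  rw [perturbationDet, dif_pos hex]
  exact hex.choose_spec.unique hV h

/-- The perturbation determinant in terms of the Jost functions. -/
theorem isPerturbationDet_vertexSum (hn : n ≠ 0) (hV : FirstMoment V) {ζ : ℂ} (hζ : 0 < ζ.im) :
    IsPerturbationDet V (ζ ^ 2) (Complex.I / (n * ζ) *
      vertexSum (fun j => jost ζ (fun y => (V j y : ℂ)) 0)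
        fun j => jostDeriv ζ fun y => (V j y : ℂ)) := by
  have ha := memLp_signedSqrt hV
  have hb := memLp_sqrtAbs hV
  obtain ⟨R, hR⟩ := exists_resolventOp (n := n) hζ
  obtain ⟨A, hA, hτ⟩ := exists_weightedResolvent hζ ha hb
  obtain ⟨d₀, hd₀⟩ := hτ.exists_tendsto
  have hex := fun k : ℕ => exists_weightedResolvent hζ (memLp_cutoff ha k) (memLp_cutoff hb k)
  choose Ak hAk _ using hex
  set Vk : ℕ → Fin n → ℝ → ℂ := fun k j y => if y < k then (V j y : ℂ) else 0 with hVk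
  have hcut0 : ∀ (k : ℕ) (c : Fin n × ℝ → ℂ) (p : Fin n × ℝ), (k : ℝ) ≤ p.2 → cutoff k c p = 0 :=
    fun k c p hp => if_neg hp.not_gt
  have hd := fun k : ℕ => tendsto_compressedDet_of_truncated hζ (memLp_cutoff ha k)
    (memLp_cutoff hb k) (R := k) (Nat.cast_nonneg k) (hcut0 k _) (hcut0 k _) (hAk k) (V := Vk k)
    (g := fun j => jost ζ (Vk k j))
    (fun p => by
      simp only [cutoff, hVk]
      split_ifs
      · exact signedSqrt_mul_sqrtAbs p
      · exact zero_mul 0)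
    (fun j => isJost_jost (isDominated_truncated (hV j) k) (isMajorant_edgeMajorant (hV j)) hζ.le)
  have hlim := tendsto_fredholmDet_cutoff hζ ha hb hA hτ hAk hd hd₀
  have hpt : ∀ j y, 0 < y → Tendsto (fun k : ℕ => Vk k j y) atTop (𝓝 (V j y : ℂ)) :=
    fun j y _ => by
      refine tendsto_const_nhds.congr' ?_
      obtain ⟨k, hk⟩ := exists_nat_gt y
      filter_upwards [eventually_ge_atTop k] with m hm
      exact (if_pos (hk.trans_le (by exact_mod_cast hm))).symm
  have hg : ∀ j, Tendsto (fun k : ℕ => jost ζ (Vk k j) 0) atTop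
      (𝓝 (jost ζ (fun y => (V j y : ℂ)) 0)) := fun j =>
    tendsto_jost (ζ := fun _ => ζ) (isMajorant_edgeMajorant (hV j))
      (isDominated_truncated (hV j)) (Eventually.of_forall fun _ => hζ.le) tendsto_const_nhds
      (hpt j) le_rfl
  have hw : ∀ j, Tendsto (fun k : ℕ => jostSlope ζ (Vk k j) 0) atTop
      (𝓝 (jostSlope ζ (fun y => (V j y : ℂ)) 0)) := fun j =>
    tendsto_jostSlope (ζ := fun _ => ζ) (isMajorant_edgeMajorant (hV j))
      (isDominated_truncated (hV j)) (Eventually.of_forall fun _ => hζ.le) tendsto_const_nhds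
      (hpt j) le_rfl
  have hlim' := (tendsto_finsetProd Finset.univ fun j _ => hg j).add
    ((tendsto_finsetSum Finset.univ fun j _ => (hw j).mul
      (tendsto_finsetProd (Finset.univ.erase j) fun k _ => hg k)).const_mul
        (Complex.I / (n * ζ)))
  have heq := tendsto_nhds_unique hlim hlim'
  have hζ0 : ζ ≠ 0 := by
    rintro rfl
    simp at hζ
  have hn0 : (n : ℂ) ≠ 0 := by exact_mod_cast hn
  have hfin : d₀ = Complex.I / (n * ζ) * vertexSum (fun j => jost ζ (fun y => (V j y : ℂ)) 0)
      fun j => jostDeriv ζ fun y => (V j y : ℂ) := by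
    have h1 : vertexSum (fun j => jost ζ (fun y => (V j y : ℂ)) 0)
        (fun j => jostDeriv ζ fun y => (V j y : ℂ)) =
        ∑ j, jostSlope ζ (fun y => (V j y : ℂ)) 0 *
          ∏ k ∈ Finset.univ.erase j, jost ζ (fun y => (V k y : ℂ)) 0 -
        n * (Complex.I * ζ * ∏ j, jost ζ (fun y => (V j y : ℂ)) 0) := by
      have h2 : (n : ℂ) * (Complex.I * ζ * ∏ j, jost ζ (fun y => (V j y : ℂ)) 0) =
          ∑ _j : Fin n, Complex.I * ζ * ∏ j, jost ζ (fun y => (V j y : ℂ)) 0 := by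
        simp
      rw [h2, vertexSum, ← Finset.sum_sub_distrib]
      refine Finset.sum_congr rfl fun j _ => ?_
      rw [jostDeriv, ← Finset.mul_prod_erase Finset.univ
        (fun j => jost ζ (fun y => (V j y : ℂ)) 0) (Finset.mem_univ j)]
      ring
    rw [heq, h1]
    field_simp
    linear_combination (n * ζ * ∏ j, jost ζ (fun y => (V j y : ℂ)) 0) * Complex.I_sq
  exact ⟨R, A, isResolvent_resolventOp hn hζ hR, hA.isSandwich hR, hτ.isTraceClass, hfin ▸ hd₀⟩

end PerturbationDeterminant

end StarGraph

end

open StarGraph in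
theorem proposition4p1 (n : ℕ) (hn : 2 ≤ n) (V : Fin n → ℝ → ℝ) (hV : FirstMoment V)
    (hV2 : resonanceMultiplicity V = 1 → SecondMoment V) :
    FiniteDimensional ℂ (zeroEnergySpace V) ∧
    (∀ ζ : ℂ, 0 < ζ.im → ∃! d : ℂ, IsPerturbationDet V (ζ ^ 2) d) ∧
    ∃ c : ℂ, c ≠ 0 ∧
      (fun ζ : ℂ => perturbationDet V (ζ ^ 2)) ~[𝓝[{ζ : ℂ | 0 < ζ.im}] 0]
        (fun ζ : ℂ => c * ζ ^ ((resonanceMultiplicity V : ℤ) - 1)) := by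
  have hn0 : n ≠ 0 := by omega
  have hnC : (n : ℂ) ≠ 0 := by exact_mod_cast hn0
  have : Nonempty (Fin n) := ⟨⟨0, by omega⟩⟩
  refine ⟨finiteDimensional_zeroEnergySpace hV, fun ζ hζ =>
    ⟨_, isPerturbationDet_vertexSum hn0 hV hζ, fun d hd =>
      hd.unique hV (isPerturbationDet_vertexSum hn0 hV hζ)⟩, ?_⟩
  have hd := fun j => isDominated_edgeMajorant (hV j)
  have hm := fun j => isMajorant_edgeMajorant (hV j)
  have hr : ∀ j y, conj ((V j y : ℝ) : ℂ) = (V j y : ℂ) := fun j y => Complex.conj_ofReal _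
  obtain ⟨c, hc, hlim⟩ := exists_tendsto_vertexSum (a := jostValue V) (β := jostSlopeValue V)
    eventually_upperNhdsZero_ne tendsto_upperNhdsZero
    (fun j => tendsto_jost_zero (hd j) (hm j)) (fun j => tendsto_jostDeriv_zero (hd j) (hm j))
    (fun j => tendsto_jost_wronskian (hd j) (hm j)) (fun j => jostSlope_ne_zero_of_jost_eq_zero (hd j) (hm j))
    (fun j => conj_jost (hd j) (hm j) (hr j) le_rfl)
    (fun j => conj_jostSlope (hd j) (hm j) (hr j) le_rfl)
  have hc' : Complex.I / n * c ≠ 0 := mul_ne_zero (div_ne_zero Complex.I_ne_zero hnC) hc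
  refine ⟨Complex.I / n * c, hc', ?_⟩
  rw [isEquivalent_iff_tendsto_one (eventually_upperNhdsZero_ne.mono fun ζ hζ =>
    mul_ne_zero hc' (zpow_ne_zero _ hζ))]
  have h1 := hlim.div_const c
  rw [div_self hc] at h1
  refine h1.congr' ?_
  filter_upwards [eventually_upperNhdsZero, eventually_upperNhdsZero_ne] with ζ hζ hζ0
  rw [Pi.div_apply, (isPerturbationDet_vertexSum hn0 hV hζ).perturbationDet_eq hV,
    resonanceMultiplicity_eq hV, zpow_sub_one₀ hζ0, zpow_natCast]
  have hp : ζ ^ Module.finrank ℂ (vertexSpace (jostValue V) (jostSlopeValue V)) ≠ 0 :=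
    pow_ne_zero _ hζ0
  field_simp
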